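/- **Conventions.** $\mathbb N=\{1,2,\dots\}$. Finite multisets of positive integers are ordered by $A\prec B$ iff $\Sigma(A)<\Sigma(B)$, or $\Sigma(A)=\Sigma(B)$ and at the smallest integer whose multiplicities in $A$ and $B$ differ the multiplicity in $A$ is smaller; here $\Sigma(A)$ is the sum of the elements of $A$ with multiplicity. $M_j$ is the $j$-th multiset in this order ($M_1=\emptyset$), and $z^{A}=\prod_{k\in A}z_k$. For real $x$, $\langle x\rangle$ is the unique $k\in\mathbb N$ with $x-\lfloor x\rfloor\in[1-2^{-k+1},1-2^{-k})$. A *graphon* is a symmetric measurable $W:[0,1)^2\to[0,1]$, and for a graph $H$ on $\{1,\dots,n\}$, $$\tau(H,W)=\int_{[0,1)^n}\prod_{ij\in E(H)}W(x_i,x_j)\prod_{ij\notin E(H)}(1-W(x_i,x_j))\,dx ,$$ the products being over unordered pairs $i\ne j$. **Totally analytic.** $f:[0,1]^{\mathbb N}\to\mathbb R$ is totally analytic if (i) for every finite multiset $M$ of positive integers the partial derivative $\partial^{|M|}f/(\partial z)^M$ exists on $[0,1]^{\mathbb N}$ (one-sided on the boundary, independent of the order of differentiation) and is continuous in the product topology;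 (ii) for every $n$ and every fixed $(z_{n+1},z_{n+2},\dots)\in[0,1]^{\mathbb N\setminus[n]}$ the function $(z_1,\dots,z_n)\mapsto f(z)$ extends to an analytic function on an open set containing $[0,1]^n$. **Bounding sequence.** $P=(p_i,l_i,u_i)_{i\in\mathbb N}$, where $p_i$ is a real polynomial in finitely many of the $z_k$ with coefficient $\pi_{i,j}$ at $z^{M_j}$, such that on $[0,1]^{\mathbb N}$ we have $p_i\in[0,1]$ and all first partial derivatives of $p_i$ lie in $[-1,1]$; $|\pi_{i,j}|\le 2^{-2^j}/9$; and $0\le l_i\le u_i\le1$. Write $\pi^+=\max(\pi,0)$, $\pi^-=\max(-\pi,0)$. A point $z\in[0,1]^{\mathbb N}$ is *feasible* if $p_i(z)\in[l_i,u_i]$ for all $i$. **The graphon $W_F$ (depending on $P$).** On $[0,2/3)^2\setminus[1/3,2/3)^2$ it is $1$ if $x,y\in[1/6,1/3)$ and $\langle3x\rangle=\langle3y\rangle$, or if $x\in[1/3,2/3)$, $y\in[1/6,1/3)$ and $M_{\langle3x\rangle}\in\{M_{\langle3y\rangle}\setminus\{m\},\{m\}\}$ with $m=\min M_{\langle 3y\rangle}$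 (one copy of $m$ is removed), or symmetrically; otherwise $0$. For $x\in[2/3,1)$ it is $9\cdot2^{2\langle3y\rangle}\pi^+_{\langle3x\rangle,\langle3y\rangle}$ if $y\in[0,1/3)$ and $9\cdot2^{2\langle3y\rangle}\pi^-_{\langle3x\rangle,\langle3y\rangle}$ if $y\in[1/3,2/3)$, and symmetrically for $y\in[2/3,1)$. On $[1/3,2/3)^2$ it is $1-u_{\langle3x\rangle}$, and on $[2/3,1)^2$ it is $l_{\langle3x\rangle}$, if $\langle3x\rangle=\langle3y\rangle$, and $0$ otherwise. **Host graphon.** $W_0$ is any graphon that contains $W_F$ in its seventh tile: with $\iota^0_k(x)=(k+x)/13$, $k=0,\dots,6$, we have $W_0(\iota^0_6(x),\iota^0_6(y))=W_F(x,y)$ for all $x,y\in[0,1)$. (The finitely forcible graphon of the Cooper–Král'–Martins theorem that contains $W_F$ is one such $W_0$; nothing else about $W_0$ is assumed.) **The graphon $W_P(z)$, $z\in[0,1]^{\mathbb N}$.** Split $[0,1)$ from left to right into intervals ("parts") $A,B,C,D_0,\dots,D_6,E,F,Q,R$, of length $1/25$ except $|Q|=12/25$; let $\iota_X:[0,1)\to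 X$ be the increasing affine bijection. The value $W_P(z)(\iota_X(x),\iota_Y(y))$ is as follows (symmetric tiles are omitted; it is $0$ where nothing is said). - $A\times Y$, $Y\in\{A,B,C,D_0,\dots,D_6,E\}$: $1$ if $\lfloor3x\rfloor=\lfloor3y\rfloor$. - $B\times Y$, $Y\in\{B,C,D_0,\dots,D_6,E\}$: $1$ if $\lfloor3x\rfloor=\lfloor3y\rfloor$ and $\langle3x\rangle=\langle3y\rangle$. - $C\times C$, for $x,y<2/3$ with $\langle3x\rangle=\langle3y\rangle=k$: $z^{M_k}$ if $\lfloor3x\rfloor=\lfloor3y\rfloor$, and $1-z^{M_k}$ otherwise. - $C\times D_0$: $1$ if $x\in[0,\frac13)$, $y\in[\frac13,\frac23)$, $\langle3x\rangle=\langle3y\rangle$. $C\times D_1$: $1$ if $x\in[0,\frac13)$, $y\in[\frac23,1)$, $\langle3x\rangle=\langle3y\rangle$. $C\times D_2$: $1$ if $x,y\in[0,\frac16)$. $C\times D_6$: $W_F(x,y)$ on $[0,\frac13)\times[0,\frac23)\cup[0,\frac23)\times[\frac23,1)$. - $C\times E$, with $k=\langle3x\rangle$, $a=2^k(3y-1)+2$,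 $b=2^k(3y-2)+2$: $1$ if $x,y\in[0,\frac13)$, $0\le a\le p_k(z)$; or $x\in[0,\frac13)$, $y\in[\frac13,\frac23)$, $0\le b\le1-p_k(z)$; or $x\in[\frac13,\frac23)$, $y\in[0,\frac13)$, $p_k(z)\le a\le1$; or $x,y\in[\frac13,\frac23)$, $1-p_k(z)\le b\le1$. - $D_i\times D_j$: $W_0(\iota^0_i(x),\iota^0_j(y))$. - $D_6\times E$, for $y\in[0,\frac13)$ and $\langle3x\rangle=\langle3y\rangle=k$: $1$ if $x\in[\frac13,\frac23)$ and $2^k(3y-1)+2\le u_k$, or if $x\in[\frac23,1)$ and $2^k(3y-1)+2\le l_k$. - $Y\times F$, $Y\in\{A,B,D_0,\dots,D_6,F\}$: $1$ if $x+y\ge1$. - $X\times Q$, $X$ one of the twelve parts $A,\dots,F$: $\frac1{12}\bigl(12-\sum_{Z}\int_0^1W_P(z)(\iota_X(x),\iota_Z(s))\,ds\bigr)$, the sum being over these twelve parts. - $Q\times Q$ and $Q\times R$: $1$. $X\times R$, $X$ the $k$-th of the twelve parts $A,\dots,F$: $k/25$. $R\times R$: $0$. **The function $t_{P,H}$ (for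 a given $W_0$).** Consider the following pieces $c$. Each has an interval $I_c$ and a polynomial $\mu_c$. - Each part $X\notin\{C,E\}$: $I_c=X$, $\mu_c=|X|$. - $C_{k,j}$, $j\in\{0,1,2\}$: $I_c=\{\iota_C(x):\lfloor3x\rfloor=j,\langle3x\rangle=k\}$, $\mu_c=2^{-k}/75$. - $E_{k,0,r}$, $r=0,1,2,3$: $I_c$ is the set of $\iota_E(y)$ with $\lfloor3y\rfloor=0$, $\langle3y\rangle=k$ and $2^k(3y-1)+2$ in $[0,l_k)$, $[l_k,u_k)$, $[l_k,u_k)$, $[u_k,1)$, respectively; $\mu_c$ is $2^{-k}/75$ times $l_k$, $p_k-l_k$, $u_k-p_k$, $1-u_k$, respectively. - $E_{k,1,r}$, $r=0,1$: $I_c=\{\iota_E(y):\lfloor3y\rfloor=1,\langle3y\rangle=k\}$, and $\mu_c$ is $2^{-k}/75$ times $1-p_k$, $p_k$, respectively. - $E_{k,2}$: $I_c=\{\iota_E(y):\lfloor3y\rfloor=2,\langle3y\rangle=k\}$, $\mu_c=2^{-k}/75$. For two pieces of $C\cup E$ let $e_{c,c'}=e_{c',c}$ be the following polynomial: $e=z^{M_k}$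 for $C_{k,j},C_{k,j}$ with $j\in\{0,1\}$; $e=1-z^{M_k}$ for $C_{k,0},C_{k,1}$; $e=1$ for the pairs $C_{k,0},E_{k,0,r}$ with $r\le1$, $C_{k,1},E_{k,0,r}$ with $r\ge2$, $C_{k,0},E_{k,1,0}$ and $C_{k,1},E_{k,1,1}$; $e=0$ for all other pairs. For a graph $H$ on $\{1,\dots,n\}$ and an assignment $L$ of pieces to its vertices, let $s_L$ be the probability that, for independent uniform $x_v\in I_{L(v)}$ (the endpoint if $I_{L(v)}$ is empty), the $W_P(0)$-random graph on $x_1,\dots,x_n$ agrees with $H$ on all pairs of vertices that are not both assigned to pieces of $C\cup E$. Put $$q_L(z)=s_L\prod_v\mu_{L(v)}(z)\prod_{ij\in E(H)}e_{L(i),L(j)}(z)\prod_{ij\notin E(H)}\bigl(1-e_{L(i),L(j)}(z)\bigr),$$ the last two products being over pairs of vertices both assigned to pieces of $C\cup E$. Let $\alpha_{P,i}$ be the sum over all $L$ of the coefficients of $q_L$ at $z^{M_i}$, and let $$t_{P,H}(z)=\sum_{i=1}^\infty\alpha_{P,i}\,z^{M_i}.$$ **Statement.** Let $H$ be a finite graph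 on $\{1,\dots,n\}$, $P$ a bounding sequence and $W_0$ a host graphon for $P$ as above. Then $W_P(z)$ is a graphon for every $z\in[0,1]^{\mathbb N}$; the series defining $\alpha_{P,i}$, $i\in\mathbb N$, and $t_{P,H}(z)$, $z\in[0,1]^{\mathbb N}$, converge absolutely; the function $t_{P,H}:[0,1]^{\mathbb N}\to\mathbb R$ is totally analytic; and $t_{P,H}(z)=\tau(H,W_P(z))$ for every $z\in[0,1]^{\mathbb N}$ with $p_i(z)\in[l_i,u_i]$ for all $i\in\mathbb N$. -/

import Mathlib

open Set MeasureTheory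

namespace GraphonFamily

noncomputable section

open scoped Classical

/-! ### Totally analytic functions on the Hilbert cube -/

/-- The cube `[0,1]^ℕ`, coordinates indexed by the positive integers, with the product topology. -/
abbrev Cube : Type := ℕ+ → Icc (0 : ℝ) 1

/-- The real coordinates of a point of the cube. -/
def Cube.val (z : Cube) : ℕ+ → ℝ := fun k => (z k : ℝ)

/-- `d` is the partial derivative of `f` at `z` in the `j`-th coordinate
(one-sided if `z j` is `0` or `1`). -/
def HasPartialDerivAt (f : Cube → ℝ) (j : ℕ+) (d : ℝ) (z : Cube) : Prop :=
  HasDerivWithinAt (fun s : ℝ => f (Function.update z j (projIcc 0 1 zero_le_one s)))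
    d (Icc 0 1) (z j)

/-- Replace the first `n` coordinates of `z` by `x`. -/
def replaceFirst (n : ℕ) (x : Fin n → Icc (0 : ℝ) 1) (z : Cube) : Cube :=
  fun k => if h : k.natPred < n then x ⟨k.natPred, h⟩ else z k

/-- Total analyticity: all iterated partial derivatives (indexed by finite multisets) exist and are
continuous in the product topology, and for every fixed tail the function of the first `n`
coordinates extends to an analytic function on an open set containing `[0,1]^n`. -/
structure TotallyAnalytic (f : Cube → ℝ) : Prop where
  partials : ∃ D : Multiset ℕ+ → Cube → ℝ, D 0 = f ∧
    (∀ (M : Multiset ℕ+) (j : ℕ+) (z : Cube), HasPartialDerivAt (D M) j (D (j ::ₘ M) z) z) ∧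
    ∀ M : Multiset ℕ+, Continuous (D M)
  analytic : ∀ (n : ℕ) (z₀ : Cube), ∃ (U : Set (Fin n → ℝ)) (g : (Fin n → ℝ) → ℝ),
    IsOpen U ∧ Icc 0 1 ⊆ U ∧ AnalyticOnNhd ℝ g U ∧
    ∀ x : Fin n → Icc (0 : ℝ) 1, g (fun i => (x i : ℝ)) = f (replaceFirst n x z₀)

/-! ### The enumeration `M₁, M₂, …` of finite multisets of positive integers

A finite multiset `A` of positive integers is represented by its multiplicity function
`ℕ+ →₀ ℕ`, so that it is also the exponent of the monomial `z^A`. -/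

/-- The sum `Σ(A)` of the elements of a multiset. -/
def msum (A : ℕ+ →₀ ℕ) : ℕ := A.sum fun n c => (n : ℕ) * c

/-- The strict part of the linear order on finite multisets of positive integers. -/
def Prec (A B : ℕ+ →₀ ℕ) : Prop :=
  msum A < msum B ∨ (msum A = msum B ∧ ∃ n : ℕ+, (∀ k < n, A k = B k) ∧ A n < B n)

theorem prec_irrefl (A : ℕ+ →₀ ℕ) : ¬ Prec A A := by
  rintro (h | ⟨_, n, _, h⟩) <;> exact lt_irrefl _ h

theorem prec_trans {A B C : ℕ+ →₀ ℕ} (h₁ : Prec A B) (h₂ : Prec B C) : Prec A C := by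
  rcases h₁ with h₁ | ⟨e₁, n, a₁, l₁⟩ <;> rcases h₂ with h₂ | ⟨e₂, m, a₂, l₂⟩
  · exact Or.inl (h₁.trans h₂)
  · exact Or.inl (e₂ ▸ h₁)
  · exact Or.inl (e₁ ▸ h₂)
  · refine Or.inr ⟨e₁.trans e₂, min n m, fun k hk => ?_, ?_⟩
    · rw [a₁ k (hk.trans_le (min_le_left _ _)), a₂ k (hk.trans_le (min_le_right _ _))]
    · rcases lt_trichotomy n m with h | h | h
      · rw [min_eq_left h.le, ← a₂ n h]; exact l₁
      · subst h; rw [min_self]; exact l₁.trans l₂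
      · rw [min_eq_right h.le, a₁ m h]; exact l₂

theorem prec_total {A B : ℕ+ →₀ ℕ} (h : A ≠ B) : Prec A B ∨ Prec B A := by
  rcases lt_trichotomy (msum A) (msum B) with h₁ | h₁ | h₁
  · exact Or.inl (Or.inl h₁)
  · have hne : ∃ n : ℕ+, A n ≠ B n := by
      by_contra hc
      push Not at hc
      exact h (Finsupp.ext hc)
    have hmin := PNat.find_spec hne
    have hlt : ∀ k < PNat.find hne, A k = B k := fun k hk => by
      by_contra hc
      exact PNat.find_min hne hk hc
    rcases lt_or_gt_of_ne hmin with h₂ | h₂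
    · exact Or.inl (Or.inr ⟨h₁, _, hlt, h₂⟩)
    · exact Or.inr (Or.inr ⟨h₁.symm, _, fun k hk => (hlt k hk).symm, h₂⟩)
  · exact Or.inr (Or.inl h₁)

theorem mul_le_msum (A : ℕ+ →₀ ℕ) (n : ℕ+) : (n : ℕ) * A n ≤ msum A := by
  by_cases h : n ∈ A.support
  · exact Finset.single_le_sum (f := fun n : ℕ+ => (n : ℕ) * A n) (fun _ _ => Nat.zero_le _) h
  · rw [Finsupp.notMem_support_iff.mp h]; simp

theorem finite_prec (A : ℕ+ →₀ ℕ) : {B | Prec B A}.Finite := by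
  let N : ℕ := msum A
  let T : Finset ℕ+ := Finset.Icc 1 (N.succPNat)
  refine ((Finset.finite_toSet (T.finsupp fun _ => Finset.range (N + 1)))).subset ?_
  intro B hB
  have hs : msum B ≤ N := by
    rcases hB with h | ⟨h, -⟩
    · exact h.le
    · exact h.le
  have hb := mul_le_msum B
  rw [Finset.mem_coe, Finset.mem_finsupp_iff]
  refine ⟨fun n hn => ?_, fun n _ => ?_⟩
  · have h1 : 1 ≤ B n := Nat.one_le_iff_ne_zero.mpr (Finsupp.mem_support_iff.mp hn)
    have h2 : (n : ℕ) ≤ N := by nlinarith [hb n]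
    refine Finset.mem_Icc.mpr ⟨one_le, ?_⟩
    rw [← PNat.coe_le_coe, Nat.succPNat_coe]
    omega
  · have h3 : 1 ≤ (n : ℕ) := n.pos
    have h4 : B n ≤ N := by nlinarith [hb n]
    exact Finset.mem_range.mpr (by omega)

/-- The (zero-based) position of a multiset in the linear order. -/
def rank (A : ℕ+ →₀ ℕ) : ℕ := {B | Prec B A}.ncard

theorem rank_lt {A B : ℕ+ →₀ ℕ} (h : Prec A B) : rank A < rank B := by
  refine Set.ncard_lt_ncard ?_ (finite_prec B)
  refine ⟨fun C hC => prec_trans hC h, fun hsub => ?_⟩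
  exact prec_irrefl A (hsub h)

theorem rank_injective : Function.Injective rank := by
  intro A B h
  by_contra hne
  rcases prec_total hne with h' | h'
  · exact absurd h (rank_lt h').ne
  · exact absurd h (rank_lt h').ne'

theorem rank_surjective : Function.Surjective rank := by
  intro n
  obtain ⟨A, hA⟩ : ∃ A, n < rank A := by
    have hinf : (Set.range rank).Infinite := Set.infinite_range_of_injective rank_injective
    obtain ⟨_, ⟨A, rfl⟩, hA⟩ := hinf.exists_gt n
    exact ⟨A, hA⟩
  have him : rank '' {B | Prec B A} ⊆ Set.Iio (rank A) := by
    rintro _ ⟨B, hB, rfl⟩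
    exact rank_lt hB
  have heq : rank '' {B | Prec B A} = Set.Iio (rank A) := by
    refine Set.eq_of_subset_of_ncard_le him ?_ (Set.finite_Iio _)
    rw [Set.ncard_image_of_injective _ rank_injective]
    have : (Set.Iio (rank A)).ncard = rank A := by
      rw [← Nat.card_coe_set_eq]; simp
    rw [this]; exact le_rfl
  obtain ⟨B, -, hB⟩ : n ∈ rank '' {B | Prec B A} := heq ▸ hA
  exact ⟨B, hB⟩

/-- `multiset j` is `M_j`, the `j`-th multiset in the linear order (`M₁ = ∅`). -/
def multiset (j : ℕ+) : ℕ+ →₀ ℕ :=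
  (Equiv.ofBijective rank ⟨rank_injective, rank_surjective⟩).symm j.natPred

/-- The value `z^A` of the monomial with exponent `A`. -/
def monomialValue (A : ℕ+ →₀ ℕ) (z : Cube) : ℝ := A.prod fun k e => z.val k ^ e

/-! ### Bounding sequences -/

/-- A bounding sequence `(p_i, l_i, u_i)`, `i` a positive integer. -/
structure BoundingSequence where
  p : ℕ+ → MvPolynomial ℕ+ ℝ
  l : ℕ+ → ℝ
  u : ℕ+ → ℝ
  p_mem : ∀ (i : ℕ+) (z : Cube), MvPolynomial.eval z.val (p i) ∈ Icc (0 : ℝ) 1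
  coeff_le : ∀ i j : ℕ+, |(p i).coeff (multiset j)| ≤ (1 / 2 : ℝ) ^ (2 ^ (j : ℕ)) / 9
  pderiv_mem : ∀ (i k : ℕ+) (z : Cube),
    MvPolynomial.eval z.val (MvPolynomial.pderiv k (p i)) ∈ Icc (-1 : ℝ) 1
  l_mem : ∀ i, l i ∈ Icc (0 : ℝ) 1
  u_mem : ∀ i, u i ∈ Icc (0 : ℝ) 1
  l_le_u : ∀ i, l i ≤ u i

namespace BoundingSequence

variable (P : BoundingSequence)

/-- The value `p_i(z)`. -/
def pval (i : ℕ+) (z : Cube) : ℝ := MvPolynomial.eval z.val (P.p i)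

/-- The coefficient `π_{i,j}` of `p_i` at `z^{M_j}`. -/
def coeff (i j : ℕ+) : ℝ := (P.p i).coeff (multiset j)

/-- The positive part of `π_{i,j}`. -/
def coeffPos (i j : ℕ+) : ℝ := max (P.coeff i j) 0

/-- The negative part of `π_{i,j}`. -/
def coeffNeg (i j : ℕ+) : ℝ := max (-P.coeff i j) 0

/-- `z` satisfies all the constraints `p_i(z) ∈ [l_i, u_i]`. -/
def Feasible (z : Cube) : Prop := ∀ i, P.pval i z ∈ Icc (P.l i) (P.u i)

end BoundingSequence

/-! ### Graphons and labeled densities -/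

/-- A graphon: a symmetric measurable function `[0,1)² → [0,1]`. Only the values of `W` on
`[0,1)²` are relevant. -/
structure IsGraphon (W : ℝ → ℝ → ℝ) : Prop where
  measurable : Measurable fun q : Ico (0 : ℝ) 1 × Ico (0 : ℝ) 1 => W q.1 q.2
  symm : ∀ x ∈ Ico (0 : ℝ) 1, ∀ y ∈ Ico (0 : ℝ) 1, W x y = W y x
  mem : ∀ x ∈ Ico (0 : ℝ) 1, ∀ y ∈ Ico (0 : ℝ) 1, W x y ∈ Icc (0 : ℝ) 1

/-- The pairs of distinct vertices, each listed once. -/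
def vertexPairs (n : ℕ) : Finset (Fin n × Fin n) :=
  Finset.univ.filter fun q => q.1 < q.2

/-- The unit cube `[0,1)^n`. -/
def unitBox (n : ℕ) : Set (Fin n → ℝ) := Set.univ.pi fun _ => Ico (0 : ℝ) 1

/-- The labeled density `τ(H, W)`. -/
def labeledDensity {n : ℕ} (H : SimpleGraph (Fin n)) (W : ℝ → ℝ → ℝ) : ℝ :=
  ∫ x in unitBox n, ∏ q ∈ vertexPairs n,
    if H.Adj q.1 q.2 then W (x q.1) (x q.2) else 1 - W (x q.1) (x q.2)

/-! ### The auxiliary graphon `W_F` -/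

/-- The interval `J_k = [1 - 2^{-k+1}, 1 - 2^{-k})`. -/
def J (k : ℕ+) : Set ℝ := Ico (1 - 2 * (1 / 2 : ℝ) ^ (k : ℕ)) (1 - (1 / 2 : ℝ) ^ (k : ℕ))

/-- The unique `k` such that `x - ⌊x⌋ ∈ J_k`, see `coord_eq_iff`. -/
def coord (x : ℝ) : ℕ+ := (Nat.log 2 ⌊(1 - Int.fract x)⁻¹⌋₊).succPNat

theorem coord_eq_iff (x : ℝ) (k : ℕ+) : coord x = k ↔ Int.fract x ∈ J k := by
  obtain ⟨m, rfl⟩ : ∃ m : ℕ, k = m.succPNat := ⟨k.natPred, (PNat.succPNat_natPred k).symm⟩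
  have hf := Int.fract_lt_one x
  set y : ℝ := 1 - Int.fract x with hy
  have hy0 : 0 < y := by linarith
  have hy1 : y ≤ 1 := by have := Int.fract_nonneg x; linarith
  have hfl : ⌊y⁻¹⌋₊ ≠ 0 := by
    have : (1 : ℝ) ≤ y⁻¹ := (one_le_inv₀ hy0).mpr hy1
    have := Nat.floor_pos.mpr this
    omega
  have h1 : coord x = m.succPNat ↔ Nat.log 2 ⌊y⁻¹⌋₊ = m := by
    unfold coord
    exact Nat.succPNat_injective.eq_iff
  have hx : Int.fract x = 1 - y := by rw [hy]; ring
  rw [h1, Nat.log_eq_iff (Or.inr ⟨by norm_num, hfl⟩), hx, Nat.le_floor_iff (by positivity),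
    Nat.floor_lt (by positivity)]
  simp only [J, mem_Ico, Nat.succPNat_coe, Nat.succ_eq_add_one]
  push_cast
  rw [le_inv_comm₀ (by positivity) hy0, inv_lt_comm₀ hy0 (by positivity)]
  simp only [one_div, inv_pow]
  have h2 : 2 * ((2 : ℝ) ^ (m + 1))⁻¹ = ((2 : ℝ) ^ m)⁻¹ := by
    rw [pow_succ]; field_simp
  rw [h2]
  constructor <;> rintro ⟨ha, hb⟩ <;> constructor <;> linarith

/-- With `a = min B`: either `A = B \ {a}` (one copy of `a` removed) or `A = {a}`. -/
def Linked (A B : ℕ+ →₀ ℕ) : Prop :=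
  ∃ a : ℕ+, IsLeast {k : ℕ+ | B k ≠ 0} a ∧
    (A = B - Finsupp.single a 1 ∨ A = Finsupp.single a 1)

/-- The graphon `W_F` on `[0,1)²`. -/
def WF (P : BoundingSequence) (x y : ℝ) : ℝ :=
  if x < 2 / 3 ∧ y < 2 / 3 ∧ ¬ (1 / 3 ≤ x ∧ 1 / 3 ≤ y) then
    if (x ∈ Ico (1 / 6) (1 / 3) ∧ y ∈ Ico (1 / 6) (1 / 3) ∧ coord (3 * x) = coord (3 * y)) ∨
      (x ∈ Ico (1 / 3) (2 / 3) ∧ y ∈ Ico (1 / 6) (1 / 3) ∧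
        Linked (multiset (coord (3 * x))) (multiset (coord (3 * y)))) ∨
      (y ∈ Ico (1 / 3) (2 / 3) ∧ x ∈ Ico (1 / 6) (1 / 3) ∧
        Linked (multiset (coord (3 * y))) (multiset (coord (3 * x))))
    then 1 else 0
  else if 2 / 3 ≤ x ∧ y < 1 / 3 then
    9 * 2 ^ (2 * (coord (3 * y) : ℕ)) * P.coeffPos (coord (3 * x)) (coord (3 * y))
  else if 2 / 3 ≤ x ∧ y < 2 / 3 then
    9 * 2 ^ (2 * (coord (3 * y) : ℕ)) * P.coeffNeg (coord (3 * x)) (coord (3 * y))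
  else if x < 1 / 3 ∧ 2 / 3 ≤ y then
    9 * 2 ^ (2 * (coord (3 * x) : ℕ)) * P.coeffPos (coord (3 * y)) (coord (3 * x))
  else if x < 2 / 3 ∧ 2 / 3 ≤ y then
    9 * 2 ^ (2 * (coord (3 * x) : ℕ)) * P.coeffNeg (coord (3 * y)) (coord (3 * x))
  else if x < 2 / 3 ∧ y < 2 / 3 then
    if coord (3 * x) = coord (3 * y) then 1 - P.u (coord (3 * x)) else 0
  else
    if coord (3 * x) = coord (3 * y) then P.l (coord (3 * x)) else 0

/-! ### The graphons `W_P(z)` -/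

/-- The parts `A, B, C, D_A, …, D_G, E, F`; the parts `D_A, …, D_G` are `D 0, …, D 6`. -/
inductive Core : Type
  | A | B | C
  | D (k : Fin 7)
  | E | F

/-- All fourteen parts. -/
inductive Part : Type
  | core (X : Core)
  | Q | R

/-- The position of a part in the list `A, B, C, D_A, …, D_G, E, F`, starting from `0`. -/
def Core.idx : Core → ℕ
  | .A => 0
  | .B => 1
  | .C => 2
  | .D k => 3 + k
  | .E => 10
  | .F => 11

/-- The left endpoint of a part. -/
def Part.start : Part → ℝ
  | .core X => X.idx / 25
  | .Q => 12 / 25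
  | .R => 24 / 25

/-- The length of a part. -/
def Part.size : Part → ℝ
  | .core _ => 1 / 25
  | .Q => 12 / 25
  | .R => 1 / 25

/-- The linear map `ι_X` from `[0,1)` onto the part `X`. -/
def Part.embed (X : Part) (x : ℝ) : ℝ := X.start + X.size * x

/-- The part containing a point of `[0,1)`. -/
def partOf (s : ℝ) : Part :=
  if s < 1 / 25 then .core .A
  else if s < 2 / 25 then .core .B
  else if s < 3 / 25 then .core .C
  else if h : 3 ≤ ⌊25 * s⌋₊ ∧ ⌊25 * s⌋₊ < 10 then .core (.D ⟨⌊25 * s⌋₊ - 3, by omega⟩)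
  else if s < 11 / 25 then .core .E
  else if s < 12 / 25 then .core .F
  else if s < 24 / 25 then .Q
  else .R

theorem partOf_embed (X : Part) {x : ℝ} (hx : x ∈ Ico (0 : ℝ) 1) : partOf (X.embed x) = X := by
  obtain ⟨h0, h1⟩ := hx
  rcases X with (_ | _ | _ | k | _ | _) | _ | _
  case core.D =>
    have hk : (k : ℕ) < 7 := k.2
    have hk' : ((k : ℕ) : ℝ) < 7 := by exact_mod_cast hk
    have hk0 : (0 : ℝ) ≤ ((k : ℕ) : ℝ) := Nat.cast_nonneg _
    have hs : (Part.core (Core.D k)).embed x = (3 + (k : ℕ) + x) / 25 := by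
      simp only [Part.embed, Part.start, Part.size, Core.idx]; push_cast; ring
    have hfl : ⌊25 * ((3 + ((k : ℕ) : ℝ) + x) / 25)⌋₊ = 3 + (k : ℕ) := by
      rw [Nat.floor_eq_iff (by positivity)]
      push_cast
      constructor <;> linarith
    rw [hs]
    unfold partOf
    rw [if_neg (by linarith), if_neg (by linarith), if_neg (by linarith),
      dif_pos (by rw [hfl]; omega)]
    congr 2
    ext
    simp only [hfl]
    omega
  all_goals
    simp only [Part.embed, Part.start, Part.size, Core.idx]
    unfold partOf
    push_cast
  case core.A => rw [if_pos (by linarith)]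
  case core.B => rw [if_neg (by linarith), if_pos (by linarith)]
  case core.C => rw [if_neg (by linarith), if_neg (by linarith), if_pos (by linarith)]
  all_goals
    rw [if_neg (by linarith), if_neg (by linarith), if_neg (by linarith), dif_neg]
  case core.E.hnc | core.F.hnc | Q.hnc | R.hnc =>
    rintro ⟨-, h⟩
    rw [Nat.floor_lt (by positivity)] at h
    push_cast at h
    linarith
  · rw [if_pos (by linarith)]
  · rw [if_neg (by linarith), if_pos (by linarith)]
  · rw [if_neg (by linarith), if_neg (by linarith), if_pos (by linarith)]
  · rw [if_neg (by linarith), if_neg (by linarith), if_neg (by linarith)]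

/-- The linear map from `[0,1)` onto the `k`-th of the parts `A, …, G` of the host graphon `W₀`,
whose ten parts `A, …, G, P, Q, R` have size `1/13` except `Q`. -/
def hostEmbed (k : Fin 7) (x : ℝ) : ℝ := ((k : ℕ) + x) / 13

section Graphon

variable (P : BoundingSequence) (W₀ : ℝ → ℝ → ℝ) (z : Cube)

/-- The tile `C × C`. -/
def tileCC (x y : ℝ) : ℝ :=
  if x < 2 / 3 ∧ y < 2 / 3 ∧ coord (3 * x) = coord (3 * y) then
    if ⌊3 * x⌋ = ⌊3 * y⌋ then monomialValue (multiset (coord (3 * x))) z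
    else 1 - monomialValue (multiset (coord (3 * x))) z
  else 0

/-- The tiles `C × D_A, …, C × D_G`. -/
def tileCD (k : Fin 7) (x y : ℝ) : ℝ :=
  if k = 0 then
    if x < 1 / 3 ∧ y ∈ Ico (1 / 3) (2 / 3) ∧ coord (3 * x) = coord (3 * y) then 1 else 0
  else if k = 1 then
    if x < 1 / 3 ∧ 2 / 3 ≤ y ∧ coord (3 * x) = coord (3 * y) then 1 else 0
  else if k = 2 then
    if x < 1 / 6 ∧ y < 1 / 6 then 1 else 0
  else if k = 6 then
    if (x < 1 / 3 ∧ y < 2 / 3) ∨ (x < 2 / 3 ∧ 2 / 3 ≤ y) then WF P x y else 0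
  else 0

/-- The tile `C × E`. -/
def tileCE (x y : ℝ) : ℝ :=
  let k := coord (3 * x)
  let a := 2 ^ (k : ℕ) * (3 * y - 1) + 2
  let b := 2 ^ (k : ℕ) * (3 * y - 2) + 2
  if (x < 1 / 3 ∧ y < 1 / 3 ∧ 0 ≤ a ∧ a ≤ P.pval k z) ∨
    (x < 1 / 3 ∧ y ∈ Ico (1 / 3) (2 / 3) ∧ 0 ≤ b ∧ b ≤ 1 - P.pval k z) ∨
    (x ∈ Ico (1 / 3) (2 / 3) ∧ y < 1 / 3 ∧ P.pval k z ≤ a ∧ a ≤ 1) ∨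
    (x ∈ Ico (1 / 3) (2 / 3) ∧ y ∈ Ico (1 / 3) (2 / 3) ∧ 1 - P.pval k z ≤ b ∧ b ≤ 1)
  then 1 else 0

/-- The tile `D_G × E`. -/
def tileGE (x y : ℝ) : ℝ :=
  let k := coord (3 * y)
  let a := 2 ^ (k : ℕ) * (3 * y - 1) + 2
  if y < 1 / 3 ∧ coord (3 * x) = k ∧
    ((x ∈ Ico (1 / 3) (2 / 3) ∧ a ≤ P.u k) ∨ (2 / 3 ≤ x ∧ a ≤ P.l k))
  then 1 else 0

/-- The tiles `X × Y` with `X` not after `Y` in the list `A, B, C, D_A, …, D_G, E, F`. -/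
def upperTile : Core → Core → ℝ → ℝ → ℝ
  | .A, .F, x, y => if 1 ≤ x + y then 1 else 0
  | .B, .F, x, y => if 1 ≤ x + y then 1 else 0
  | .D _, .F, x, y => if 1 ≤ x + y then 1 else 0
  | .F, .F, x, y => if 1 ≤ x + y then 1 else 0
  | .A, _, x, y => if ⌊3 * x⌋ = ⌊3 * y⌋ then 1 else 0
  | .B, _, x, y => if ⌊3 * x⌋ = ⌊3 * y⌋ ∧ coord (3 * x) = coord (3 * y) then 1 else 0
  | .C, .C, x, y => tileCC z x y
  | .C, .D k, x, y => tileCD P k x y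
  | .C, .E, x, y => tileCE P z x y
  | .D j, .D k, x, y => W₀ (hostEmbed j x) (hostEmbed k y)
  | .D k, .E, x, y => if k = 6 then tileGE P x y else 0
  | _, _, _, _ => 0

/-- `W_P(ι_X(x), ι_Y(y))` for the parts `A, B, C, D_A, …, D_G, E, F`. -/
def coreTile (X Y : Core) (x y : ℝ) : ℝ :=
  if X.idx ≤ Y.idx then upperTile P W₀ z X Y x y else upperTile P W₀ z Y X y x

/-- The sum of the twelve relative degrees of `ι_X(x)` in the parts `A, …, F`. -/
def coreDegree (X : Core) (x : ℝ) : ℝ :=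
  let d : Core → ℝ := fun Y => ∫ s in Ico (0 : ℝ) 1, coreTile P W₀ z X Y x s
  d .A + d .B + d .C + ∑ k : Fin 7, d (.D k) + d .E + d .F

/-- `W_P(ι_X(x), ι_Y(y))` for all parts. -/
def tile : Part → Part → ℝ → ℝ → ℝ
  | .core X, .core Y, x, y => coreTile P W₀ z X Y x y
  | .core X, .Q, x, _ => (12 - coreDegree P W₀ z X x) / 12
  | .Q, .core Y, _, y => (12 - coreDegree P W₀ z Y y) / 12
  | .core X, .R, _, _ => ((X.idx : ℝ) + 1) / 25
  | .R, .core Y, _, _ => ((Y.idx : ℝ) + 1) / 25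
  | .Q, .Q, _, _ => 1
  | .Q, .R, _, _ => 1
  | .R, .Q, _, _ => 1
  | .R, .R, _, _ => 0

/-- The graphon `W_P(z)`, built with the host graphon `W₀` in the tiles `D_Z × D_{Z'}`. -/
def WP (s t : ℝ) : ℝ :=
  tile P W₀ z (partOf s) (partOf t) ((s - (partOf s).start) / (partOf s).size)
    ((t - (partOf t).start) / (partOf t).size)

theorem WP_embed (X Y : Part) {x y : ℝ} (hx : x ∈ Ico (0 : ℝ) 1) (hy : y ∈ Ico (0 : ℝ) 1) :
    WP P W₀ z (X.embed x) (Y.embed y) = tile P W₀ z X Y x y := by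
  have hsize : ∀ X : Part, X.size ≠ 0 := by
    rintro (_ | _ | _) <;> norm_num [Part.size]
  have h : ∀ (X : Part) (x : ℝ), (X.embed x - X.start) / X.size = x := fun X x => by
    rw [Part.embed, add_sub_cancel_left, mul_div_cancel_left₀ _ (hsize X)]
  rw [WP, partOf_embed X hx, partOf_embed Y hy, h, h]

end Graphon

/-! ### The functions `t_{P,H}` -/

/-- The pieces into which `[0,1)` is split:
* the parts `A, B, D_A, …, D_G, F, Q, R`;
* `C k j`, the points `ι_C(x)` with `⌊3x⌋ = j` and `coord (3x) = k`;
* `E₁ k i`, the points `ι_E(y)` with `⌊3y⌋ = 0` and `coord (3y) = k`, whose relative position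
  `2^k (3y - 1) + 2` lies between the consecutive terms number `i` and `i + 1` of
  `0 ≤ l_k ≤ p_k(z) ≤ u_k ≤ 1`;
* `E₂ k i`, the points `ι_E(y)` with `⌊3y⌋ = 1` and `coord (3y) = k`, whose relative position
  `2^k (3y - 2) + 2` is below (`i = 0`) or above (`i = 1`) `1 - p_k(z)`;
* `E₃ k`, the points `ι_E(y)` with `⌊3y⌋ = 2` and `coord (3y) = k`. -/
inductive Cell : Type
  | A | B
  | D (k : Fin 7)
  | F | Q | R
  | C (k : ℕ+) (j : Fin 3)
  | E₁ (k : ℕ+) (i : Fin 4)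
  | E₂ (k : ℕ+) (i : Fin 2)
  | E₃ (k : ℕ+)

/-- The part containing a piece. -/
def Cell.part : Cell → Part
  | .A => .core .A
  | .B => .core .B
  | .D k => .core (.D k)
  | .F => .core .F
  | .Q => .Q
  | .R => .R
  | .C _ _ => .core .C
  | .E₁ _ _ => .core .E
  | .E₂ _ _ => .core .E
  | .E₃ _ => .core .E

/-- The pieces of the parts `C` and `E`. -/
def Cell.InCE : Cell → Prop
  | .C _ _ => True
  | .E₁ _ _ => True
  | .E₂ _ _ => True
  | .E₃ _ => True
  | _ => False

/-- The left endpoint of `{x ∈ [0,1) | ⌊3x⌋ = j, coord (3x) = k}`, an interval of length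
`2^{-k} / 3`. -/
def blockStart (k : ℕ+) (j : ℕ) : ℝ := ((j : ℝ) + 1 - 2 * (1 / 2) ^ (k : ℕ)) / 3

section Density

variable (P : BoundingSequence) (W₀ : ℝ → ℝ → ℝ)

/-- The left endpoint, in the coordinate of its part, of the smallest interval independent of `z`
that contains the piece: the relative positions of `E₁ k 1` and `E₁ k 2` are enlarged to
`[l_k, u_k)`, those of `E₂ k i` to `[0, 1)`. -/
def Cell.lo : Cell → ℝ
  | .C k j => blockStart k j
  | .E₁ k i => blockStart k 0 + (1 / 2) ^ (k : ℕ) / 3 * ![0, P.l k, P.l k, P.u k] i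
  | .E₂ k _ => blockStart k 1
  | .E₃ k => blockStart k 2
  | _ => 0

/-- The right endpoint of the interval of `Cell.lo`. -/
def Cell.hi : Cell → ℝ
  | .C k j => blockStart k j + (1 / 2) ^ (k : ℕ) / 3
  | .E₁ k i => blockStart k 0 + (1 / 2) ^ (k : ℕ) / 3 * ![P.l k, P.u k, P.u k, 1] i
  | .E₂ k _ => blockStart k 1 + (1 / 2) ^ (k : ℕ) / 3
  | .E₃ k => blockStart k 2 + (1 / 2) ^ (k : ℕ) / 3
  | _ => 1

/-- The point of `[0,1)` at relative position `t ∈ [0,1)` in the interval of `Cell.lo`. -/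
def Cell.point (c : Cell) (t : ℝ) : ℝ := c.part.embed (c.lo P + (c.hi P - c.lo P) * t)

/-- The measure of a piece, as a polynomial in `z`. -/
def Cell.measurePoly : Cell → MvPolynomial ℕ+ ℝ
  | .E₁ k i => MvPolynomial.C ((1 / 2) ^ (k : ℕ) / 75) *
      ![MvPolynomial.C (P.l k), P.p k - MvPolynomial.C (P.l k), MvPolynomial.C (P.u k) - P.p k,
        1 - MvPolynomial.C (P.u k)] i
  | .E₂ k i => MvPolynomial.C ((1 / 2) ^ (k : ℕ) / 75) * ![1 - P.p k, P.p k] i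
  | .E₃ k => MvPolynomial.C ((1 / 2) ^ (k : ℕ) / 75)
  | .C k _ => MvPolynomial.C ((1 / 2) ^ (k : ℕ) / 75)
  | c => MvPolynomial.C c.part.size

/-- The constant value of `W_P(z)` on the product of two pieces of `C ∪ E`, as a polynomial
in `z`. -/
def edgePoly : Cell → Cell → MvPolynomial ℕ+ ℝ
  | .C k j, .C k' j' =>
      if k = k' ∧ j ≠ 2 ∧ j' ≠ 2 then
        if j = j' then MvPolynomial.monomial (multiset k) 1
        else 1 - MvPolynomial.monomial (multiset k) 1
      else 0
  | .C k j, .E₁ k' i => if k = k' ∧ ((j = 0 ∧ i < 2) ∨ (j = 1 ∧ 2 ≤ i)) then 1 else 0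
  | .E₁ k' i, .C k j => if k = k' ∧ ((j = 0 ∧ i < 2) ∨ (j = 1 ∧ 2 ≤ i)) then 1 else 0
  | .C k j, .E₂ k' i => if k = k' ∧ ((j = 0 ∧ i = 0) ∨ (j = 1 ∧ i = 1)) then 1 else 0
  | .E₂ k' i, .C k j => if k = k' ∧ ((j = 0 ∧ i = 0) ∨ (j = 1 ∧ i = 1)) then 1 else 0
  | _, _ => 0

variable {n : ℕ} (H : SimpleGraph (Fin n))

/-- The probability that, for independent uniform points, the vertex `v` being placed in the
interval of the piece `L v`, the random graph agrees with `H` on all pairs of vertices that are not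
both placed in `C ∪ E`. The values of `W_P(z)` involved do not depend on `z` (up to null sets),
so `z = 0` is used. -/
def outerProb (L : Fin n → Cell) : ℝ :=
  ∫ x in unitBox n,
    ∏ q ∈ (vertexPairs n).filter fun q => ¬ ((L q.1).InCE ∧ (L q.2).InCE),
      if H.Adj q.1 q.2 then
        WP P W₀ (fun _ => 0) ((L q.1).point P (x q.1)) ((L q.2).point P (x q.2))
      else 1 - WP P W₀ (fun _ => 0) ((L q.1).point P (x q.1)) ((L q.2).point P (x q.2))

/-- The polynomial `q_{P,H'}` of the copy `H'` of `H` whose vertex `v` is labeled by the piece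
`L v`: the contribution to `τ(H, W_P(z))` of the points in `∏ v, L v`. -/
def labeledPoly (L : Fin n → Cell) : MvPolynomial ℕ+ ℝ :=
  MvPolynomial.C (outerProb P W₀ H L) * (∏ v, (L v).measurePoly P) *
    ∏ q ∈ (vertexPairs n).filter fun q => (L q.1).InCE ∧ (L q.2).InCE,
      if H.Adj q.1 q.2 then edgePoly (L q.1) (L q.2) else 1 - edgePoly (L q.1) (L q.2)

/-- The coefficient `α_{P,i}`: the sum over all labelings of the coefficients at `z^{M_i}`. -/
def alpha (i : ℕ+) : ℝ := ∑' L : Fin n → Cell, (labeledPoly P W₀ H L).coeff (multiset i)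

/-- The function `t_{P,H}(z) = ∑ i, α_{P,i} z^{M_i}`. -/
def tFun (z : Cube) : ℝ := ∑' i : ℕ+, alpha P W₀ H i * monomialValue (multiset i) z

end Density

end

end GraphonFamily

open GraphonFamily

namespace GraphonFamily

noncomputable section

open scoped Classical

/-! ### A weighted norm on polynomials -/

/-! Label every vertex of `H` by the piece containing its point. For a feasible `z` the pieces are
ordered by `0 ≤ l ≤ p(z) ≤ u ≤ 1`, so they partition `[0,1)`, and `τ(H, W_P(z))` is the sum over all
labelings of the integral over the corresponding box. Each such integral is the value at `z` of the
polynomial `labeledPoly` (`integral_carrier`), for two reasons. On products of pieces inside `C ∪ E`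
the graphon is almost everywhere the constant `edgePoly`. On all other pairs it is independent of
`z`, once each piece is rescaled affinely to a fixed interval. The delicate tiles here are those
with `Q`, which contain degrees: they do not move because the variable contributions come in
complementary pairs, `z^M` with `1 - z^M` and `p` with `1 - p` (`integral_tileCC`,
`integral_tileCE_right`, `integral_tileCE_left`).

Convergence comes from a norm on polynomials that weights the coefficient at `z^A` by `r ^ Σ(A)`,
with `r > 1`. A piece of block `k` has measure of norm at most `2^{-k}`, since the coefficients of
`p_k` decay doubly exponentially. An edge polynomial has norm at most `1 + r^k`, since `Σ(M_k) ≤ k`.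
A vertex lies in fewer than `n` pairs, so a labeling costs at most a product over the vertices of
`3^n (r^n / 2)^k`. For `r` close to `1` this is summable over all labelings
(`exists_summable_wnorm_labeledPoly`).

Hence the coefficients of `t_{P,H}` remain summable with the weights `r ^ Σ(A)`. Any power series
with this property is totally analytic (`OverConvergent.totallyAnalytic`): differentiation costs a
factor linear in `Σ(A)`, paid for by decreasing `r`, and in finitely many variables the series
converges on a sup-norm ball of radius `r > 1`. Absolute convergence also permits exchanging the sum
over labelings with the sum over monomials, which identifies `t_{P,H}(z)` with the density at
feasible `z`. -/

theorem msum_zero : msum 0 = 0 := by simp [msum]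

theorem msum_add (A B : ℕ+ →₀ ℕ) : msum (A + B) = msum A + msum B := by
  unfold msum
  exact Finsupp.sum_add_index' (fun _ => by simp) (fun _ _ _ => by ring)

theorem msum_single (j : ℕ+) (c : ℕ) : msum (Finsupp.single j c) = j * c := by
  unfold msum
  exact Finsupp.sum_single_index (by simp)

/-- The enumeration of the finite multisets as an equivalence. -/
def multisetEquiv : ℕ+ ≃ (ℕ+ →₀ ℕ) :=
  Equiv.pnatEquivNat.trans (Equiv.ofBijective rank ⟨rank_injective, rank_surjective⟩).symm

theorem rank_multiset (j : ℕ+) : rank (multiset j) = j.natPred :=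
  (Equiv.ofBijective rank ⟨rank_injective, rank_surjective⟩).apply_symm_apply j.natPred

/-- The multisets consisting of `m` copies of `1`, for `m < Σ(A)`, have smaller sum and therefore
all precede `A`. -/
theorem msum_le_rank (A : ℕ+ →₀ ℕ) : msum A ≤ rank A := by
  have hsub : (fun m : ℕ => Finsupp.single (1 : ℕ+) m) '' Set.Iio (msum A) ⊆ {B | Prec B A} := by
    rintro _ ⟨m, hm, rfl⟩
    refine Or.inl ?_
    simpa [msum_single] using hm
  have h := Set.ncard_le_ncard hsub (finite_prec A)
  rw [Set.ncard_image_of_injective _ (Finsupp.single_injective _)] at h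
  have : (Set.Iio (msum A)).ncard = msum A := by
    rw [← Nat.card_coe_set_eq]; simp
  rwa [this] at h

theorem msum_multiset_le (j : ℕ+) : msum (multiset j) ≤ j := by
  have h := msum_le_rank (multiset j)
  rw [rank_multiset] at h
  have := PNat.natPred_add_one j
  omega

/-- The sum of the absolute values of the coefficients, the one at `z^A` weighted by
`r ^ Σ(A)`. -/
def wnorm (r : ℝ) (q : MvPolynomial ℕ+ ℝ) : ℝ := ∑ A ∈ q.support, |q.coeff A| * r ^ msum A

section wnorm

variable {r : ℝ}

theorem wnorm_eq_sum {q : MvPolynomial ℕ+ ℝ} {s : Finset (ℕ+ →₀ ℕ)} (h : q.support ⊆ s) :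
    wnorm r q = ∑ A ∈ s, |q.coeff A| * r ^ msum A :=
  Finset.sum_subset h fun A _ hA => by
    rw [MvPolynomial.notMem_support_iff.mp hA]; simp

theorem wnorm_nonneg (hr : 0 ≤ r) (q : MvPolynomial ℕ+ ℝ) : 0 ≤ wnorm r q :=
  Finset.sum_nonneg fun _ _ => by positivity

theorem wnorm_zero : wnorm r 0 = 0 := by simp [wnorm]

theorem wnorm_add_le (hr : 0 ≤ r) (p q : MvPolynomial ℕ+ ℝ) :
    wnorm r (p + q) ≤ wnorm r p + wnorm r q := by
  rw [wnorm_eq_sum (MvPolynomial.support_add (p := p) (q := q)),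
    wnorm_eq_sum (q := p) Finset.subset_union_left,
    wnorm_eq_sum (q := q) Finset.subset_union_right, ← Finset.sum_add_distrib]
  refine Finset.sum_le_sum fun A _ => ?_
  rw [← add_mul, MvPolynomial.coeff_add]
  exact mul_le_mul_of_nonneg_right (abs_add_le _ _) (by positivity)

theorem wnorm_neg (q : MvPolynomial ℕ+ ℝ) : wnorm r (-q) = wnorm r q := by
  simp [wnorm, MvPolynomial.support_neg]

theorem wnorm_sub_le (hr : 0 ≤ r) (p q : MvPolynomial ℕ+ ℝ) :
    wnorm r (p - q) ≤ wnorm r p + wnorm r q := by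
  rw [sub_eq_add_neg, ← wnorm_neg (r := r) q]
  exact wnorm_add_le hr _ _

theorem wnorm_sum_le {ι : Type*} (hr : 0 ≤ r) (s : Finset ι) (f : ι → MvPolynomial ℕ+ ℝ) :
    wnorm r (∑ i ∈ s, f i) ≤ ∑ i ∈ s, wnorm r (f i) := by
  induction s using Finset.induction_on with
  | empty => simp [wnorm_zero]
  | insert a s ha ih =>
    rw [Finset.sum_insert ha, Finset.sum_insert ha]
    exact (wnorm_add_le hr _ _).trans (by gcongr)

theorem wnorm_monomial (A : ℕ+ →₀ ℕ) (c : ℝ) :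
    wnorm r (MvPolynomial.monomial A c) = |c| * r ^ msum A := by
  rw [wnorm_eq_sum (s := {A}) MvPolynomial.support_monomial_subset]
  simp

theorem wnorm_C (c : ℝ) : wnorm r (MvPolynomial.C c) = |c| := by
  rw [MvPolynomial.C_apply, wnorm_monomial, msum_zero]; simp

theorem wnorm_one : wnorm r 1 = 1 := by
  rw [← MvPolynomial.C_1, wnorm_C, abs_one]

/-- The weight is multiplicative because `msum` is additive, so the norm is submultiplicative, as
for an `ℓ¹` convolution algebra. -/
theorem wnorm_mul_le (hr : 0 ≤ r) (p q : MvPolynomial ℕ+ ℝ) :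
    wnorm r (p * q) ≤ wnorm r p * wnorm r q := by
  have h : p * q = ∑ A ∈ p.support, ∑ B ∈ q.support,
      MvPolynomial.monomial (A + B) (p.coeff A * q.coeff B) := by
    conv_lhs => rw [p.as_sum, q.as_sum, Finset.sum_mul_sum]
    simp only [MvPolynomial.monomial_mul]
  rw [h]
  refine (wnorm_sum_le hr _ _).trans ?_
  rw [wnorm, wnorm, Finset.sum_mul_sum]
  refine Finset.sum_le_sum fun A _ => (wnorm_sum_le hr _ _).trans (Finset.sum_le_sum fun B _ => ?_)
  rw [wnorm_monomial, msum_add, pow_add, abs_mul]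
  exact le_of_eq (by ring)

theorem wnorm_prod_le {ι : Type*} (hr : 0 ≤ r) (s : Finset ι) (f : ι → MvPolynomial ℕ+ ℝ) :
    wnorm r (∏ i ∈ s, f i) ≤ ∏ i ∈ s, wnorm r (f i) := by
  induction s using Finset.induction_on with
  | empty => simp [wnorm_one]
  | insert a s ha ih =>
    rw [Finset.prod_insert ha, Finset.prod_insert ha]
    exact (wnorm_mul_le hr _ _).trans (mul_le_mul_of_nonneg_left ih (wnorm_nonneg hr _))

theorem hasSum_wnorm (q : MvPolynomial ℕ+ ℝ) :
    HasSum (fun A => |q.coeff A| * r ^ msum A) (wnorm r q) :=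
  hasSum_sum_of_ne_finset_zero fun A hA => by
    rw [MvPolynomial.notMem_support_iff.mp hA]; simp

theorem hasSum_eval (q : MvPolynomial ℕ+ ℝ) (z : Cube) :
    HasSum (fun A => q.coeff A * monomialValue A z) (MvPolynomial.eval z.val q) := by
  rw [MvPolynomial.eval_eq]
  refine hasSum_sum_of_ne_finset_zero fun A hA => ?_
  rw [MvPolynomial.notMem_support_iff.mp hA, zero_mul]

theorem monomialValue_mem (A : ℕ+ →₀ ℕ) (z : Cube) : monomialValue A z ∈ Icc (0 : ℝ) 1 :=
  ⟨Finset.prod_nonneg fun k _ => pow_nonneg (z k).2.1 _,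
    Finset.prod_le_one (fun k _ => pow_nonneg (z k).2.1 _)
      fun k _ => pow_le_one₀ (z k).2.1 (z k).2.2⟩

theorem abs_coeff_le_wnorm (hr : 1 ≤ r) (q : MvPolynomial ℕ+ ℝ) (A : ℕ+ →₀ ℕ) :
    |q.coeff A| ≤ wnorm r q := by
  have h0 : 0 ≤ r := zero_le_one.trans hr
  have h1 := le_hasSum (hasSum_wnorm (r := r) q) A fun B _ => by positivity
  exact (le_mul_of_one_le_right (abs_nonneg _) (one_le_pow₀ hr)).trans h1

/-- The coefficient at `z^{M_j}` is at most `2^{-2j}` and its weight at most `2^j`, so the norm is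
dominated by `∑ 2^{-j} = 1`. -/
theorem BoundingSequence.wnorm_p_le (P : BoundingSequence) (hr : 0 ≤ r) (hr2 : r ≤ 2)
    (hr1 : 1 ≤ r) (k : ℕ+) : wnorm r (P.p k) ≤ 1 := by
  have h1 : HasSum (fun j : ℕ+ => |P.coeff k j| * r ^ msum (multiset j)) (wnorm r (P.p k)) :=
    (multisetEquiv.hasSum_iff (f := fun A => |(P.p k).coeff A| * r ^ msum A)).mpr
      (hasSum_wnorm (P.p k))
  have h2 : HasSum (fun m : ℕ => (1 / 2 : ℝ) / 2 ^ m) 1 := by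
    convert hasSum_geometric_two' 1 using 1
  have h3 : HasSum (fun j : ℕ+ => (1 / 2 : ℝ) / 2 ^ (j.natPred)) 1 :=
    (Equiv.pnatEquivNat.hasSum_iff (f := fun m : ℕ => (1 / 2 : ℝ) / 2 ^ m)).mpr h2
  refine hasSum_le (fun j => ?_) h1 h3
  obtain ⟨m, rfl⟩ : ∃ m : ℕ, j = m.succPNat := ⟨j.natPred, (PNat.succPNat_natPred j).symm⟩
  -- With `j = m + 1`, half of the exponent `2j` cancels the weight and the other half gives the
  -- geometric series.
  have hpow : 2 * (m + 1) ≤ 2 ^ (m + 1) := by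
    rw [pow_succ]; have := Nat.lt_two_pow_self (n := m); omega
  have h4 : |P.coeff k m.succPNat| ≤ (1 / 2 : ℝ) ^ (2 * (m + 1)) := by
    refine (P.coeff_le k m.succPNat).trans ?_
    simp only [Nat.succPNat_coe, Nat.succ_eq_add_one]
    have : (1 / 2 : ℝ) ^ (2 ^ (m + 1)) ≤ (1 / 2 : ℝ) ^ (2 * (m + 1)) :=
      pow_le_pow_of_le_one (by norm_num) (by norm_num) hpow
    have h0 : (0 : ℝ) ≤ (1 / 2 : ℝ) ^ (2 ^ (m + 1)) := by positivity
    linarith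
  have h5 : r ^ msum (multiset m.succPNat) ≤ 2 ^ (m + 1) := by
    have hm : msum (multiset m.succPNat) ≤ m + 1 := by
      simpa using msum_multiset_le m.succPNat
    calc r ^ msum (multiset m.succPNat) ≤ r ^ (m + 1) := pow_le_pow_right₀ hr1 hm
      _ ≤ 2 ^ (m + 1) := pow_le_pow_left₀ hr hr2 _
  calc |P.coeff k m.succPNat| * r ^ msum (multiset m.succPNat)
      ≤ (1 / 2 : ℝ) ^ (2 * (m + 1)) * 2 ^ (m + 1) :=
        mul_le_mul h4 h5 (by positivity) (by positivity)
    _ = (1 / 2 : ℝ) / 2 ^ (m.succPNat).natPred := by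
        rw [Nat.natPred_succPNat, two_mul, pow_add, mul_assoc, ← mul_pow]
        rw [show (1 / 2 * 2 : ℝ) = 1 by norm_num, one_pow, mul_one, one_div_pow, pow_succ,
          div_div, mul_comm]

end wnorm

/-! ### Summability over all labelings -/

/-- The index of the block containing a piece, `0` for the pieces outside `C ∪ E`. -/
def Cell.key : Cell → ℕ
  | .C k _ => k
  | .E₁ k _ => k
  | .E₂ k _ => k
  | .E₃ k => k
  | _ => 0

/-- The kind of a piece. -/
def Cell.kind : Cell → Fin 22
  | .A => 0
  | .B => 1
  | .D k => ⟨2 + k, by omega⟩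
  | .F => 9
  | .Q => 10
  | .R => 11
  | .C _ j => ⟨12 + j, by omega⟩
  | .E₁ _ i => ⟨15 + i, by omega⟩
  | .E₂ _ i => ⟨19 + i, by omega⟩
  | .E₃ _ => 21

/-- This encoding makes the set of pieces countable and bounds sums over pieces by 22 geometric
series. -/
theorem Cell.key_kind_injective :
    Function.Injective fun c : Cell => (c.key, c.kind) := by
  intro c d h
  simp only [Prod.mk.injEq, Fin.ext_iff] at h
  obtain ⟨h1, h2⟩ := h
  cases c <;> cases d <;> simp [Cell.key, Cell.kind] at h1 h2 ⊢ <;> grind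

instance : Countable Cell := Cell.key_kind_injective.countable

theorem summable_pow_key {c : ℝ} (h0 : 0 ≤ c) (h1 : c < 1) :
    Summable fun d : Cell => c ^ d.key := by
  have h : Summable fun q : ℕ × Fin 22 => c ^ q.1 * 1 :=
    (summable_geometric_of_lt_one h0 h1).mul_of_nonneg
      (Summable.of_finite (f := fun _ : Fin 22 => (1 : ℝ)))
      (fun _ => by positivity) (fun _ => by positivity)
  simpa [Function.comp_def] using h.comp_injective Cell.key_kind_injective

/-- The sum over labelings is the `n`-th power of the sum over pieces; induction splits off the
label of the first vertex. -/
theorem summable_prod_fin {ι : Type*} {w : ι → ℝ} (hw : Summable w) (h0 : ∀ i, 0 ≤ w i) (n : ℕ) :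
    Summable fun L : Fin n → ι => ∏ v, w (L v) := by
  induction n with
  | zero => exact Summable.of_finite
  | succ n ih =>
    have h := hw.mul_of_nonneg ih h0 fun L => Finset.prod_nonneg fun v _ => h0 _
    have h' := (Fin.consEquiv fun _ => ι).symm.summable_iff.mpr h
    refine h'.congr fun L => ?_
    simp [Fin.prod_univ_succ, Fin.consEquiv, Fin.tail]

section Density

variable (P : BoundingSequence) (W₀ : ℝ → ℝ → ℝ) {n : ℕ} (H : SimpleGraph (Fin n)) {r : ℝ}

/-- The variable factor is a difference of two polynomials of norm at most `1`, and the constant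
`1/75` easily absorbs the resulting `2`. Pieces outside `C ∪ E` have key `0`, where the bound only
asks for size at most `1`. -/
theorem wnorm_measurePoly_le (hr2 : r ≤ 2) (hr1 : 1 ≤ r) (c : Cell) :
    wnorm r (c.measurePoly P) ≤ (1 / 2 : ℝ) ^ c.key := by
  have hr : 0 ≤ r := zero_le_one.trans hr1
  have hmul : ∀ (k : ℕ+) (q : MvPolynomial ℕ+ ℝ), wnorm r q ≤ 2 →
      wnorm r (MvPolynomial.C ((1 / 2) ^ (k : ℕ) / 75) * q) ≤ (1 / 2 : ℝ) ^ (k : ℕ) := by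
    intro k q hq
    refine (wnorm_mul_le hr _ _).trans ?_
    rw [wnorm_C, abs_of_nonneg (by positivity)]
    have h0 : (0 : ℝ) ≤ (1 / 2) ^ (k : ℕ) := by positivity
    nlinarith [wnorm_nonneg hr q]
  have hC : ∀ x : ℝ, x ∈ Icc (0 : ℝ) 1 → wnorm r (MvPolynomial.C x) ≤ 1 := fun x hx => by
    rw [wnorm_C, abs_of_nonneg hx.1]; exact hx.2
  have hp : ∀ k, wnorm r (P.p k) ≤ 1 := P.wnorm_p_le hr hr2 hr1
  have h1 : wnorm r 1 ≤ 1 := wnorm_one.le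
  have hsub : ∀ p q, wnorm r p ≤ 1 → wnorm r q ≤ 1 → wnorm r (p - q) ≤ 2 := fun p q hp hq =>
    (wnorm_sub_le hr p q).trans (by linarith)
  have hk : ∀ k : ℕ+, wnorm r (MvPolynomial.C ((1 / 2) ^ (k : ℕ) / 75)) ≤ (1 / 2 : ℝ) ^ (k : ℕ) :=
    fun k => by simpa using hmul k 1 (h1.trans one_le_two)
  cases c with
  | E₁ k i =>
    refine hmul k _ ?_
    fin_cases i
    · exact (hC _ (P.l_mem k)).trans one_le_two
    · exact hsub _ _ (hp k) (hC _ (P.l_mem k))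
    · exact hsub _ _ (hC _ (P.u_mem k)) (hp k)
    · exact hsub _ _ h1 (hC _ (P.u_mem k))
  | E₂ k i =>
    refine hmul k _ ?_
    fin_cases i
    · exact hsub _ _ h1 (hp k)
    · exact (hp k).trans one_le_two
  | E₃ k => exact hk k
  | C k j => exact hk k
  | _ =>
    simp only [Cell.measurePoly, Cell.key, pow_zero]
    apply hC
    constructor <;> norm_num [Cell.part, Part.size]

/-- A nonconstant edge polynomial occurs only for two pieces of `C` in the same block `k`, where
`msum_multiset_le` bounds the weight of `z^{M_k}`. This is why the key of one of the two pieces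
suffices. -/
theorem wnorm_edgePoly_le (hr1 : 1 ≤ r) (c d : Cell) :
    wnorm r (edgePoly c d) ≤ 1 + r ^ c.key := by
  have hr : 0 ≤ r := zero_le_one.trans hr1
  have hpos : ∀ m : ℕ, 0 ≤ r ^ m := fun m => by positivity
  have h1 : ∀ m : ℕ, wnorm r 1 ≤ 1 + r ^ m := fun m => by
    rw [wnorm_one]; linarith [hpos m]
  have hm : ∀ k : ℕ+, wnorm r (MvPolynomial.monomial (multiset k) 1) ≤ r ^ (k : ℕ) := by
    intro k
    rw [wnorm_monomial, abs_one, one_mul]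
    exact pow_le_pow_right₀ hr1 (msum_multiset_le k)
  have h0 : ∀ m : ℕ, wnorm r 0 ≤ 1 + r ^ m := fun m => by
    rw [wnorm_zero]; linarith [hpos m]
  have h2 : ∀ k : ℕ+, wnorm r (1 - MvPolynomial.monomial (multiset k) 1) ≤ 1 + r ^ (k : ℕ) :=
    fun k => (wnorm_sub_le hr _ _).trans (by rw [wnorm_one]; linarith [hm k])
  have h3 : ∀ k : ℕ+, wnorm r (MvPolynomial.monomial (multiset k) 1) ≤ 1 + r ^ (k : ℕ) :=
    fun k => by linarith [hm k]
  cases c <;> cases d <;> simp only [edgePoly, Cell.key] <;> (try split_ifs) <;>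
    first | exact h0 _ | exact h1 _ | exact h2 _ | exact h3 _

theorem abs_outerProb_le (hW : ∀ x ∈ Ico (0 : ℝ) 1, ∀ y ∈ Ico (0 : ℝ) 1,
    WP P W₀ (fun _ => 0) x y ∈ Icc (0 : ℝ) 1)
    (hpt : ∀ (c : Cell), ∀ t ∈ Ico (0 : ℝ) 1, c.point P t ∈ Ico (0 : ℝ) 1) (L : Fin n → Cell) :
    |outerProb P W₀ H L| ≤ 1 := by
  have hvol : volume (unitBox n) = 1 := by
    simp [unitBox, volume_pi_pi]
  have h := norm_setIntegral_le_of_norm_le_const (μ := volume) (s := unitBox n) (C := 1)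
    (f := fun x : Fin n → ℝ =>
      ∏ q ∈ (vertexPairs n).filter fun q => ¬ ((L q.1).InCE ∧ (L q.2).InCE),
      if H.Adj q.1 q.2 then
        WP P W₀ (fun _ => 0) ((L q.1).point P (x q.1)) ((L q.2).point P (x q.2))
      else 1 - WP P W₀ (fun _ => 0) ((L q.1).point P (x q.1)) ((L q.2).point P (x q.2)))
    (by rw [hvol]; exact ENNReal.one_lt_top) ?_
  · rw [measureReal_def, hvol] at h
    simpa [outerProb] using h
  · intro x hx
    rw [Real.norm_eq_abs, Finset.abs_prod]
    refine Finset.prod_le_one (fun _ _ => abs_nonneg _) fun q _ => ?_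
    have h1 := hW _ (hpt (L q.1) _ (hx q.1 (mem_univ _))) _ (hpt (L q.2) _ (hx q.2 (mem_univ _)))
    split_ifs <;> rw [abs_le] <;> constructor <;> linarith [h1.1, h1.2]

/-- Every pair is charged to its first vertex. The charges are at least `1`, so the product may be
enlarged to all of `Fin n × Fin n`, which gives each vertex exactly `n` of them. -/
theorem wnorm_labeledPoly_le (hr2 : r ≤ 2) (hr1 : 1 ≤ r) (L : Fin n → Cell)
    (hL : |outerProb P W₀ H L| ≤ 1) :
    wnorm r (labeledPoly P W₀ H L) ≤ ∏ v, (3 ^ n * (r ^ n / 2) ^ (L v).key) := by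
  have hr : 0 ≤ r := zero_le_one.trans hr1
  have hbase : ∀ v, 1 ≤ 3 * r ^ (L v).key := fun v => by
    linarith [one_le_pow₀ hr1 (n := (L v).key)]
  have hpair : wnorm r (∏ q ∈ (vertexPairs n).filter fun q => (L q.1).InCE ∧ (L q.2).InCE,
      if H.Adj q.1 q.2 then edgePoly (L q.1) (L q.2) else 1 - edgePoly (L q.1) (L q.2)) ≤
      ∏ v, (3 * r ^ (L v).key) ^ n := by
    calc _ ≤ ∏ q ∈ (vertexPairs n).filter fun q => (L q.1).InCE ∧ (L q.2).InCE,
          3 * r ^ (L q.1).key := by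
          refine (wnorm_prod_le hr _ _).trans
            (Finset.prod_le_prod (fun _ _ => wnorm_nonneg hr _) fun q _ => ?_)
          have h1 := wnorm_edgePoly_le hr1 (L q.1) (L q.2)
          have h2 := one_le_pow₀ hr1 (n := (L q.1).key)
          split_ifs
          · linarith
          -- The complement of an edge polynomial has norm at most `2 + r ^ key`; this is where the
          -- constant `3` comes from.
          · refine (wnorm_sub_le hr _ _).trans ?_
            rw [wnorm_one]; linarith
      _ ≤ ∏ q : Fin n × Fin n, 3 * r ^ (L q.1).key :=
          Finset.prod_le_prod_of_subset_of_one_le (Finset.subset_univ _)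
            (fun q _ => zero_le_one.trans (hbase q.1)) fun q _ _ => hbase q.1
      _ = ∏ v, (3 * r ^ (L v).key) ^ n := by
          rw [Fintype.prod_prod_type]; simp
  have hmeas : wnorm r (∏ v, (L v).measurePoly P) ≤ ∏ v, (1 / 2 : ℝ) ^ (L v).key :=
    (wnorm_prod_le hr _ _).trans (Finset.prod_le_prod (fun _ _ => wnorm_nonneg hr _)
      fun v _ => wnorm_measurePoly_le P hr2 hr1 (L v))
  have hout : wnorm r (MvPolynomial.C (outerProb P W₀ H L)) ≤ 1 := by rwa [wnorm_C]
  calc _ ≤ 1 * (∏ v, (1 / 2 : ℝ) ^ (L v).key) * ∏ v, (3 * r ^ (L v).key) ^ n := by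
        refine (wnorm_mul_le hr _ _).trans (mul_le_mul ?_ hpair (wnorm_nonneg hr _) ?_)
        · exact (wnorm_mul_le hr _ _).trans
            (mul_le_mul hout hmeas (wnorm_nonneg hr _) zero_le_one)
        · exact mul_nonneg zero_le_one (Finset.prod_nonneg fun _ _ => by positivity)
    _ = _ := by
        rw [one_mul, ← Finset.prod_mul_distrib]
        refine Finset.prod_congr rfl fun v _ => ?_
        rw [mul_pow, div_pow, div_pow, one_pow, ← pow_mul, ← pow_mul, mul_comm n]
        ring

theorem exists_summable_wnorm_labeledPoly
    (hL : ∀ L : Fin n → Cell, |outerProb P W₀ H L| ≤ 1) :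
    ∃ r : ℝ, 1 < r ∧ Summable fun L : Fin n → Cell => wnorm r (labeledPoly P W₀ H L) := by
  -- The bound `r ^ n ≤ 3/2` makes the ratio `r ^ n / 2` at most `3/4`. Such an `r > 1` exists by
  -- continuity of the power at `1`.
  obtain ⟨r, hr1, hr2, hrn⟩ : ∃ r : ℝ, 1 < r ∧ r ≤ 2 ∧ r ^ n ≤ 3 / 2 := by
    have h : ∀ᶠ r : ℝ in nhdsWithin 1 (Ioi 1), r ^ n < 3 / 2 := by
      have hc : Filter.Tendsto (fun r : ℝ => r ^ n) (nhdsWithin 1 (Ioi 1)) (nhds (1 ^ n)) :=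
        ((continuous_pow n).tendsto 1).mono_left nhdsWithin_le_nhds
      exact hc.eventually_lt_const (by norm_num)
    obtain ⟨r, h1, h2, h3⟩ := (h.and (Ioo_mem_nhdsGT (one_lt_two (α := ℝ)))).exists
    exact ⟨r, h2, h3.le, h1.le⟩
  refine ⟨r, hr1, ?_⟩
  have hr0 : 0 ≤ r := zero_le_one.trans hr1.le
  have hw : Summable fun c : Cell => 3 ^ n * (r ^ n / 2) ^ c.key :=
    (summable_pow_key (by positivity) (by linarith)).mul_left _
  exact Summable.of_nonneg_of_le (fun L => wnorm_nonneg hr0 _)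
    (fun L => wnorm_labeledPoly_le P W₀ H hr2 hr1.le L (hL L))
    (summable_prod_fin hw (fun c => by positivity) n)

end Density

/-! ### Power series on the cube -/

/-- The sum of the power series with coefficients `a`. -/
def seriesSum (a : (ℕ+ →₀ ℕ) → ℝ) (z : Cube) : ℝ := ∑' A, a A * monomialValue A z

/-- The power series with coefficients `a` converges absolutely at `z_k = r ^ k` for some
`r > 1`. -/
def OverConvergent (a : (ℕ+ →₀ ℕ) → ℝ) : Prop :=
  ∃ r : ℝ, 1 < r ∧ Summable fun A => |a A| * r ^ msum A

/-- The coefficients of the partial derivative in the `j`-th coordinate. -/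
def derivCoeff (j : ℕ+) (a : (ℕ+ →₀ ℕ) → ℝ) (A : ℕ+ →₀ ℕ) : ℝ :=
  (A j + 1) * a (A + Finsupp.single j 1)

theorem le_msum (A : ℕ+ →₀ ℕ) (j : ℕ+) : A j ≤ msum A :=
  (Nat.le_mul_of_pos_left _ j.pos).trans (mul_le_msum A j)

/-- Bernoulli's inequality: the linear factor produced by a derivative is absorbed by a geometric
one. -/
theorem natCast_add_one_le_pow {r : ℝ} (hr : 1 < r) (m : ℕ) :
    (m : ℝ) + 1 ≤ ((r - 1)⁻¹ + 1) * r ^ m := by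
  have h0 : 0 < r - 1 := by linarith
  have h1 := one_add_mul_le_pow (show (-2 : ℝ) ≤ r - 1 by linarith) m
  rw [add_sub_cancel] at h1
  have h2 : (m : ℝ) ≤ (r - 1)⁻¹ * r ^ m := by
    rw [inv_mul_eq_div, le_div_iff₀ h0]; linarith
  have h3 := one_le_pow₀ hr.le (n := m)
  linarith

theorem OverConvergent.summable_abs {a : (ℕ+ →₀ ℕ) → ℝ} (ha : OverConvergent a) :
    Summable fun A => |a A| := by
  obtain ⟨r, hr, h⟩ := ha
  exact Summable.of_nonneg_of_le (fun _ => abs_nonneg _)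
    (fun A => le_mul_of_one_le_right (abs_nonneg _) (one_le_pow₀ hr.le)) h

theorem abs_mul_monomialValue_le (a : ℝ) (A : ℕ+ →₀ ℕ) (z : Cube) :
    |a * monomialValue A z| ≤ |a| := by
  rw [abs_mul, abs_of_nonneg (monomialValue_mem A z).1]
  exact mul_le_of_le_one_right (abs_nonneg _) (monomialValue_mem A z).2

theorem OverConvergent.summable {a : (ℕ+ →₀ ℕ) → ℝ} (ha : OverConvergent a) (z : Cube) :
    Summable fun A => a A * monomialValue A z :=
  Summable.of_norm_bounded ha.summable_abs fun A => abs_mul_monomialValue_le (a A) A z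

theorem continuous_monomialValue (A : ℕ+ →₀ ℕ) : Continuous (monomialValue A) := by
  unfold monomialValue Cube.val Finsupp.prod
  fun_prop

/-- Weierstrass test: monomials lie in `[0,1]` on the cube, and each depends continuously on
finitely many coordinates. -/
theorem OverConvergent.continuous {a : (ℕ+ →₀ ℕ) → ℝ} (ha : OverConvergent a) :
    Continuous (seriesSum a) :=
  continuous_tsum (fun A => continuous_const.mul (continuous_monomialValue A)) ha.summable_abs
    fun A z => abs_mul_monomialValue_le (a A) A z

/-- The radius drops from `r` to `√r`: one of the two factors `√r ^ Σ(A)` of `r ^ Σ(A)` pays for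
`Σ(A) + 1`, the other remains as weight. -/
theorem OverConvergent.exists_summable_mul {a : (ℕ+ →₀ ℕ) → ℝ} (ha : OverConvergent a) :
    ∃ r : ℝ, 1 < r ∧ Summable fun A => |a A| * ((msum A + 1) * r ^ msum A) := by
  obtain ⟨r, hr, h⟩ := ha
  have hs : 1 < √r := by rwa [Real.lt_sqrt zero_le_one, one_pow]
  refine ⟨√r, hs, Summable.of_nonneg_of_le (fun A => by positivity) (fun A => ?_)
    (h.mul_left ((√r - 1)⁻¹ + 1))⟩
  have h1 := natCast_add_one_le_pow hs (msum A)
  have h2 : (√r) ^ msum A * (√r) ^ msum A = r ^ msum A := by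
    rw [← mul_pow, Real.mul_self_sqrt (by linarith)]
  calc |a A| * ((msum A + 1) * (√r) ^ msum A)
      ≤ |a A| * ((((√r - 1)⁻¹ + 1) * (√r) ^ msum A) * (√r) ^ msum A) := by gcongr
    _ = _ := by rw [mul_assoc ((√r - 1)⁻¹ + 1), h2]; ring

theorem OverConvergent.deriv {a : (ℕ+ →₀ ℕ) → ℝ} (ha : OverConvergent a) (j : ℕ+) :
    OverConvergent (derivCoeff j a) := by
  obtain ⟨r, hr, h⟩ := ha.exists_summable_mul
  refine ⟨r, hr, Summable.of_nonneg_of_le (fun A => by positivity) (fun A => ?_)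
    (h.comp_injective (add_left_injective (Finsupp.single j 1)))⟩
  have hr0 : 0 ≤ r := by linarith
  simp only [derivCoeff, Function.comp_apply]
  have h1 : msum A ≤ msum (A + Finsupp.single j 1) := by rw [msum_add]; omega
  have h2 : A j ≤ msum (A + Finsupp.single j 1) := (le_msum A j).trans h1
  rw [abs_mul, abs_of_nonneg (by positivity), mul_comm (_ + _ : ℝ), mul_assoc]
  have h3 : (A j : ℝ) ≤ msum (A + Finsupp.single j 1) := by exact_mod_cast h2
  have h4 := pow_le_pow_right₀ hr.le h1
  gcongr

theorem monomialValue_eq (A : ℕ+ →₀ ℕ) (j : ℕ+) (z : Cube) :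
    monomialValue A z = (z j : ℝ) ^ A j * (A.erase j).prod fun k e => z.val k ^ e :=
  (Finsupp.mul_prod_erase' A j _ fun _ => pow_zero _).symm

theorem monomialValue_update (A : ℕ+ →₀ ℕ) (j : ℕ+) (z : Cube) (s : Icc (0 : ℝ) 1) :
    monomialValue A (Function.update z j s) =
      (s : ℝ) ^ A j * (A.erase j).prod fun k e => z.val k ^ e := by
  rw [monomialValue_eq A j]
  congr 1
  · simp
  · refine Finsupp.prod_congr fun k hk => ?_
    have : k ≠ j := by
      rintro rfl
      simp at hk
    simp [Cube.val, this]

/-- Termwise differentiation in one coordinate, the derived series being dominated through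
`exists_summable_mul`. -/
theorem OverConvergent.hasPartialDerivAt {a : (ℕ+ →₀ ℕ) → ℝ} (ha : OverConvergent a) (j : ℕ+)
    (z : Cube) :
    HasPartialDerivAt (seriesSum a) j (seriesSum (derivCoeff j a) z) z := by
  obtain ⟨r, hr, hs⟩ := ha.exists_summable_mul
  have hr0 : 0 ≤ r := by linarith
  set c : (ℕ+ →₀ ℕ) → ℝ := fun A => (A.erase j).prod fun k e => z.val k ^ e with hc
  have hc01 : ∀ A, c A ∈ Icc (0 : ℝ) 1 := fun A => monomialValue_mem (A.erase j) z
  -- As `r > 1`, the closed interval lies inside an open one on which the series still converges, so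
  -- the endpoints need no separate treatment.
  have hmem : ∀ s ∈ Icc (0 : ℝ) 1, s ∈ Ioo (-r) r := fun s hs =>
    ⟨by linarith [hs.1], by linarith [hs.2]⟩
  have hder : HasDerivAt (fun s : ℝ => ∑' A, a A * (s ^ A j * c A))
      (∑' A, a A * ((A j * (z j : ℝ) ^ (A j - 1)) * c A)) (z j : ℝ) := by
    refine hasDerivAt_tsum_of_isPreconnected hs isOpen_Ioo isPreconnected_Ioo
      (y₀ := (z j : ℝ)) (g' := fun A (s : ℝ) => a A * ((A j * s ^ (A j - 1)) * c A))
      (fun A s _ => ((hasDerivAt_pow (A j) s).mul_const (c A)).const_mul (a A)) ?_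
      (hmem _ (z j).2) ?_ (hmem _ (z j).2)
    · intro A s hs
      rw [Real.norm_eq_abs, abs_mul, abs_mul, abs_mul, abs_of_nonneg (hc01 A).1, Nat.abs_cast,
        abs_pow]
      have h1 : (A j : ℝ) ≤ msum A + 1 := by
        have : (A j : ℝ) ≤ msum A := by exact_mod_cast le_msum A j
        linarith
      have h2 : |s| ^ (A j - 1) ≤ r ^ msum A :=
        (pow_le_pow_left₀ (abs_nonneg s) (abs_lt.mpr hs).le _).trans
          (pow_le_pow_right₀ hr.le ((Nat.sub_le _ _).trans (le_msum A j)))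
      have h3 := (hc01 A).2
      calc |a A| * (A j * |s| ^ (A j - 1) * c A)
          ≤ |a A| * (A j * |s| ^ (A j - 1)) := by
            refine mul_le_mul_of_nonneg_left ?_ (abs_nonneg _)
            exact mul_le_of_le_one_right (by positivity) h3
        _ ≤ |a A| * ((msum A + 1) * r ^ msum A) := by gcongr
    · refine (ha.summable z).congr fun A => ?_
      rw [monomialValue_eq A j]
  have hval : ∑' A, a A * ((A j * (z j : ℝ) ^ (A j - 1)) * c A) =
      seriesSum (derivCoeff j a) z := by
    -- Reindex by `A = B + {j}`. The multisets missed by this shift have `A j = 0`, so their terms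
    -- vanish.
    rw [seriesSum, ← (add_left_injective (Finsupp.single j 1)).tsum_eq]
    · refine tsum_congr fun B => ?_
      have herase : (B + Finsupp.single j 1).erase j = B.erase j := by
        ext k
        by_cases h : k = j <;> simp [h]
      simp only [hc, derivCoeff, monomialValue_eq B j, herase]
      simp only [Finsupp.add_apply, Finsupp.single_eq_same, Nat.add_sub_cancel]
      push_cast
      ring
    · intro A hA
      by_cases h : A j = 0
      · simp [h] at hA
      · refine ⟨A - Finsupp.single j 1, tsub_add_cancel_of_le ?_⟩
        exact Finsupp.single_le_iff.mpr (Nat.one_le_iff_ne_zero.mpr h)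
  rw [hval] at hder
  refine hder.hasDerivWithinAt.congr_of_mem (fun s hs => ?_) (z j).2
  simp only [seriesSum, monomialValue_update, projIcc_of_mem _ hs, hc]

/-- Mixed partial derivatives commute at the level of coefficients, which lets `Multiset.foldr`
iterate them over an unordered multiset. -/
instance : LeftCommutative derivCoeff where
  left_comm i j a := by
    funext A
    simp only [derivCoeff, Finsupp.add_apply]
    by_cases h : i = j
    · subst h; rfl
    · rw [Finsupp.single_eq_of_ne h, Finsupp.single_eq_of_ne (Ne.symm h), add_right_comm A]
      push_cast
      ring

/-! ### Analytic extension in finitely many coordinates -/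

/-- The monomial given by a list of `m` indices as a multilinear map, `0` for lists of other
lengths. -/
def listMonomial {n : ℕ} (l : List (Fin n)) (m : ℕ) :
    ContinuousMultilinearMap ℝ (fun _ : Fin m => Fin n → ℝ) ℝ :=
  if h : l.length = m then
    (ContinuousMultilinearMap.mkPiAlgebra ℝ (Fin m) ℝ).compContinuousLinearMap fun i =>
      ContinuousLinearMap.proj (l.get (i.cast h.symm))
  else 0

theorem norm_listMonomial_le {n : ℕ} (l : List (Fin n)) (m : ℕ) :
    ‖listMonomial l m‖ ≤ if l.length = m then 1 else 0 := by
  unfold listMonomial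
  split_ifs with h
  · refine ContinuousMultilinearMap.opNorm_le_bound zero_le_one fun v => ?_
    simp only [ContinuousMultilinearMap.compContinuousLinearMap_apply,
      ContinuousMultilinearMap.mkPiAlgebra_apply, one_mul, norm_prod]
    exact Finset.prod_le_prod (fun _ _ => norm_nonneg _) fun i _ => norm_le_pi_norm (v i) _
  · simp

theorem listMonomial_apply {n : ℕ} (l : List (Fin n)) (m : ℕ) (x : Fin n → ℝ) :
    listMonomial l m (fun _ => x) = if l.length = m then (l.map x).prod else 0 := by
  unfold listMonomial
  split_ifs with h
  · subst h
    simp only [ContinuousMultilinearMap.compContinuousLinearMap_apply,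
      ContinuousMultilinearMap.mkPiAlgebra_apply, ContinuousLinearMap.proj_apply, Fin.cast_refl]
    rw [← Fin.prod_univ_fun_getElem]
    rfl
  · simp

/-- For the sup norm every monomial has norm at most `1` as a multilinear map. The weighted sum
therefore bounds the radius of convergence from below, and absolute convergence allows grouping the
terms by degree. -/
theorem hasFPowerSeriesOnBall_listSum {ι : Type*} {n : ℕ} (b : ι → ℝ) (l : ι → List (Fin n))
    {r : ℝ} (hr : 1 < r) (hb : Summable fun i => |b i| * r ^ (l i).length) :
    HasFPowerSeriesOnBall (fun x : Fin n → ℝ => ∑' i, b i * ((l i).map x).prod)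
      (fun m => ∑' i, b i • listMonomial (l i) m) 0 (ENNReal.ofReal r) := by
  have hr0 : 0 ≤ r := by linarith
  have hterm : ∀ i m, ‖b i • listMonomial (l i) m‖ * r ^ m ≤ |b i| * r ^ (l i).length := by
    intro i m
    rw [norm_smul, Real.norm_eq_abs, mul_assoc]
    refine mul_le_mul_of_nonneg_left ?_ (abs_nonneg _)
    refine (mul_le_mul_of_nonneg_right (norm_listMonomial_le (l i) m) (by positivity)).trans ?_
    split_ifs with h
    · rw [h, one_mul]
    · rw [zero_mul]; positivity
  have hnorm : ∀ m, Summable fun i => ‖b i • listMonomial (l i) m‖ := fun m =>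
    Summable.of_nonneg_of_le (fun i => norm_nonneg _)
      (fun i => (le_mul_of_one_le_right (norm_nonneg _) (one_le_pow₀ hr.le)).trans (hterm i m)) hb
  refine ⟨?_, by simpa using by linarith, ?_⟩
  · refine FormalMultilinearSeries.le_radius_of_bound _ (∑' i, |b i| * r ^ (l i).length)
      fun m => ?_
    rw [Real.coe_toNNReal _ hr0]
    calc _ ≤ (∑' i, ‖b i • listMonomial (l i) m‖) * r ^ m := by
          gcongr
          exact norm_tsum_le_tsum_norm (hnorm m)
      _ = ∑' i, ‖b i • listMonomial (l i) m‖ * r ^ m := tsum_mul_right.symm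
      _ ≤ _ := ((hnorm m).mul_right _).tsum_le_tsum (fun i => hterm i m) hb
  · intro x hx
    rw [zero_add]
    have hxr : ∀ i, |x i| ≤ r := by
      intro i
      have h1 : ‖x‖ < r := by
        rw [Metric.eball_ofReal, mem_ball_zero_iff] at hx
        exact hx
      exact (norm_le_pi_norm x i).trans h1.le
    have habs : ∀ k : List (Fin n), |(k.map x).prod| ≤ r ^ k.length := by
      intro k
      induction k with
      | nil => simp
      | cons i k ih =>
        rw [List.map_cons, List.prod_cons, abs_mul, List.length_cons, pow_succ']
        exact mul_le_mul (hxr i) ih (abs_nonneg _) hr0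
    have hsum : Summable fun i => b i * ((l i).map x).prod :=
      Summable.of_norm_bounded hb fun i => by
        rw [Real.norm_eq_abs, abs_mul]
        exact mul_le_mul_of_nonneg_left (habs _) (abs_nonneg _)
    -- The double family over degree and index is supported on the graph of the length, so it has
    -- the same sum as the single family; summing it by fibers then gives the homogeneous parts.
    have hinj : Function.Injective fun i => ((l i).length, i) := fun i j h => (Prod.ext_iff.mp h).2
    have hprod : HasSum (fun q : ℕ × ι => b q.2 • listMonomial (l q.2) q.1 fun _ => x)
        (∑' i, b i * ((l i).map x).prod) := by
      rw [← hinj.hasSum_iff]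
      · convert hsum.hasSum using 2
        simp [listMonomial_apply]
      · rintro ⟨m, i⟩ hmi
        have : (l i).length ≠ m := fun h => hmi ⟨i, by simp [h]⟩
        simp [listMonomial_apply, this]
    refine hprod.prod_fiberwise fun m => ?_
    have h1 := ((hnorm m).of_norm).hasSum
    exact h1.mapL (ContinuousMultilinearMap.apply ℝ (fun _ : Fin m => Fin n → ℝ) ℝ fun _ => x)

/-- A monomial factors into a constant in `[0,1]`, coming from the fixed tail, and a monomial in the
first `n` coordinates. -/
theorem monomialValue_replaceFirst (n : ℕ) (A : ℕ+ →₀ ℕ) (x : Fin n → Icc (0 : ℝ) 1) (z : Cube) :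
    monomialValue A (replaceFirst n x z) =
      (∏ k ∈ A.support.filter fun k => ¬ k.natPred < n, (z k : ℝ) ^ A k) *
        ∏ i : Fin n, (x i : ℝ) ^ A (i : ℕ).succPNat := by
  rw [monomialValue, Finsupp.prod,
    ← Finset.prod_filter_mul_prod_filter_not A.support (fun k : ℕ+ => k.natPred < n), mul_comm]
  congr 1
  · refine Finset.prod_congr rfl fun k hk => ?_
    simp [Cube.val, replaceFirst, (Finset.mem_filter.mp hk).2]
  · have hinj : Function.Injective fun i : Fin n => (i : ℕ).succPNat := fun i j h =>
      Fin.ext (Nat.succPNat_injective h)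
    have himg : ∏ i : Fin n, (x i : ℝ) ^ A (i : ℕ).succPNat =
        ∏ k ∈ Finset.univ.image fun i : Fin n => (i : ℕ).succPNat,
          (replaceFirst n x z).val k ^ A k := by
      rw [Finset.prod_image hinj.injOn]
      refine Finset.prod_congr rfl fun i _ => ?_
      simp [Cube.val, replaceFirst]
    rw [himg]
    refine Finset.prod_subset ?_ ?_
    · intro k hk
      exact Finset.mem_image.mpr ⟨⟨k.natPred, (Finset.mem_filter.mp hk).2⟩, Finset.mem_univ _,
        by simp⟩
    · intro k hk hk'
      obtain ⟨i, -, rfl⟩ := Finset.mem_image.mp hk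
      have : A (i : ℕ).succPNat = 0 := by
        by_contra h
        exact hk' (Finset.mem_filter.mpr ⟨Finsupp.mem_support_iff.mpr h, by simp⟩)
      rw [this, pow_zero]

/-- The first `n` coordinates occurring in a multiset, listed with multiplicity. -/
def firstIndices (n : ℕ) (A : ℕ+ →₀ ℕ) : List (Fin n) :=
  (List.finRange n).flatMap fun i : Fin n => List.replicate (A (i : ℕ).succPNat) i

theorem prod_map_firstIndices (n : ℕ) (A : ℕ+ →₀ ℕ) (x : Fin n → ℝ) :
    ((firstIndices n A).map x).prod = ∏ i : Fin n, x i ^ A (i : ℕ).succPNat := by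
  rw [firstIndices, List.map_flatMap, List.flatMap_def, List.prod_flatten, List.map_map,
    ← List.prod_ofFn, List.ofFn_eq_map]
  congr 2
  funext i
  simp

theorem length_firstIndices_le (n : ℕ) (A : ℕ+ →₀ ℕ) : (firstIndices n A).length ≤ msum A := by
  have h : (firstIndices n A).length = ∑ i : Fin n, A (i : ℕ).succPNat := by
    rw [firstIndices, List.length_flatMap, ← List.sum_ofFn, List.ofFn_eq_map]
    congr 2
    funext i
    simp
  have hinj : Function.Injective fun i : Fin n => (i : ℕ).succPNat := fun i j h =>
    Fin.ext (Nat.succPNat_injective h)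
  rw [h, ← Finset.sum_image (f := fun k => A k) hinj.injOn, msum, Finsupp.sum]
  refine (Finset.sum_le_sum_of_ne_zero fun k _ hk => ?_).trans
    (Finset.sum_le_sum fun k _ => Nat.le_mul_of_pos_left _ k.pos)
  exact Finsupp.mem_support_iff.mpr hk

/-- The class is closed under `derivCoeff`, so derivatives of every order are again continuous sums.
Fixing the tail multiplies each coefficient by a number of absolute value at most `1`, and the ball
of radius `r > 1` contains the closed cube. -/
theorem OverConvergent.totallyAnalytic {a : (ℕ+ →₀ ℕ) → ℝ} (ha : OverConvergent a) :
    TotallyAnalytic (seriesSum a) := by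
  have hconv : ∀ M : Multiset ℕ+, OverConvergent (M.foldr derivCoeff a) := by
    intro M
    induction M using Multiset.induction_on with
    | empty => simpa using ha
    | cons j M ih => rw [Multiset.foldr_cons]; exact ih.deriv j
  refine ⟨⟨fun M => seriesSum (M.foldr derivCoeff a), by simp, fun M j z => ?_,
    fun M => (hconv M).continuous⟩, fun n z₀ => ?_⟩
  · simp only [Multiset.foldr_cons]
    exact (hconv M).hasPartialDerivAt j z
  · obtain ⟨r, hr, hs⟩ := ha
    set c : (ℕ+ →₀ ℕ) → ℝ := fun A =>
      ∏ k ∈ A.support.filter fun k => ¬ k.natPred < n, (z₀ k : ℝ) ^ A k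
    have hc : ∀ A, |c A| ≤ 1 := fun A => by
      rw [Finset.abs_prod]
      refine Finset.prod_le_one (fun _ _ => abs_nonneg _) fun k _ => ?_
      rw [abs_pow, abs_of_nonneg (z₀ k).2.1]
      exact pow_le_one₀ (z₀ k).2.1 (z₀ k).2.2
    have hb : Summable fun A => |a A * c A| * r ^ (firstIndices n A).length := by
      refine Summable.of_nonneg_of_le (fun A => by positivity) (fun A => ?_) hs
      rw [abs_mul]
      exact mul_le_mul (mul_le_of_le_one_right (abs_nonneg _) (hc A))
        (pow_le_pow_right₀ hr.le (length_firstIndices_le n A)) (by positivity) (abs_nonneg _)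
    have hps := hasFPowerSeriesOnBall_listSum (fun A => a A * c A) (firstIndices n) hr hb
    refine ⟨Metric.ball 0 r, fun x => ∑' A, a A * c A * ((firstIndices n A).map x).prod,
      Metric.isOpen_ball, fun x hx => ?_, fun x hx => ?_, fun x => tsum_congr fun A => ?_⟩
    · rw [mem_ball_zero_iff]
      refine lt_of_le_of_lt ((pi_norm_le_iff_of_nonneg zero_le_one).mpr fun i => ?_) hr
      rw [Real.norm_eq_abs, abs_of_nonneg (hx.1 i)]
      exact hx.2 i
    · exact hps.analyticAt_of_mem (by rwa [Metric.eball_ofReal])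
    · rw [monomialValue_replaceFirst, prod_map_firstIndices, mul_assoc]

/-! ### Measurability of the tiles -/

instance : MeasurableSpace ℕ+ := ⊤

instance : DiscreteMeasurableSpace ℕ+ := ⟨fun _ => trivial⟩

@[fun_prop]
theorem measurable_coord : Measurable coord := by
  have h : Measurable fun x : ℝ => ⌊(1 - Int.fract x)⁻¹⌋₊ :=
    Nat.measurable_floor.comp (measurable_const.sub measurable_fract).inv
  exact (Measurable.of_discrete (f := fun m : ℕ => (Nat.log 2 m).succPNat)).comp h

/-- Whatever depends on block indices only factors through a countable discrete space, so nothing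
has to be known about the parameters. -/
theorem measurable_coord_pair {β : Type*} [MeasurableSpace β] (p : ℕ+ → ℕ+ → β) :
    Measurable fun q : ℝ × ℝ => p (coord (3 * q.1)) (coord (3 * q.2)) := by
  have h : Measurable fun q : ℝ × ℝ => (coord (3 * q.1), coord (3 * q.2)) := by fun_prop
  exact (Measurable.of_discrete (f := fun k : ℕ+ × ℕ+ => p k.1 k.2)).comp h

theorem measurable_coord_left {β : Type*} [MeasurableSpace β] (p : ℕ+ → β) :
    Measurable fun q : ℝ × ℝ => p (coord (3 * q.1)) :=
  measurable_coord_pair fun k _ => p k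

theorem measurable_coord_right {β : Type*} [MeasurableSpace β] (p : ℕ+ → β) :
    Measurable fun q : ℝ × ℝ => p (coord (3 * q.2)) :=
  measurable_coord_pair fun _ k => p k

section Measurability

variable (P : BoundingSequence) (W₀ : ℝ → ℝ → ℝ) (z : Cube)

theorem measurable_WF : Measurable fun q : ℝ × ℝ => WF P q.1 q.2 := by
  have h1 := measurable_coord_pair fun k m => k = m
  have h2 := measurable_coord_pair fun k m => Linked (multiset k) (multiset m)
  have h3 := measurable_coord_pair fun k m => Linked (multiset m) (multiset k)
  have h4 := measurable_coord_pair fun k m => 9 * 2 ^ (2 * (m : ℕ)) * P.coeffPos k m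
  have h5 := measurable_coord_pair fun k m => 9 * 2 ^ (2 * (m : ℕ)) * P.coeffNeg k m
  have h6 := measurable_coord_pair fun m k => 9 * 2 ^ (2 * (m : ℕ)) * P.coeffPos k m
  have h7 := measurable_coord_pair fun m k => 9 * 2 ^ (2 * (m : ℕ)) * P.coeffNeg k m
  have h8 := measurable_coord_left fun k => 1 - P.u k
  have h9 := measurable_coord_left fun k => P.l k
  have ht : ∀ c : ℝ, Measurable fun q : ℝ × ℝ => q.1 < c := fun c => by fun_prop
  have ht' : ∀ c : ℝ, Measurable fun q : ℝ × ℝ => q.2 < c := fun c => by fun_prop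
  have hs : ∀ c : ℝ, Measurable fun q : ℝ × ℝ => c ≤ q.1 := fun c => by fun_prop
  have hs' : ∀ c : ℝ, Measurable fun q : ℝ × ℝ => c ≤ q.2 := fun c => by fun_prop
  have hm : ∀ a b : ℝ, Measurable fun q : ℝ × ℝ => q.1 ∈ Ico a b := fun a b => (hs a).and (ht b)
  have hm' : ∀ a b : ℝ, Measurable fun q : ℝ × ℝ => q.2 ∈ Ico a b := fun a b =>
    (hs' a).and (ht' b)
  unfold WF
  refine Measurable.ite ((ht _).and ((ht' _).and ((hs _).and (hs' _)).not)).setOf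
    (Measurable.ite (((hm _ _).and ((hm' _ _).and h1)).or
      (((hm _ _).and ((hm' _ _).and h2)).or ((hm' _ _).and ((hm _ _).and h3)))).setOf
      measurable_const measurable_const) ?_
  refine Measurable.ite ((hs _).and (ht' _)).setOf h4 ?_
  refine Measurable.ite ((hs _).and (ht' _)).setOf h5 ?_
  refine Measurable.ite ((ht _).and (hs' _)).setOf h6 ?_
  refine Measurable.ite ((ht _).and (hs' _)).setOf h7 ?_
  refine Measurable.ite ((ht _).and (ht' _)).setOf ?_ ?_
  · exact Measurable.ite h1.setOf h8 measurable_const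
  · exact Measurable.ite h1.setOf h9 measurable_const

theorem measurable_tileCC : Measurable fun q : ℝ × ℝ => tileCC z q.1 q.2 := by
  have h1 := measurable_coord_pair fun k m => k = m
  have h2 := measurable_coord_left fun k => monomialValue (multiset k) z
  have h3 := measurable_coord_left fun k => 1 - monomialValue (multiset k) z
  unfold tileCC
  refine Measurable.ite (Measurable.setOf (by fun_prop))
    (Measurable.ite (Measurable.setOf (by fun_prop)) h2 h3) measurable_const

theorem measurable_tileCD (k : Fin 7) : Measurable fun q : ℝ × ℝ => tileCD P k q.1 q.2 := by
  have h1 := measurable_coord_pair fun k m => k = m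
  have h2 := measurable_WF P
  unfold tileCD
  simp only [mem_Ico]
  split_ifs
  · exact Measurable.ite (Measurable.setOf (by fun_prop)) measurable_const measurable_const
  · exact Measurable.ite (Measurable.setOf (by fun_prop)) measurable_const measurable_const
  · exact Measurable.ite (Measurable.setOf (by fun_prop)) measurable_const measurable_const
  · exact Measurable.ite (Measurable.setOf (by fun_prop)) h2 measurable_const
  · exact measurable_const

theorem measurable_tileCE : Measurable fun q : ℝ × ℝ => tileCE P z q.1 q.2 := by
  have h1 := measurable_coord_left fun k => P.pval k z
  have h2 := measurable_coord_left fun k => (2 : ℝ) ^ (k : ℕ)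
  unfold tileCE
  simp only [mem_Ico]
  exact Measurable.ite (Measurable.setOf (by fun_prop)) measurable_const measurable_const

theorem measurable_tileGE : Measurable fun q : ℝ × ℝ => tileGE P q.1 q.2 := by
  have h1 := measurable_coord_right fun k => P.u k
  have h2 := measurable_coord_right fun k => P.l k
  have h3 := measurable_coord_right fun k => (2 : ℝ) ^ (k : ℕ)
  have h4 := measurable_coord_pair fun k m => k = m
  unfold tileGE
  simp only [mem_Ico]
  exact Measurable.ite (Measurable.setOf (by fun_prop)) measurable_const measurable_const

variable {W₀}

theorem measurable_upperTile (hW : Measurable fun q : ℝ × ℝ => W₀ q.1 q.2) (X Y : Core) :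
    Measurable fun q : ℝ × ℝ => upperTile P W₀ z X Y q.1 q.2 := by
  have h1 := measurable_coord_pair fun k m => k = m
  have hA : Measurable fun q : ℝ × ℝ => if ⌊3 * q.1⌋ = ⌊3 * q.2⌋ then (1 : ℝ) else 0 :=
    Measurable.ite (Measurable.setOf (by fun_prop)) measurable_const measurable_const
  have hB : Measurable fun q : ℝ × ℝ =>
      if ⌊3 * q.1⌋ = ⌊3 * q.2⌋ ∧ coord (3 * q.1) = coord (3 * q.2) then (1 : ℝ) else 0 :=
    Measurable.ite (Measurable.setOf (by fun_prop)) measurable_const measurable_const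
  have hF : Measurable fun q : ℝ × ℝ => if 1 ≤ q.1 + q.2 then (1 : ℝ) else 0 :=
    Measurable.ite (Measurable.setOf (by fun_prop)) measurable_const measurable_const
  have hGE : ∀ k : Fin 7, Measurable fun q : ℝ × ℝ => if k = 6 then tileGE P q.1 q.2 else 0 := by
    intro k
    split_ifs
    · exact measurable_tileGE P
    · exact measurable_const
  have hD : ∀ j k : Fin 7, Measurable fun q : ℝ × ℝ => W₀ (hostEmbed j q.1) (hostEmbed k q.2) := by
    intro j k
    have h : Measurable fun q : ℝ × ℝ => (hostEmbed j q.1, hostEmbed k q.2) := by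
      unfold hostEmbed; fun_prop
    exact hW.comp h
  cases X <;> cases Y <;> simp only [upperTile] <;>
    first
    | exact measurable_const | exact hA | exact hB | exact hF | exact hGE _ | exact hD _ _
    | exact measurable_tileCC z | exact measurable_tileCD P _ | exact measurable_tileCE P z

theorem measurable_coreTile (hW : Measurable fun q : ℝ × ℝ => W₀ q.1 q.2) (X Y : Core) :
    Measurable fun q : ℝ × ℝ => coreTile P W₀ z X Y q.1 q.2 := by
  unfold coreTile
  split_ifs
  · exact measurable_upperTile P z hW X Y
  · exact (measurable_upperTile P z hW Y X).comp measurable_swap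

theorem measurable_coreDegree (hW : Measurable fun q : ℝ × ℝ => W₀ q.1 q.2) (X : Core) :
    Measurable (coreDegree P W₀ z X) := by
  have h : ∀ Y, Measurable fun x => ∫ s in Ico (0 : ℝ) 1, coreTile P W₀ z X Y x s := fun Y =>
    (StronglyMeasurable.integral_prod_right
      (f := fun x s => coreTile P W₀ z X Y x s)
      (measurable_coreTile P z hW X Y).stronglyMeasurable).measurable
  unfold coreDegree
  fun_prop

theorem measurable_tile (hW : Measurable fun q : ℝ × ℝ => W₀ q.1 q.2) (X Y : Part) :
    Measurable fun q : ℝ × ℝ => tile P W₀ z X Y q.1 q.2 := by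
  have h := measurable_coreDegree P z hW
  cases X <;> cases Y <;> simp only [tile]
  case core.core X Y => exact measurable_coreTile P z hW X Y
  all_goals fun_prop

end Measurability

/-! ### The parts as subintervals, and the graphon axioms for `WP` -/

theorem floor_mul_lt_iff (s : ℝ) (k : ℕ) [NeZero k] : s < k / 25 ↔ ⌊25 * s⌋₊ < k := by
  rw [Nat.floor_lt' (NeZero.ne k), lt_div_iff₀ (by norm_num), mul_comm]

/-- The part depends on `s` only through an integer, because all endpoints are multiples of `1/25`.
Measurability of `WP` thus becomes a matter of countably many tiles. -/
theorem partOf_floor (s : ℝ) : partOf (⌊25 * s⌋₊ / 25) = partOf s := by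
  have h : ∀ (k : ℕ) [NeZero k], ((⌊25 * s⌋₊ : ℝ) / 25 < k / 25) = (s < k / 25) := by
    intro k _
    rw [floor_mul_lt_iff, mul_div_cancel₀ _ (by norm_num), Nat.floor_natCast, floor_mul_lt_iff]
  have h25 : ⌊25 * ((⌊25 * s⌋₊ : ℝ) / 25)⌋₊ = ⌊25 * s⌋₊ := by
    rw [mul_div_cancel₀ _ (by norm_num), Nat.floor_natCast]
  have h1 := h 1
  have h2 := h 2
  have h3 := h 3
  have h11 := h 11
  have h12 := h 12
  have h24 := h 24
  push_cast at h1 h2 h3 h11 h12 h24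
  unfold partOf
  simp only [h1, h2, h3, h11, h12, h24, h25]

theorem embed_partOf {s : ℝ} (hs : s ∈ Ico (0 : ℝ) 1) :
    (s - (partOf s).start) / (partOf s).size ∈ Ico (0 : ℝ) 1 ∧
      (partOf s).embed ((s - (partOf s).start) / (partOf s).size) = s := by
  have hsize : ∀ X : Part, 0 < X.size := by
    rintro (_ | _ | _) <;> norm_num [Part.size]
  have hmem : (partOf s).start ≤ s ∧ s < (partOf s).start + (partOf s).size := by
    have h0 := hs.1
    have hfl := Nat.floor_le (show 0 ≤ 25 * s by linarith)
    have hfl' := Nat.lt_floor_add_one (25 * s)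
    unfold partOf
    split_ifs with h1 h2 h3 h4 h5 h6 h7 <;> simp only [Part.start, Part.size, Core.idx]
    · constructor <;> norm_num <;> linarith
    · constructor <;> norm_num <;> linarith
    · constructor <;> norm_num <;> linarith
    · have : ((⌊25 * s⌋₊ - 3 : ℕ) : ℝ) = (⌊25 * s⌋₊ : ℝ) - 3 := by
        rw [Nat.cast_sub h4.1]; norm_num
      push_cast
      rw [this]
      constructor <;> linarith
    · have h3' : 3 ≤ ⌊25 * s⌋₊ := Nat.le_floor (by push_cast; linarith)
      have h10 : (10 : ℝ) ≤ ⌊25 * s⌋₊ := by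
        exact_mod_cast not_lt.mp fun h => h4 ⟨h3', h⟩
      constructor <;> norm_num <;> linarith
    · constructor <;> norm_num <;> linarith
    · constructor <;> norm_num <;> linarith
    · have := hs.2
      constructor <;> norm_num <;> linarith
  refine ⟨⟨div_nonneg (by linarith [hmem.1]) (hsize _).le, ?_⟩, ?_⟩
  · rw [div_lt_one (hsize _)]; linarith [hmem.2]
  · rw [Part.embed, mul_div_cancel₀ _ (hsize _).ne']; ring

theorem Part.embed_mem (X : Part) {x : ℝ} (hx : x ∈ Ico (0 : ℝ) 1) :
    X.embed x ∈ Ico (0 : ℝ) 1 := by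
  obtain ⟨h0, h1⟩ := hx
  rcases X with (_ | _ | _ | k | _ | _) | _ | _
  case core.D =>
    have hk : ((k : ℕ) : ℝ) ≤ 6 := by exact_mod_cast Nat.lt_succ_iff.mp k.2
    have hk0 : (0 : ℝ) ≤ ((k : ℕ) : ℝ) := Nat.cast_nonneg _
    simp only [Part.embed, Part.start, Part.size, Core.idx]
    push_cast
    constructor <;> linarith
  all_goals
    simp only [Part.embed, Part.start, Part.size, Core.idx]
    push_cast
    constructor <;> linarith

section Bounds

variable {P : BoundingSequence} {W₀ : ℝ → ℝ → ℝ}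

theorem hostEmbed_mem (k : Fin 7) {x : ℝ} (hx : x ∈ Ico (0 : ℝ) 1) :
    hostEmbed k x ∈ Ico (0 : ℝ) 1 := by
  have hk : ((k : ℕ) : ℝ) ≤ 6 := by exact_mod_cast Nat.lt_succ_iff.mp k.2
  have hk0 : (0 : ℝ) ≤ ((k : ℕ) : ℝ) := Nat.cast_nonneg _
  unfold hostEmbed
  constructor <;> linarith [hx.1, hx.2]

theorem upperTile_mem (hW : ∀ x ∈ Ico (0 : ℝ) 1, ∀ y ∈ Ico (0 : ℝ) 1, W₀ x y ∈ Icc (0 : ℝ) 1)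
    (hF : ∀ x ∈ Ico (0 : ℝ) 1, ∀ y ∈ Ico (0 : ℝ) 1, WF P x y ∈ Icc (0 : ℝ) 1)
    (z : Cube) (X Y : Core) {x y : ℝ} (hx : x ∈ Ico (0 : ℝ) 1) (hy : y ∈ Ico (0 : ℝ) 1) :
    upperTile P W₀ z X Y x y ∈ Icc (0 : ℝ) 1 := by
  have h0 : (0 : ℝ) ∈ Icc (0 : ℝ) 1 := ⟨le_rfl, zero_le_one⟩
  have h1 : (1 : ℝ) ∈ Icc (0 : ℝ) 1 := ⟨zero_le_one, le_rfl⟩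
  have hm : ∀ A, monomialValue A z ∈ Icc (0 : ℝ) 1 := fun A => monomialValue_mem A z
  have hm' : ∀ A, 1 - monomialValue A z ∈ Icc (0 : ℝ) 1 := fun A =>
    ⟨by linarith [(hm A).2], by linarith [(hm A).1]⟩
  cases X <;> cases Y <;>
    simp only [upperTile, tileCC, tileCD, tileCE, tileGE] <;> (try split_ifs) <;>
    first
    | exact h0 | exact h1 | exact hm _ | exact hm' _ | exact hF _ hx _ hy
    | exact hW _ (hostEmbed_mem _ hx) _ (hostEmbed_mem _ hy)

theorem coreTile_mem (hW : ∀ x ∈ Ico (0 : ℝ) 1, ∀ y ∈ Ico (0 : ℝ) 1, W₀ x y ∈ Icc (0 : ℝ) 1)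
    (hF : ∀ x ∈ Ico (0 : ℝ) 1, ∀ y ∈ Ico (0 : ℝ) 1, WF P x y ∈ Icc (0 : ℝ) 1)
    (z : Cube) (X Y : Core) {x y : ℝ} (hx : x ∈ Ico (0 : ℝ) 1) (hy : y ∈ Ico (0 : ℝ) 1) :
    coreTile P W₀ z X Y x y ∈ Icc (0 : ℝ) 1 := by
  unfold coreTile
  split_ifs
  · exact upperTile_mem hW hF z X Y hx hy
  · exact upperTile_mem hW hF z Y X hy hx

theorem setIntegral_Ico_mem {f : ℝ → ℝ} (hf : ∀ s ∈ Ico (0 : ℝ) 1, f s ∈ Icc (0 : ℝ) 1) :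
    ∫ s in Ico (0 : ℝ) 1, f s ∈ Icc (0 : ℝ) 1 := by
  refine ⟨setIntegral_nonneg measurableSet_Ico fun s hs => (hf s hs).1, ?_⟩
  have h := norm_setIntegral_le_of_norm_le_const (μ := volume) (s := Ico (0 : ℝ) 1) (f := f)
    (C := 1) (by simp) fun s hs => by
      rw [Real.norm_eq_abs, abs_of_nonneg (hf s hs).1]; exact (hf s hs).2
  rw [measureReal_def, Real.volume_Ico] at h
  norm_num at h
  exact (le_abs_self _).trans h

theorem coreDegree_mem
    (hW : ∀ x ∈ Ico (0 : ℝ) 1, ∀ y ∈ Ico (0 : ℝ) 1, W₀ x y ∈ Icc (0 : ℝ) 1)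
    (hF : ∀ x ∈ Ico (0 : ℝ) 1, ∀ y ∈ Ico (0 : ℝ) 1, WF P x y ∈ Icc (0 : ℝ) 1)
    (z : Cube) (X : Core) {x : ℝ} (hx : x ∈ Ico (0 : ℝ) 1) :
    coreDegree P W₀ z X x ∈ Icc (0 : ℝ) 12 := by
  have h : ∀ Y, ∫ s in Ico (0 : ℝ) 1, coreTile P W₀ z X Y x s ∈ Icc (0 : ℝ) 1 := fun Y =>
    setIntegral_Ico_mem fun s hs => coreTile_mem hW hF z X Y hx hs
  have hD0 : 0 ≤ ∑ k : Fin 7, ∫ s in Ico (0 : ℝ) 1, coreTile P W₀ z X (.D k) x s :=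
    Finset.sum_nonneg fun k _ => (h _).1
  have hD1 : ∑ k : Fin 7, ∫ s in Ico (0 : ℝ) 1, coreTile P W₀ z X (.D k) x s ≤ 7 := by
    refine (Finset.sum_le_sum fun k _ => (h (.D k)).2).trans ?_
    simp
  have hA := h .A
  have hB := h .B
  have hC := h .C
  have hE := h .E
  have hF' := h .F
  unfold coreDegree
  constructor <;> linarith [hA.1, hA.2, hB.1, hB.2, hC.1, hC.2, hE.1, hE.2, hF'.1, hF'.2]

theorem Core.idx_le (X : Core) : X.idx ≤ 11 := by
  cases X <;> simp only [Core.idx] <;> omega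

theorem Core.idx_injective : Function.Injective Core.idx := by
  intro X Y h
  cases X <;> cases Y <;> dsimp only [Core.idx] at h <;>
    first | rfl | omega | exact congrArg Core.D (Fin.ext (by omega))

theorem tile_mem (hW : ∀ x ∈ Ico (0 : ℝ) 1, ∀ y ∈ Ico (0 : ℝ) 1, W₀ x y ∈ Icc (0 : ℝ) 1)
    (hF : ∀ x ∈ Ico (0 : ℝ) 1, ∀ y ∈ Ico (0 : ℝ) 1, WF P x y ∈ Icc (0 : ℝ) 1)
    (z : Cube) (X Y : Part) {x y : ℝ} (hx : x ∈ Ico (0 : ℝ) 1) (hy : y ∈ Ico (0 : ℝ) 1) :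
    tile P W₀ z X Y x y ∈ Icc (0 : ℝ) 1 := by
  have hidx : ∀ X : Core, ((X.idx : ℝ) + 1) / 25 ∈ Icc (0 : ℝ) 1 := by
    intro X
    have : (X.idx : ℝ) ≤ 11 := by exact_mod_cast X.idx_le
    have h0 : (0 : ℝ) ≤ X.idx := Nat.cast_nonneg _
    constructor <;> linarith
  have hdeg : ∀ (X : Core) {x : ℝ}, x ∈ Ico (0 : ℝ) 1 →
      (12 - coreDegree P W₀ z X x) / 12 ∈ Icc (0 : ℝ) 1 := by
    intro X x hx
    have := coreDegree_mem hW hF z X hx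
    constructor <;> linarith [this.1, this.2]
  cases X <;> cases Y <;> simp only [tile] <;>
    first
    | exact coreTile_mem hW hF z _ _ hx hy | exact hidx _ | exact hdeg _ hx | exact hdeg _ hy
    | exact ⟨zero_le_one, le_rfl⟩ | exact ⟨le_rfl, zero_le_one⟩

/-- Off the diagonal, symmetry is built into `coreTile`; only the tiles of a part with itself must
be inspected. -/
theorem coreTile_comm (hW : ∀ x ∈ Ico (0 : ℝ) 1, ∀ y ∈ Ico (0 : ℝ) 1, W₀ x y = W₀ y x)
    (z : Cube) (X Y : Core) {x y : ℝ} (hx : x ∈ Ico (0 : ℝ) 1) (hy : y ∈ Ico (0 : ℝ) 1) :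
    coreTile P W₀ z X Y x y = coreTile P W₀ z Y X y x := by
  rcases lt_trichotomy X.idx Y.idx with h | h | h
  · rw [coreTile, coreTile, if_pos h.le, if_neg (by omega)]
  · obtain rfl := Core.idx_injective h
    simp only [coreTile, le_refl, if_true]
    cases X <;> simp only [upperTile]
    case A => simp only [eq_comm]
    case B => simp only [eq_comm]
    case C =>
      simp only [tileCC]
      by_cases hc : coord (3 * x) = coord (3 * y)
      · simp only [hc, eq_comm (a := ⌊3 * x⌋), ← and_assoc, and_comm (a := x < 2 / 3)]
      · simp [hc, Ne.symm hc]
    case D k => exact hW _ (hostEmbed_mem k hx) _ (hostEmbed_mem k hy)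
    case F => simp only [add_comm]
  · rw [coreTile, coreTile, if_neg (by omega), if_pos h.le]

theorem tile_comm (hW : ∀ x ∈ Ico (0 : ℝ) 1, ∀ y ∈ Ico (0 : ℝ) 1, W₀ x y = W₀ y x)
    (z : Cube) (X Y : Part) {x y : ℝ} (hx : x ∈ Ico (0 : ℝ) 1) (hy : y ∈ Ico (0 : ℝ) 1) :
    tile P W₀ z X Y x y = tile P W₀ z Y X y x := by
  cases X <;> cases Y <;> simp only [tile]
  exact coreTile_comm hW z _ _ hx hy

theorem coreTile_congr {W₁ : ℝ → ℝ → ℝ}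
    (h : ∀ x ∈ Ico (0 : ℝ) 1, ∀ y ∈ Ico (0 : ℝ) 1, W₀ x y = W₁ x y) (z : Cube) (X Y : Core)
    {x y : ℝ} (hx : x ∈ Ico (0 : ℝ) 1) (hy : y ∈ Ico (0 : ℝ) 1) :
    coreTile P W₀ z X Y x y = coreTile P W₁ z X Y x y := by
  unfold coreTile
  cases X <;> cases Y <;> simp only [upperTile]
  rw [h _ (hostEmbed_mem _ hx) _ (hostEmbed_mem _ hy),
    h _ (hostEmbed_mem _ hy) _ (hostEmbed_mem _ hx)]

/-- This permits replacing the host by a version measurable on the whole plane. The degrees are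
covered too, since their integrals only run over `[0,1)`. -/
theorem tile_congr {W₁ : ℝ → ℝ → ℝ}
    (h : ∀ x ∈ Ico (0 : ℝ) 1, ∀ y ∈ Ico (0 : ℝ) 1, W₀ x y = W₁ x y) (z : Cube) (X Y : Part)
    {x y : ℝ} (hx : x ∈ Ico (0 : ℝ) 1) (hy : y ∈ Ico (0 : ℝ) 1) :
    tile P W₀ z X Y x y = tile P W₁ z X Y x y := by
  have hint : ∀ (X Y : Core) {x : ℝ}, x ∈ Ico (0 : ℝ) 1 →
      ∫ s in Ico (0 : ℝ) 1, coreTile P W₀ z X Y x s =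
        ∫ s in Ico (0 : ℝ) 1, coreTile P W₁ z X Y x s := fun X Y x hx =>
    setIntegral_congr_fun measurableSet_Ico fun s hs => coreTile_congr h z X Y hx hs
  have hdeg : ∀ (X : Core) {x : ℝ}, x ∈ Ico (0 : ℝ) 1 →
      coreDegree P W₀ z X x = coreDegree P W₁ z X x := by
    intro X x hx
    simp only [coreDegree, hint X _ hx]
  cases X <;> cases Y <;> simp only [tile]
  · exact coreTile_congr h z _ _ hx hy
  · rw [hdeg _ hx]
  · rw [hdeg _ hy]

/-- A graphon agrees on `[0,1)²` with a measurable function on the plane. -/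
theorem IsGraphon.exists_measurable {W : ℝ → ℝ → ℝ} (hW : IsGraphon W) :
    ∃ W₁ : ℝ → ℝ → ℝ, (Measurable fun q : ℝ × ℝ => W₁ q.1 q.2) ∧
      ∀ x ∈ Ico (0 : ℝ) 1, ∀ y ∈ Ico (0 : ℝ) 1, W x y = W₁ x y := by
  have he : MeasurableEmbedding
      (Prod.map Subtype.val Subtype.val : Ico (0 : ℝ) 1 × Ico (0 : ℝ) 1 → ℝ × ℝ) :=
    (MeasurableEmbedding.subtype_coe measurableSet_Ico).prodMap
      (MeasurableEmbedding.subtype_coe measurableSet_Ico)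
  obtain ⟨g, hg, hgW⟩ := he.exists_measurable_extend hW.measurable fun _ => ⟨0⟩
  exact ⟨fun x y => g (x, y), hg, fun x hx y hy => (congrFun hgW (⟨x, hx⟩, ⟨y, hy⟩)).symm⟩

theorem measurable_WP (hW : Measurable fun q : ℝ × ℝ => W₀ q.1 q.2) (z : Cube) :
    Measurable fun q : ℝ × ℝ => WP P W₀ z q.1 q.2 := by
  have hnat : Measurable fun p : (ℕ × ℕ) × (ℝ × ℝ) =>
      tile P W₀ z (partOf (p.1.1 / 25)) (partOf (p.1.2 / 25))
        ((p.2.1 - (partOf (p.1.1 / 25)).start) / (partOf (p.1.1 / 25)).size)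
        ((p.2.2 - (partOf (p.1.2 / 25)).start) / (partOf (p.1.2 / 25)).size) := by
    refine measurable_from_prod_countable_right fun m => ?_
    have h : ∀ X Y : Part, Measurable fun q : ℝ × ℝ =>
        ((q.1 - X.start) / X.size, (q.2 - Y.start) / Y.size) := fun X Y => by fun_prop
    exact (measurable_tile P z hW (partOf (m.1 / 25)) (partOf (m.2 / 25))).comp
      (h (partOf (m.1 / 25)) (partOf (m.2 / 25)))
  have hpair : Measurable fun q : ℝ × ℝ => ((⌊25 * q.1⌋₊, ⌊25 * q.2⌋₊), q) := by fun_prop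
  have hc := hnat.comp hpair
  simpa only [Function.comp_def, partOf_floor, WP] using hc

/-- The bounds on `WF` are inherited from the host, of which it is a tile. -/
theorem isGraphon_WP (hW₀ : IsGraphon W₀)
    (hG : ∀ x ∈ Ico (0 : ℝ) 1, ∀ y ∈ Ico (0 : ℝ) 1,
      W₀ (hostEmbed 6 x) (hostEmbed 6 y) = WF P x y) (z : Cube) : IsGraphon (WP P W₀ z) := by
  have hF : ∀ x ∈ Ico (0 : ℝ) 1, ∀ y ∈ Ico (0 : ℝ) 1, WF P x y ∈ Icc (0 : ℝ) 1 :=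
    fun x hx y hy => hG x hx y hy ▸ hW₀.mem _ (hostEmbed_mem 6 hx) _ (hostEmbed_mem 6 hy)
  refine ⟨?_, fun x hx y hy => ?_, fun x hx y hy => ?_⟩
  · obtain ⟨W₁, hm, hW₁⟩ := hW₀.exists_measurable
    have h : Measurable fun q : Ico (0 : ℝ) 1 × Ico (0 : ℝ) 1 => WP P W₁ z q.1 q.2 :=
      (measurable_WP (P := P) hm z).comp
        ((measurable_subtype_coe.comp measurable_fst).prodMk
          (measurable_subtype_coe.comp measurable_snd))
    convert h using 2 with q
    exact tile_congr hW₁ z _ _ (embed_partOf q.1.2).1 (embed_partOf q.2.2).1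
  · exact tile_comm hW₀.symm z _ _ (embed_partOf hx).1 (embed_partOf hy).1
  · exact tile_mem hW₀.mem hF z _ _ (embed_partOf hx).1 (embed_partOf hy).1

end Bounds

/-! ### Integrals over boxes and blocks -/

/-- Change of variables by a diagonal affine map. A degenerate box is treated apart: it is empty,
and the product of the side lengths vanishes. -/
theorem integral_pi_Ico {n : ℕ} {a b : Fin n → ℝ} (hab : ∀ i, a i ≤ b i)
    (F : (Fin n → ℝ) → ℝ) :
    ∫ x in univ.pi fun i => Ico (a i) (b i), F x =
      (∏ i, (b i - a i)) * ∫ t in unitBox n, F fun i => a i + (b i - a i) * t i := by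
  by_cases h : ∃ i, a i = b i
  · obtain ⟨i, hi⟩ := h
    have hempty : (univ.pi fun i => Ico (a i) (b i)) = ∅ :=
      univ_pi_eq_empty (i := i) (by rw [hi, Ico_self])
    rw [hempty, setIntegral_empty, Finset.prod_eq_zero (Finset.mem_univ i) (by rw [hi, sub_self]),
      zero_mul]
  · push Not at h
    have hpos : ∀ i, 0 < b i - a i := fun i => sub_pos.mpr ((hab i).lt_of_ne (h i))
    set f : (Fin n → ℝ) → Fin n → ℝ := fun t i => a i + (b i - a i) * t i with hf
    have himage : f '' unitBox n = univ.pi fun i => Ico (a i) (b i) := by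
      ext x
      constructor
      · rintro ⟨t, ht, rfl⟩ i -
        have h1 := ht i (mem_univ i)
        have := hpos i
        simp only [hf]
        exact ⟨by nlinarith [h1.1], by nlinarith [h1.2]⟩
      · intro hx
        refine ⟨fun i => (x i - a i) / (b i - a i), fun i _ => ?_, ?_⟩
        · have h1 := hx i (mem_univ i)
          refine ⟨div_nonneg (by linarith [h1.1]) (hpos i).le, ?_⟩
          rw [div_lt_one (hpos i)]
          linarith [h1.2]
        · funext i
          simp only [hf]
          rw [mul_div_cancel₀ _ (hpos i).ne']
          ring
    have hinj : InjOn f (unitBox n) := by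
      intro s _ t _ hst
      funext i
      have := congrFun hst i
      simp only [hf] at this
      exact mul_left_cancel₀ (hpos i).ne' (add_left_cancel this)
    let f' : (Fin n → ℝ) →L[ℝ] Fin n → ℝ :=
      LinearMap.toContinuousLinearMap (Matrix.toLin' (Matrix.diagonal fun i => b i - a i))
    have hderiv : ∀ t ∈ unitBox n, HasFDerivWithinAt f f' (unitBox n) t := by
      intro t _
      have h1 : f = fun t => a + f' t := by
        funext t i
        simp [f', hf, Matrix.mulVec_diagonal]
      rw [h1]
      exact (f'.hasFDerivAt.const_add a).hasFDerivWithinAt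
    have hdet : |f'.det| = ∏ i, (b i - a i) := by
      have : f'.det = ∏ i, (b i - a i) := by
        simp [f', ContinuousLinearMap.det, LinearMap.det_toLin']
      rw [this, abs_of_nonneg (Finset.prod_nonneg fun i _ => (hpos i).le)]
    have hmeas : MeasurableSet (unitBox n) := MeasurableSet.univ_pi fun _ => measurableSet_Ico
    rw [← himage, integral_image_eq_integral_abs_det_fderiv_smul volume hmeas hderiv hinj]
    simp only [hdet, smul_eq_mul, integral_const_mul]
    rfl

theorem coord_eq_iff_rel (x : ℝ) (k : ℕ+) : coord x = k ↔
    0 ≤ 2 ^ (k : ℕ) * (Int.fract x - 1) + 2 ∧ 2 ^ (k : ℕ) * (Int.fract x - 1) + 2 < 1 := by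
  rw [coord_eq_iff, J, mem_Ico]
  have h2 : (0 : ℝ) < 2 ^ (k : ℕ) := by positivity
  have hinv : (1 / 2 : ℝ) ^ (k : ℕ) * 2 ^ (k : ℕ) = 1 := by
    rw [← mul_pow]; norm_num
  constructor
  · rintro ⟨h3, h4⟩
    constructor <;> nlinarith
  · rintro ⟨h3, h4⟩
    constructor
    · by_contra! h
      nlinarith
    · by_contra! h
      nlinarith

/-- The relative position of a point in the block number `k` of the `j`-th third. -/
def relPos (k : ℕ+) (j : ℕ) (x : ℝ) : ℝ := 2 ^ (k : ℕ) * (3 * x - (j + 1)) + 2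

theorem blockStart_relPos (k : ℕ+) (j : ℕ) (x : ℝ) :
    blockStart k j + (1 / 2) ^ (k : ℕ) / 3 * relPos k j x = x := by
  have hinv : (2 : ℝ) ^ (k : ℕ) * (1 / 2 : ℝ) ^ (k : ℕ) = 1 := by
    rw [← mul_pow]; norm_num
  unfold relPos blockStart
  linear_combination (x - (j + 1) / 3) * hinv

/-- A relative position in `[0,1)` already determines the third, because a block has length at most
half that of its third. -/
theorem block_iff (k : ℕ+) (j : ℕ) (x : ℝ) :
    (⌊3 * x⌋ = j ∧ coord (3 * x) = k) ↔ 0 ≤ relPos k j x ∧ relPos k j x < 1 := by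
  have h2 : (2 : ℝ) ≤ 2 ^ (k : ℕ) := by
    simpa using pow_le_pow_right₀ (one_le_two (α := ℝ)) k.pos
  constructor
  · rintro ⟨h1, h⟩
    rw [coord_eq_iff_rel, Int.fract, h1] at h
    have : relPos k j x = 2 ^ (k : ℕ) * (3 * x - ((j : ℤ) : ℝ) - 1) + 2 := by
      unfold relPos; push_cast; ring
    rwa [this]
  · intro h
    have h1 : ⌊3 * x⌋ = (j : ℤ) := by
      rw [Int.floor_eq_iff]
      unfold relPos at h
      push_cast
      constructor
      · by_contra! hc
        nlinarith [h.1]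
      · by_contra! hc
        nlinarith [h.2]
    refine ⟨h1, ?_⟩
    rw [coord_eq_iff_rel, Int.fract, h1]
    have : relPos k j x = 2 ^ (k : ℕ) * (3 * x - ((j : ℤ) : ℝ) - 1) + 2 := by
      unfold relPos; push_cast; ring
    rwa [← this]

theorem floor_eq_zero_iff {x : ℝ} (hx : 0 ≤ x) : ⌊3 * x⌋ = 0 ↔ x < 1 / 3 := by
  rw [Int.floor_eq_iff]
  push_cast
  constructor
  · intro h; linarith [h.2]
  · intro h; constructor <;> linarith

theorem floor_eq_one_iff {x : ℝ} : ⌊3 * x⌋ = 1 ↔ x ∈ Ico (1 / 3 : ℝ) (2 / 3) := by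
  rw [Int.floor_eq_iff, mem_Ico]
  push_cast
  constructor <;> rintro ⟨h1, h2⟩ <;> constructor <;> linarith

theorem floor_cases {x : ℝ} (hx : x ∈ Ico (0 : ℝ) 1) : ∃ j : Fin 3, ⌊3 * x⌋ = ((j : ℕ) : ℤ) := by
  have h0 : 0 ≤ ⌊3 * x⌋ := Int.floor_nonneg.mpr (by linarith [hx.1])
  have h3 : ⌊3 * x⌋ < 3 := Int.floor_lt.mpr (by push_cast; linarith [hx.2])
  refine ⟨⟨⌊3 * x⌋.toNat, by omega⟩, ?_⟩
  simp [h0]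

/-- The value `t = 1` is allowed: each block ends strictly before the end of its third. -/
theorem blockStart_mem (k : ℕ+) (j : Fin 3) {t : ℝ} (ht : t ∈ Icc (0 : ℝ) 1) :
    blockStart k j + (1 / 2) ^ (k : ℕ) / 3 * t ∈ Ico (0 : ℝ) 1 := by
  have h1 : (1 / 2 : ℝ) ^ (k : ℕ) ≤ 1 / 2 := by
    simpa using pow_le_pow_of_le_one (show (0 : ℝ) ≤ 1 / 2 by norm_num) (by norm_num) k.pos
  have h2 : 0 < (1 / 2 : ℝ) ^ (k : ℕ) := by positivity
  have hj : ((j : ℕ) : ℝ) ≤ 2 := by exact_mod_cast Nat.lt_succ_iff.mp j.2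
  have hj0 : (0 : ℝ) ≤ ((j : ℕ) : ℝ) := Nat.cast_nonneg _
  unfold blockStart
  constructor <;> nlinarith [ht.1, ht.2]

/-- Blocks are half-open intervals. -/
theorem setOf_block (k : ℕ+) (j : ℕ) : {x : ℝ | ⌊3 * x⌋ = j ∧ coord (3 * x) = k} =
    Ico (blockStart k j) (blockStart k j + (1 / 2) ^ (k : ℕ) / 3) := by
  ext x
  have hp : (0 : ℝ) < (1 / 2) ^ (k : ℕ) / 3 := by positivity
  rw [mem_ofPred_eq, block_iff, mem_Ico]
  have h := blockStart_relPos k j x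
  constructor
  · rintro ⟨h1, h2⟩
    constructor <;> nlinarith
  · rintro ⟨h1, h2⟩
    constructor
    · by_contra! hc
      nlinarith
    · by_contra! hc
      nlinarith

theorem integral_indicator_Ico {a b : ℝ} (hab : a ≤ b) (h0 : 0 ≤ a) (h1 : b ≤ 1) :
    ∫ s in Ico (0 : ℝ) 1, (Ico a b).indicator (fun _ => (1 : ℝ)) s = b - a := by
  rw [setIntegral_indicator measurableSet_Ico, inter_eq_right.mpr (Ico_subset_Ico h0 h1)]
  simp [measureReal_def, Real.volume_Ico, hab]

theorem integral_indicator_Icc {a b : ℝ} (hab : a ≤ b) (h0 : 0 ≤ a) (h1 : b < 1) :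
    ∫ s in Ico (0 : ℝ) 1, (Icc a b).indicator (fun _ => (1 : ℝ)) s = b - a := by
  have hsub : Icc a b ⊆ Ico 0 1 := fun x hx => ⟨h0.trans hx.1, hx.2.trans_lt h1⟩
  rw [setIntegral_indicator measurableSet_Icc, inter_eq_right.mpr hsub]
  simp [measureReal_def, Real.volume_Icc, hab]

theorem ite_block_eq_indicator (k : ℕ+) (j : ℕ) (s : ℝ) :
    (if ⌊3 * s⌋ = j ∧ coord (3 * s) = k then (1 : ℝ) else 0) =
      (Ico (blockStart k j) (blockStart k j + (1 / 2) ^ (k : ℕ) / 3)).indicator (fun _ => 1) s := by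
  rw [← setOf_block, indicator_apply]
  simp only [mem_ofPred_eq]

theorem integral_block (k : ℕ+) (j : Fin 3) :
    ∫ s in Ico (0 : ℝ) 1,
      (if ⌊3 * s⌋ = (j : ℕ) ∧ coord (3 * s) = k then (1 : ℝ) else 0) = (1 / 2) ^ (k : ℕ) / 3 := by
  have h0 := blockStart_mem k j (t := 0) ⟨le_rfl, zero_le_one⟩
  have h1 := blockStart_mem k j (t := 1) ⟨zero_le_one, le_rfl⟩
  rw [mul_zero, add_zero] at h0
  rw [mul_one] at h1
  have hp : (0 : ℝ) < (1 / 2) ^ (k : ℕ) / 3 := by positivity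
  simp only [ite_block_eq_indicator]
  rw [integral_indicator_Ico (by linarith) h0.1 h1.2.le, add_sub_cancel_left]

theorem integrable_block (k : ℕ+) (j : ℕ) :
    IntegrableOn (fun s : ℝ => if ⌊3 * s⌋ = j ∧ coord (3 * s) = k then (1 : ℝ) else 0)
      (Ico 0 1) := by
  simp only [ite_block_eq_indicator]
  exact (integrableOn_const (by simp)).indicator measurableSet_Ico

theorem ite_relPos_eq_indicator (k : ℕ+) (j : ℕ) (a b y : ℝ) :
    (if a ≤ relPos k j y ∧ relPos k j y ≤ b then (1 : ℝ) else 0) =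
      (Icc (blockStart k j + (1 / 2) ^ (k : ℕ) / 3 * a)
        (blockStart k j + (1 / 2) ^ (k : ℕ) / 3 * b)).indicator (fun _ => 1) y := by
  have hp : (0 : ℝ) < (1 / 2) ^ (k : ℕ) / 3 := by positivity
  have h : ∀ c, blockStart k j + (1 / 2) ^ (k : ℕ) / 3 * c ≤ y ↔ c ≤ relPos k j y := by
    intro c
    conv_lhs => rw [← blockStart_relPos k j y]
    rw [add_le_add_iff_left, mul_le_mul_iff_right₀ hp]
  have h' : ∀ c, y ≤ blockStart k j + (1 / 2) ^ (k : ℕ) / 3 * c ↔ relPos k j y ≤ c := by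
    intro c
    conv_lhs => rw [← blockStart_relPos k j y]
    rw [add_le_add_iff_left, mul_le_mul_iff_right₀ hp]
  rw [indicator_apply]
  simp only [mem_Icc, h, h']

theorem integral_relPos (k : ℕ+) (j : Fin 3) {a b : ℝ} (h0 : 0 ≤ a) (hab : a ≤ b) (h1 : b ≤ 1) :
    ∫ y in Ico (0 : ℝ) 1, (if a ≤ relPos k j y ∧ relPos k j y ≤ b then (1 : ℝ) else 0) =
      (1 / 2) ^ (k : ℕ) / 3 * (b - a) := by
  simp only [ite_relPos_eq_indicator]
  rw [integral_indicator_Icc (by gcongr) (blockStart_mem k j ⟨h0, hab.trans h1⟩).1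
    (blockStart_mem k j ⟨h0.trans hab, h1⟩).2]
  ring

theorem integrable_relPos (k : ℕ+) (j : ℕ) (a b : ℝ) :
    IntegrableOn (fun y : ℝ => if a ≤ relPos k j y ∧ relPos k j y ≤ b then (1 : ℝ) else 0)
      (Ico 0 1) := by
  simp only [ite_relPos_eq_indicator]
  exact (integrableOn_const (by simp)).indicator measurableSet_Icc

theorem lt_of_relPos_le_one {k : ℕ+} {j : ℕ} {y : ℝ} (h : relPos k j y ≤ 1) :
    y < (j + 1) / 3 := by
  have h2 : (0 : ℝ) < 2 ^ (k : ℕ) := by positivity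
  unfold relPos at h
  by_contra! hc
  nlinarith

theorem le_of_relPos_nonneg {k : ℕ+} {j : ℕ} {y : ℝ} (h : 0 ≤ relPos k j y) :
    (j : ℝ) / 3 ≤ y := by
  have h2 : (2 : ℝ) ≤ 2 ^ (k : ℕ) := by
    simpa using pow_le_pow_right₀ (one_le_two (α := ℝ)) k.pos
  unfold relPos at h
  by_contra! hc
  nlinarith

/-! ### The tiles meeting `C` and `E` -/

section Tiles

variable (P : BoundingSequence) (W₀ : ℝ → ℝ → ℝ) (z : Cube)

/-- The points of the part `E` where some tile jumps. -/
def jumpSet : Set ℝ :=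
  ⋃ k : ℕ+, ((fun t => blockStart k 0 + (1 / 2) ^ (k : ℕ) / 3 * t) ''
      {0, 1, P.pval k z, P.l k, P.u k}) ∪
    ((fun t => blockStart k 1 + (1 / 2) ^ (k : ℕ) / 3 * t) '' {0, 1, 1 - P.pval k z})

theorem countable_jumpSet : (jumpSet P z).Countable :=
  countable_iUnion fun _ => (((Set.toFinite _).image _).union ((Set.toFinite _).image _)).countable

variable {P z} in
theorem relPos_zero_ne {y : ℝ} (hy : y ∉ jumpSet P z) (k : ℕ+) :
    relPos k 0 y ≠ 0 ∧ relPos k 0 y ≠ 1 ∧ relPos k 0 y ≠ P.pval k z ∧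
      relPos k 0 y ≠ P.l k ∧ relPos k 0 y ≠ P.u k := by
  refine ⟨?_, ?_, ?_, ?_, ?_⟩ <;>
    exact fun h => hy (mem_iUnion.mpr ⟨k, Or.inl ⟨relPos k 0 y, by simp [h],
      blockStart_relPos k 0 y⟩⟩)

variable {P z} in
theorem relPos_one_ne {y : ℝ} (hy : y ∉ jumpSet P z) (k : ℕ+) :
    relPos k 1 y ≠ 0 ∧ relPos k 1 y ≠ 1 ∧ relPos k 1 y ≠ 1 - P.pval k z := by
  refine ⟨?_, ?_, ?_⟩ <;>
    exact fun h => hy (mem_iUnion.mpr ⟨k, Or.inr ⟨relPos k 1 y, by simp [h],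
      blockStart_relPos k 1 y⟩⟩)

/-- The point `y` of the part `E` is joined to the first third of the part `C`. -/
def OnFirstSide (y : ℝ) : Prop :=
  (⌊3 * y⌋ = 0 ∧ relPos (coord (3 * y)) 0 y < P.pval (coord (3 * y)) z) ∨
    (⌊3 * y⌋ = 1 ∧ relPos (coord (3 * y)) 1 y < 1 - P.pval (coord (3 * y)) z)

variable {P z} in
-- In `tileCE` the position of `y` is measured with the block index of `x`. Its being between `0`
-- and `1` forces `y` into the block with the same index, and away from the jumps weak and strict
-- inequalities agree.
theorem tileCE_eq {x y : ℝ} (hx : x ∈ Ico (0 : ℝ) 1) (hy : y ∈ Ico (0 : ℝ) 1)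
    (hyz : y ∉ jumpSet P z) :
    tileCE P z x y = if coord (3 * x) = coord (3 * y) ∧ (⌊3 * y⌋ = 0 ∨ ⌊3 * y⌋ = 1) ∧
      ((⌊3 * x⌋ = 0 ∧ OnFirstSide P z y) ∨ (⌊3 * x⌋ = 1 ∧ ¬ OnFirstSide P z y)) then 1 else 0 := by
  have hp := P.p_mem (coord (3 * x)) z
  change P.pval _ _ ∈ _ at hp
  have hx0 := floor_eq_zero_iff hx.1
  have hy0 := floor_eq_zero_iff hy.1
  have hx1 := floor_eq_one_iff (x := x)
  have hy1 := floor_eq_one_iff (x := y)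
  have hb0 := block_iff (coord (3 * x)) 0 y
  have hb1 := block_iff (coord (3 * x)) 1 y
  have hn0 := relPos_zero_ne hyz (coord (3 * x))
  have hn1 := relPos_one_ne hyz (coord (3 * x))
  have ha : 2 ^ (coord (3 * x) : ℕ) * (3 * y - 1) + 2 = relPos (coord (3 * x)) 0 y := by
    simp [relPos]
  have hb : 2 ^ (coord (3 * x) : ℕ) * (3 * y - 2) + 2 = relPos (coord (3 * x)) 1 y := by
    norm_num [relPos]
  unfold tileCE
  simp only [ha, hb, ← hx0, ← hy0, ← hx1, ← hy1]
  refine if_congr ?_ rfl rfl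
  push_cast at hb0 hb1
  set k := coord (3 * x)
  set p := P.pval k z
  set a := relPos k 0 y
  set b := relPos k 1 y
  by_cases hk : k = coord (3 * y)
  · have hs : OnFirstSide P z y ↔ (⌊3 * y⌋ = 0 ∧ a < p) ∨ (⌊3 * y⌋ = 1 ∧ b < 1 - p) := by
      unfold OnFirstSide
      rw [← hk]
    rw [hs]
    simp only [← hk, and_true, true_and] at hb0 hb1 ⊢
    obtain ⟨-, -, ha1, -, -⟩ := hn0
    obtain ⟨-, -, hb2⟩ := hn1
    have h1 : a ≤ p ↔ a < p := ⟨fun h => lt_of_le_of_ne h ha1, le_of_lt⟩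
    have h2 : p ≤ a ↔ ¬ a < p := not_lt.symm
    have h3 : b ≤ 1 - p ↔ b < 1 - p := ⟨fun h => lt_of_le_of_ne h hb2, le_of_lt⟩
    have h4 : 1 - p ≤ b ↔ ¬ b < 1 - p := not_lt.symm
    rw [h1, h2, h3, h4]
    by_cases hf0 : ⌊3 * y⌋ = 0
    · have := hb0.mp hf0
      simp only [hf0, this.1, this.2.le, true_and, and_true]
      norm_num
    · by_cases hf1 : ⌊3 * y⌋ = 1
      · have := hb1.mp hf1
        simp only [hf1, this.1, this.2.le, true_and, and_true]
        norm_num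
      · simp [hf0, hf1]
  -- With different block indices no alternative of the tile can hold; position exactly `1` is
  -- excluded as a jump.
  · have h0 : ¬ (⌊3 * y⌋ = 0 ∧ 0 ≤ a ∧ a ≤ 1) := fun ⟨_, h1, h2⟩ =>
      hk (hb0.mpr ⟨h1, lt_of_le_of_ne h2 hn0.2.1⟩).2.symm
    have h1 : ¬ (⌊3 * y⌋ = 1 ∧ 0 ≤ b ∧ b ≤ 1) := fun ⟨_, h1, h2⟩ =>
      hk (hb1.mpr ⟨h1, lt_of_le_of_ne h2 hn1.2.1⟩).2.symm
    simp only [hk, false_and, iff_false]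
    rintro (⟨-, h2, h3, h4⟩ | ⟨-, h2, h3, h4⟩ | ⟨-, h2, h3, h4⟩ | ⟨-, h2, h3, h4⟩)
    · exact h0 ⟨h2, h3, h4.trans hp.2⟩
    · exact h1 ⟨h2, h3, by linarith [hp.1]⟩
    · exact h0 ⟨h2, hp.1.trans h3, h4⟩
    · exact h1 ⟨h2, by linarith [hp.2], h4⟩

variable {P z} in
-- On either side of `p`, the point `y` is joined to exactly one of two blocks of equal length, so
-- its degree into `C` does not reveal the side.
theorem integral_tileCE_left {y : ℝ} (hy : y ∈ Ico (0 : ℝ) 1) (hyz : y ∉ jumpSet P z) :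
    ∫ x in Ico (0 : ℝ) 1, tileCE P z x y =
      if ⌊3 * y⌋ = 0 ∨ ⌊3 * y⌋ = 1 then (1 / 2) ^ (coord (3 * y) : ℕ) / 3 else 0 := by
  rw [setIntegral_congr_fun measurableSet_Ico fun x hx => tileCE_eq hx hy hyz]
  by_cases h : ⌊3 * y⌋ = 0 ∨ ⌊3 * y⌋ = 1
  · by_cases hs : OnFirstSide P z y
    · rw [if_pos h, ← integral_block (coord (3 * y)) 0]
      simp only [h, hs, true_and, not_true, false_and, or_false, Fin.val_zero,
        Nat.cast_zero, and_comm]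
    · rw [if_pos h, ← integral_block (coord (3 * y)) 1]
      simp only [h, hs, true_and, not_false_eq_true, false_and, false_or, Fin.val_one,
        Nat.cast_one, and_comm]
  · simp only [h, false_and, and_false, if_false, integral_zero]

variable {P z} in
-- A point of `C` sees relative length `p` in one block of `E` and `1 - p` in another, or vice
-- versa; the total does not depend on `z`.
theorem integral_tileCE_right (x : ℝ) :
    ∫ y in Ico (0 : ℝ) 1, tileCE P z x y =
      if x < 2 / 3 then (1 / 2) ^ (coord (3 * x) : ℕ) / 3 else 0 := by
  have hp := P.p_mem (coord (3 * x)) z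
  change P.pval _ _ ∈ _ at hp
  set k := coord (3 * x) with hk
  set p := P.pval k z
  have ha : ∀ y, 2 ^ (k : ℕ) * (3 * y - 1) + 2 = relPos k (0 : Fin 3) y := by
    simp [relPos]
  have hb : ∀ y, 2 ^ (k : ℕ) * (3 * y - 2) + 2 = relPos k (1 : Fin 3) y := by
    norm_num [relPos]
  have h0 : ∀ y, 0 ≤ relPos k (0 : Fin 3) y → relPos k (0 : Fin 3) y ≤ 1 → y < 1 / 3 := by
    intro y _ h2
    simpa using lt_of_relPos_le_one h2
  have h1 : ∀ y, 0 ≤ relPos k (1 : Fin 3) y → relPos k (1 : Fin 3) y ≤ 1 →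
      y ∈ Ico (1 / 3 : ℝ) (2 / 3) := by
    intro y h1 h2
    have h3 := lt_of_relPos_le_one h2
    have h4 := le_of_relPos_nonneg h1
    norm_num at h3 h4
    exact ⟨by linarith, by linarith⟩
  have key : ∀ a b a' b' : ℝ, 0 ≤ a → a ≤ b → b ≤ 1 → 0 ≤ a' → a' ≤ b' → b' ≤ 1 →
      b - a + (b' - a') = 1 →
      (∀ y, tileCE P z x y =
        if (y < 1 / 3 ∧ a ≤ relPos k (0 : Fin 3) y ∧ relPos k (0 : Fin 3) y ≤ b) ∨
          (y ∈ Ico (1 / 3 : ℝ) (2 / 3) ∧ a' ≤ relPos k (1 : Fin 3) y ∧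
            relPos k (1 : Fin 3) y ≤ b') then 1 else 0) →
      ∫ y in Ico (0 : ℝ) 1, tileCE P z x y = (1 / 2) ^ (k : ℕ) / 3 := by
    intro a b a' b' ha0 hab hb1 ha0' hab' hb1' hsum htile
    have heq : ∀ y, tileCE P z x y =
        (if a ≤ relPos k (0 : Fin 3) y ∧ relPos k (0 : Fin 3) y ≤ b then (1 : ℝ) else 0) +
        (if a' ≤ relPos k (1 : Fin 3) y ∧ relPos k (1 : Fin 3) y ≤ b' then (1 : ℝ) else 0) := by
      intro y
      rw [htile]
      by_cases h2 : a ≤ relPos k (0 : Fin 3) y ∧ relPos k (0 : Fin 3) y ≤ b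
      · have h3 := h0 y (ha0.trans h2.1) (h2.2.trans hb1)
        have h4 : ¬ (a' ≤ relPos k (1 : Fin 3) y ∧ relPos k (1 : Fin 3) y ≤ b') := fun h =>
          (h1 y (ha0'.trans h.1) (h.2.trans hb1')).1.not_gt h3
        rw [if_pos (Or.inl ⟨h3, h2⟩), if_pos h2, if_neg h4, add_zero]
      · by_cases h4 : a' ≤ relPos k (1 : Fin 3) y ∧ relPos k (1 : Fin 3) y ≤ b'
        · rw [if_pos (Or.inr ⟨h1 y (ha0'.trans h4.1) (h4.2.trans hb1'), h4⟩), if_neg h2, if_pos h4,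
            zero_add]
        · rw [if_neg (by rintro (⟨-, h⟩ | ⟨-, h⟩) <;> contradiction), if_neg h2, if_neg h4,
            add_zero]
    simp only [heq]
    rw [integral_add (integrable_relPos _ _ _ _) (integrable_relPos _ _ _ _),
      integral_relPos k 0 ha0 hab hb1, integral_relPos k 1 ha0' hab' hb1', ← mul_add, hsum, mul_one]
  by_cases h3 : x < 1 / 3
  · rw [if_pos (by linarith)]
    refine key 0 p 0 (1 - p) le_rfl hp.1 hp.2 le_rfl (by linarith [hp.2]) (by linarith [hp.1])
      (by ring) fun y => ?_
    have h4 : ¬ x ∈ Ico (1 / 3 : ℝ) (2 / 3) := fun h => h.1.not_gt h3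
    simp only [tileCE, ← hk, ha, hb, h3, h4, true_and, false_and, or_false]
    rfl
  · by_cases h4 : x < 2 / 3
    · rw [if_pos h4]
      refine key p 1 (1 - p) 1 hp.1 hp.2 le_rfl (by linarith [hp.2]) (by linarith [hp.1]) le_rfl
        (by ring) fun y => ?_
      have h5 : x ∈ Ico (1 / 3 : ℝ) (2 / 3) := ⟨not_lt.mp h3, h4⟩
      simp only [tileCE, ← hk, ha, hb, h3, h5, true_and, false_and, false_or]
      rfl
    · rw [if_neg h4]
      have h5 : ¬ x ∈ Ico (1 / 3 : ℝ) (2 / 3) := fun h => h4 h.2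
      simp only [tileCE, h3, h5, false_and, or_false, if_false, integral_zero]

/-- The values `m` and `1 - m` are taken on two blocks of equal length, so `m` cancels. -/
theorem integral_tileCC (x : ℝ) (hx : x ∈ Ico (0 : ℝ) 1) :
    ∫ s in Ico (0 : ℝ) 1, tileCC z x s =
      if x < 2 / 3 then (1 / 2) ^ (coord (3 * x) : ℕ) / 3 else 0 := by
  by_cases h : x < 2 / 3
  · set k := coord (3 * x) with hk
    set m := monomialValue (multiset k) z
    -- Here `j` is the third containing `x` and `j'` is the other one of the first two thirds.
    obtain ⟨j, j', hj, hjj⟩ : ∃ j j' : Fin 3, ⌊3 * x⌋ = ((j : ℕ) : ℤ) ∧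
        ∀ s : ℝ, s ∈ Ico (0 : ℝ) 1 → (⌊3 * s⌋ ≠ ((j : ℕ) : ℤ) ∧ s < 2 / 3 ↔
          ⌊3 * s⌋ = ((j' : ℕ) : ℤ)) ∧ (⌊3 * s⌋ = ((j : ℕ) : ℤ) → s < 2 / 3) := by
      by_cases h3 : x < 1 / 3
      · refine ⟨0, 1, by simpa using (floor_eq_zero_iff hx.1).mpr h3, fun s hs => ?_⟩
        have h4 := floor_eq_zero_iff hs.1
        have h5 := floor_eq_one_iff (x := s)
        simp only [Fin.val_zero, Fin.val_one, Nat.cast_zero, Nat.cast_one, ne_eq, h4, h5, mem_Ico,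
          not_lt]
        exact ⟨trivial, fun h => by linarith⟩
      · refine ⟨1, 0, by simpa using floor_eq_one_iff.mpr ⟨not_lt.mp h3, h⟩, fun s hs => ?_⟩
        have h4 := floor_eq_zero_iff hs.1
        have h5 := floor_eq_one_iff (x := s)
        simp only [Fin.val_zero, Fin.val_one, Nat.cast_zero, Nat.cast_one, ne_eq, h4, h5, mem_Ico,
          not_and, not_lt]
        refine ⟨⟨fun h => ?_, fun h => ⟨fun h' => by linarith, by linarith⟩⟩, fun h => h.2⟩
        by_contra! hc
        linarith [h.1 hc, h.2]
    have heq : ∀ s ∈ Ico (0 : ℝ) 1, tileCC z x s =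
        m * (if ⌊3 * s⌋ = (j : ℕ) ∧ coord (3 * s) = k then (1 : ℝ) else 0) +
          (1 - m) * (if ⌊3 * s⌋ = (j' : ℕ) ∧ coord (3 * s) = k then (1 : ℝ) else 0) := by
      intro s hs
      obtain ⟨h1, h2⟩ := hjj s hs
      unfold tileCC
      rw [← hk, hj]
      by_cases hc : coord (3 * s) = k
      · by_cases hf : ⌊3 * s⌋ = ((j : ℕ) : ℤ)
        · have h3 : ¬ ⌊3 * s⌋ = ((j' : ℕ) : ℤ) := fun h' => (h1.mpr h').1 hf
          rw [if_pos ⟨h, h2 hf, hc.symm⟩, if_pos hf.symm, if_pos ⟨hf, hc⟩, if_neg fun h' => h3 h'.1]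
          ring
        · by_cases hf' : ⌊3 * s⌋ = ((j' : ℕ) : ℤ)
          · rw [if_pos ⟨h, (h1.mpr hf').2, hc.symm⟩, if_neg (Ne.symm hf), if_neg fun h' => hf h'.1,
              if_pos ⟨hf', hc⟩]
            ring
          · rw [if_neg fun h' => hf' (h1.mp ⟨hf, h'.2.1⟩), if_neg fun h' => hf h'.1,
              if_neg fun h' => hf' h'.1]
            ring
      · rw [if_neg fun h' => hc h'.2.2.symm, if_neg fun h' => hc h'.2, if_neg fun h' => hc h'.2]
        ring
    rw [setIntegral_congr_fun measurableSet_Ico heq, integral_add, integral_const_mul,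
      integral_const_mul, integral_block, integral_block, if_pos h]
    · ring
    · exact (integrable_block k j).const_mul m
    · exact (integrable_block k j').const_mul (1 - m)
  · simp [tileCC, h]

end Tiles

/-! ### Independence of `z` outside the tiles of `C ∪ E` -/

/-- The parts other than `C` and `E`. -/
def Core.Outer (X : Core) : Prop := X ≠ .C ∧ X ≠ .E

/-- The parts other than `C` and `E`. -/
def Part.Outer (X : Part) : Prop := X ≠ .core .C ∧ X ≠ .core .E

section Independence

variable {P : BoundingSequence} {W₀ : ℝ → ℝ → ℝ} {z z' : Cube}

theorem coreTile_indep {X : Core} (hX : X.Outer) (Y : Core) (x y : ℝ) :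
    coreTile P W₀ z X Y x y = coreTile P W₀ z' X Y x y := by
  obtain ⟨h1, h2⟩ := hX
  unfold coreTile
  cases X <;> cases Y <;> first | contradiction | rfl

theorem coreDegree_indep {X : Core} (hX : X.Outer) (x : ℝ) :
    coreDegree P W₀ z X x = coreDegree P W₀ z' X x := by
  simp only [coreDegree, fun Y s => coreTile_indep (P := P) (W₀ := W₀) (z := z) (z' := z') hX Y x s]

theorem tile_indep {X Y : Part} (hX : X.Outer) (hY : Y.Outer) (x y : ℝ) :
    tile P W₀ z X Y x y = tile P W₀ z' X Y x y := by
  have h : ∀ X : Core, (Part.core X).Outer → X.Outer := fun X h =>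
    ⟨fun h' => h.1 (h' ▸ rfl), fun h' => h.2 (h' ▸ rfl)⟩
  cases X <;> cases Y <;> simp only [tile]
  · exact coreTile_indep (h _ hX) _ _ _
  · rw [coreDegree_indep (h _ hX)]
  · rw [coreDegree_indep (h _ hY)]

theorem coreDegree_C_indep {x : ℝ} (hx : x ∈ Ico (0 : ℝ) 1) :
    coreDegree P W₀ z .C x = coreDegree P W₀ z' .C x := by
  have hC : ∀ z, ∫ s in Ico (0 : ℝ) 1, coreTile P W₀ z .C .C x s = _ := fun z =>
    integral_tileCC z x hx
  have hE : ∀ z, ∫ s in Ico (0 : ℝ) 1, coreTile P W₀ z .C .E x s = _ := fun z =>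
    integral_tileCE_right (P := P) (z := z) x
  simp only [coreDegree, hC, hE]
  rfl

theorem tile_C_indep {Y : Part} (hY : Y.Outer) {x : ℝ} (hx : x ∈ Ico (0 : ℝ) 1) (y : ℝ) :
    tile P W₀ z (.core .C) Y x y = tile P W₀ z' (.core .C) Y x y := by
  obtain ⟨h1, h2⟩ := hY
  rcases Y with (_ | _ | _ | k | _ | _) | _ | _
  case Q => simp only [tile, coreDegree_C_indep (z := z) (z' := z') hx]
  all_goals first | contradiction | rfl

/-- Two points of the part `E` that lie in the same block and on the same side of `l` and `u`. -/
structure SameZone (P : BoundingSequence) (y y' : ℝ) : Prop where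
  floor : ⌊3 * y⌋ = ⌊3 * y'⌋
  coord : coord (3 * y) = GraphonFamily.coord (3 * y')
  lower : ⌊3 * y⌋ = 0 → ∀ k, GraphonFamily.coord (3 * y) = k →
    (relPos k 0 y < P.l k ↔ relPos k 0 y' < P.l k)
  upper : ⌊3 * y⌋ = 0 → ∀ k, GraphonFamily.coord (3 * y) = k →
    (relPos k 0 y < P.u k ↔ relPos k 0 y' < P.u k)

/-- This tile compares the position of `y` only with `l` and `u`, which is exactly what a zone
records. -/
theorem SameZone.tileGE_eq {y y' : ℝ} (h : SameZone P y y') (hy : y ∈ Ico (0 : ℝ) 1)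
    (hy' : y' ∈ Ico (0 : ℝ) 1) (hyz : y ∉ jumpSet P z) (hyz' : y' ∉ jumpSet P z') (x : ℝ) :
    tileGE P x y = tileGE P x y' := by
  have ha : ∀ (k : ℕ+) (y : ℝ), 2 ^ (k : ℕ) * (3 * y - 1) + 2 = relPos k 0 y := by
    simp [relPos]
  unfold tileGE
  simp only [← floor_eq_zero_iff hy.1, ← floor_eq_zero_iff hy'.1, ← h.floor, ← h.coord, ha]
  refine if_congr (and_congr_right fun h0 => and_congr_right fun _ => ?_) rfl rfl
  obtain ⟨-, -, -, hl, hu⟩ := relPos_zero_ne hyz (GraphonFamily.coord (3 * y))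
  obtain ⟨-, -, -, hl', hu'⟩ := relPos_zero_ne hyz' (GraphonFamily.coord (3 * y))
  rw [hl.le_iff_lt, hu.le_iff_lt, hl'.le_iff_lt, hu'.le_iff_lt, h.lower h0 _ rfl, h.upper h0 _ rfl]

theorem SameZone.coreTile_eq {y y' : ℝ} (h : SameZone P y y') (hy : y ∈ Ico (0 : ℝ) 1)
    (hy' : y' ∈ Ico (0 : ℝ) 1) (hyz : y ∉ jumpSet P z) (hyz' : y' ∉ jumpSet P z')
    {Y : Core} (hY : Y ≠ .C) (s : ℝ) :
    coreTile P W₀ z .E Y y s = coreTile P W₀ z' .E Y y' s := by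
  have hE : Core.E.idx = 10 := rfl
  cases Y
  case C => contradiction
  case A =>
    change (if _ then _ else _) = (if _ then _ else _)
    simp only [upperTile, h.floor]
  case B =>
    change (if _ then _ else _) = (if _ then _ else _)
    simp only [upperTile, h.floor, h.coord]
  case D k =>
    have h1 : ¬ Core.E.idx ≤ (Core.D k).idx := by simp only [Core.idx]; omega
    rw [coreTile, coreTile, if_neg h1, if_neg h1]
    simp only [upperTile]
    split_ifs
    · exact h.tileGE_eq hy hy' hyz hyz' s
    · rfl
  all_goals rfl

/-- All summands but the one for `C` agree pointwise. For `C` the tiles may differ, but by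
`integral_tileCE_left` the integrals depend on the block alone. -/
theorem SameZone.coreDegree_eq {y y' : ℝ} (h : SameZone P y y') (hy : y ∈ Ico (0 : ℝ) 1)
    (hy' : y' ∈ Ico (0 : ℝ) 1) (hyz : y ∉ jumpSet P z) (hyz' : y' ∉ jumpSet P z') :
    coreDegree P W₀ z .E y = coreDegree P W₀ z' .E y' := by
  have h1 := fun (Y : Core) (hY : Y ≠ .C) (s : ℝ) =>
    h.coreTile_eq (W₀ := W₀) hy hy' hyz hyz' hY s
  have hC : ∫ s in Ico (0 : ℝ) 1, coreTile P W₀ z .E .C y s =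
      ∫ s in Ico (0 : ℝ) 1, coreTile P W₀ z' .E .C y' s := by
    have h2 := integral_tileCE_left hy hyz
    have h3 := integral_tileCE_left hy' hyz'
    rw [← h.floor, ← h.coord, ← h2] at h3
    exact h3.symm
  simp only [coreDegree, hC, h1 .A (by simp), h1 .B (by simp), h1 (.D _) (by simp), h1 .E (by simp),
    h1 .F (by simp)]

theorem SameZone.tile_eq {y y' : ℝ} (h : SameZone P y y') (hy : y ∈ Ico (0 : ℝ) 1)
    (hy' : y' ∈ Ico (0 : ℝ) 1) (hyz : y ∉ jumpSet P z) (hyz' : y' ∉ jumpSet P z')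
    {Y : Part} (hY : Y.Outer) (s : ℝ) :
    tile P W₀ z (.core .E) Y y s = tile P W₀ z' (.core .E) Y y' s := by
  cases Y with
  | core Y => exact h.coreTile_eq hy hy' hyz hyz' (fun h' => hY.1 (h' ▸ rfl)) s
  | Q => simp only [tile, h.coreDegree_eq (W₀ := W₀) hy hy' hyz hyz']
  | R => rfl

end Independence

/-! ### The intervals of the pieces -/

namespace Cell

variable (P : BoundingSequence) (z : Cube)

/-- The left endpoint of the piece itself, in the coordinate of its part. -/
def left : Cell → ℝ
  | .E₁ k i => blockStart k 0 + (1 / 2) ^ (k : ℕ) / 3 * ![0, P.l k, P.pval k z, P.u k] i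
  | .E₂ k i => blockStart k 1 + (1 / 2) ^ (k : ℕ) / 3 * ![0, 1 - P.pval k z] i
  | c => c.lo P

/-- The right endpoint of the piece itself, in the coordinate of its part. -/
def right : Cell → ℝ
  | .E₁ k i => blockStart k 0 + (1 / 2) ^ (k : ℕ) / 3 * ![P.l k, P.pval k z, P.u k, 1] i
  | .E₂ k i => blockStart k 1 + (1 / 2) ^ (k : ℕ) / 3 * ![1 - P.pval k z, 1] i
  | c => c.hi P

variable {P z}

theorem size_mul_right_sub_left (c : Cell) :
    c.part.size * (c.right P z - c.left P z) = MvPolynomial.eval z.val (c.measurePoly P) := by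
  have hmul : ∀ (a e b b' v : ℝ), v = b' - b →
      1 / 25 * (a + e / 3 * b' - (a + e / 3 * b)) = e / 75 * v := by
    intro a e b b' v hv
    rw [hv]; ring
  cases c with
  | E₁ k i =>
    rw [measurePoly, map_mul, MvPolynomial.eval_C]
    refine hmul _ _ _ _ _ ?_
    fin_cases i <;> simp [BoundingSequence.pval]
  | E₂ k i =>
    rw [measurePoly, map_mul, MvPolynomial.eval_C]
    refine hmul _ _ _ _ _ ?_
    fin_cases i <;> simp [BoundingSequence.pval]
  | E₃ k => simp [part, Part.size, left, right, lo, hi, measurePoly]; ring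
  | C k j => simp [part, Part.size, left, right, lo, hi, measurePoly]; ring
  | _ => simp [part, left, right, lo, hi, measurePoly]

/-- Feasibility enters through `l ≤ p(z) ≤ u`; otherwise a piece could have negative measure
polynomial. -/
theorem left_le_right (hz : P.Feasible z) (c : Cell) : c.left P z ≤ c.right P z := by
  cases c with
  | E₁ k i =>
    simp only [left, right]
    have h1 := hz k
    have h2 := P.l_mem k
    have h3 := P.u_mem k
    gcongr
    fin_cases i <;> simp [h1.1, h1.2, h2.1, h3.2]
  | E₂ k i =>
    have h2 : P.pval k z ∈ _ := P.p_mem k z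
    simp only [left, right]
    gcongr
    fin_cases i <;> simp [h2.1, h2.2]
  | E₃ k => exact le_add_of_nonneg_right (by positivity)
  | C k j => exact le_add_of_nonneg_right (by positivity)
  | _ => exact zero_le_one

/-- The points of a piece of `C ∪ E` in terms of relative positions. -/
theorem mem_Ico_iff_relPos (k : ℕ+) (j : ℕ) (a b x : ℝ) :
    x ∈ Ico (blockStart k j + (1 / 2) ^ (k : ℕ) / 3 * a)
      (blockStart k j + (1 / 2) ^ (k : ℕ) / 3 * b) ↔ relPos k j x ∈ Ico a b := by
  have hp : (0 : ℝ) < (1 / 2) ^ (k : ℕ) / 3 := by positivity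
  rw [mem_Ico, mem_Ico]
  conv_lhs => rw [← blockStart_relPos k j x]
  rw [add_le_add_iff_left, mul_le_mul_iff_right₀ hp, add_lt_add_iff_left, mul_lt_mul_iff_right₀ hp]

theorem mem_Ico_block_iff (k : ℕ+) (j : ℕ) (x : ℝ) :
    x ∈ Ico (blockStart k j) (blockStart k j + (1 / 2) ^ (k : ℕ) / 3) ↔
      ⌊3 * x⌋ = j ∧ coord (3 * x) = k := by
  rw [← setOf_block]; rfl

/-- The points of a piece, by the value of the parameters. -/
def Holds (P : BoundingSequence) (z : Cube) (x : ℝ) : Cell → Prop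
  | .C k j => ⌊3 * x⌋ = ((j : ℕ) : ℤ) ∧ coord (3 * x) = k
  | .E₁ k i => (⌊3 * x⌋ = 0 ∧ coord (3 * x) = k) ∧
      relPos k 0 x ∈ Ico (![0, P.l k, P.pval k z, P.u k] i) (![P.l k, P.pval k z, P.u k, 1] i)
  | .E₂ k i => (⌊3 * x⌋ = 1 ∧ coord (3 * x) = k) ∧
      relPos k 1 x ∈ Ico (![0, 1 - P.pval k z] i) (![1 - P.pval k z, 1] i)
  | .E₃ k => ⌊3 * x⌋ = 2 ∧ coord (3 * x) = k
  | _ => x ∈ Ico (0 : ℝ) 1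

theorem mem_Ico_iff (hz : P.Feasible z) (c : Cell) (x : ℝ) :
    x ∈ Ico (c.left P z) (c.right P z) ↔ c.Holds P z x := by
  cases c with
  | C k j => exact mem_Ico_block_iff k j x
  | E₃ k => exact mem_Ico_block_iff k 2 x
  | E₁ k i =>
    have h1 := hz k
    have h2 := P.l_mem k
    have h3 := P.u_mem k
    have h := block_iff k 0 x
    rw [Nat.cast_zero] at h
    simp only [left, right, Holds]
    rw [mem_Ico_iff_relPos, h]
    refine ⟨fun hx => ⟨⟨le_trans ?_ hx.1, hx.2.trans_le ?_⟩, hx⟩, fun hx => hx.2⟩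
    · fin_cases i <;> simp [h2.1, h2.1.trans h1.1, h3.1]
    · fin_cases i <;> simp [h2.2, h1.2.trans h3.2, h3.2]
  | E₂ k i =>
    have h2 : P.pval k z ∈ _ := P.p_mem k z
    have h := block_iff k 1 x
    rw [Nat.cast_one] at h
    simp only [left, right, Holds]
    rw [mem_Ico_iff_relPos, h]
    refine ⟨fun hx => ⟨⟨le_trans ?_ hx.1, hx.2.trans_le ?_⟩, hx⟩, fun hx => hx.2⟩
    · fin_cases i <;> simp [h2.2]
    · fin_cases i <;> simp [h2.1]
  | _ => exact Iff.rfl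

theorem left_nonneg_and_right_le (c : Cell) : 0 ≤ c.left P z ∧ c.right P z ≤ 1 := by
  have h2 : ∀ k, P.pval k z ∈ _ := fun k => P.p_mem k z
  cases c with
  | C k j =>
    have h0 := blockStart_mem k j (t := 0) ⟨le_rfl, zero_le_one⟩
    have h1 := blockStart_mem k j (t := 1) ⟨zero_le_one, le_rfl⟩
    rw [mul_zero, add_zero] at h0
    rw [mul_one] at h1
    exact ⟨h0.1, h1.2.le⟩
  | E₃ k =>
    have h0 := blockStart_mem k 2 (t := 0) ⟨le_rfl, zero_le_one⟩
    have h1 := blockStart_mem k 2 (t := 1) ⟨zero_le_one, le_rfl⟩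
    rw [mul_zero, add_zero] at h0
    rw [mul_one] at h1
    exact ⟨h0.1, h1.2.le⟩
  | E₁ k i =>
    refine ⟨(blockStart_mem k 0 (t := ![0, P.l k, P.pval k z, P.u k] i) ?_).1,
      (blockStart_mem k 0 (t := ![P.l k, P.pval k z, P.u k, 1] i) ?_).2.le⟩
    · fin_cases i
      exacts [⟨le_rfl, zero_le_one⟩, P.l_mem k, h2 k, P.u_mem k]
    · fin_cases i
      exacts [P.l_mem k, h2 k, P.u_mem k, ⟨zero_le_one, le_rfl⟩]
  | E₂ k i =>
    have h3 : 1 - P.pval k z ∈ Icc (0 : ℝ) 1 := ⟨by linarith [(h2 k).2], by linarith [(h2 k).1]⟩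
    refine ⟨(blockStart_mem k 1 (t := ![0, 1 - P.pval k z] i) ?_).1,
      (blockStart_mem k 1 (t := ![1 - P.pval k z, 1] i) ?_).2.le⟩
    · fin_cases i
      exacts [⟨le_rfl, zero_le_one⟩, h3]
    · fin_cases i
      exacts [h3, ⟨zero_le_one, le_rfl⟩]
  | _ => exact ⟨le_rfl, le_rfl⟩

/-- The piece as a subset of `[0,1)`. -/
def carrier (P : BoundingSequence) (z : Cube) (c : Cell) : Set ℝ :=
  Ico (c.part.embed (c.left P z)) (c.part.embed (c.right P z))

theorem _root_.GraphonFamily.Part.size_pos (X : Part) : 0 < X.size := by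
  rcases X with _ | _ | _ <;> norm_num [Part.size]

theorem mem_carrier_iff {c : Cell} {s : ℝ} : s ∈ c.carrier P z ↔
    ∃ x ∈ Ico (c.left P z) (c.right P z), c.part.embed x = s := by
  have hp := c.part.size_pos
  constructor
  · rintro ⟨h1, h2⟩
    have hx : c.part.embed ((s - c.part.start) / c.part.size) = s := by
      rw [Part.embed, mul_div_cancel₀ _ hp.ne']; ring
    refine ⟨_, ?_, hx⟩
    rw [← hx] at h1 h2
    simp only [Part.embed, add_le_add_iff_left, add_lt_add_iff_left, mul_le_mul_iff_right₀ hp,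
      mul_lt_mul_iff_right₀ hp] at h1 h2
    exact ⟨h1, h2⟩
  · rintro ⟨x, ⟨h1, h2⟩, rfl⟩
    simp only [carrier, mem_Ico, Part.embed, add_le_add_iff_left, add_lt_add_iff_left,
      mul_le_mul_iff_right₀ hp, mul_lt_mul_iff_right₀ hp]
    exact ⟨h1, h2⟩

theorem mem_unit {c : Cell} {x : ℝ} (hx : x ∈ Ico (c.left P z) (c.right P z)) :
    x ∈ Ico (0 : ℝ) 1 :=
  ⟨(c.left_nonneg_and_right_le).1.trans hx.1, hx.2.trans_le (c.left_nonneg_and_right_le).2⟩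

/-- Within a block of `E` the half-open intervals between consecutive terms of `0 ≤ l ≤ p ≤ u ≤ 1`
are disjoint; this uses the order, hence feasibility. -/
theorem eq_of_holds (hz : P.Feasible z) {c d : Cell} {x : ℝ} (hcd : c.part = d.part)
    (hc : c.Holds P z x) (hd : d.Holds P z x) : c = d := by
  have h4 : ∀ (k : ℕ+) (i i' : Fin 4),
      relPos k 0 x ∈ Ico (![0, P.l k, P.pval k z, P.u k] i) (![P.l k, P.pval k z, P.u k, 1] i) →
      relPos k 0 x ∈ Ico (![0, P.l k, P.pval k z, P.u k] i') (![P.l k, P.pval k z, P.u k, 1] i') →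
      i = i' := by
    intro k i i' h h'
    have h1 := hz k
    obtain ⟨h1, h2⟩ := h1
    fin_cases i <;> fin_cases i' <;> simp at h h' ⊢ <;> linarith [h.1, h.2, h'.1, h'.2]
  have h2 : ∀ (k : ℕ+) (i i' : Fin 2),
      relPos k 1 x ∈ Ico (![0, 1 - P.pval k z] i) (![1 - P.pval k z, 1] i) →
      relPos k 1 x ∈ Ico (![0, 1 - P.pval k z] i') (![1 - P.pval k z, 1] i') → i = i' := by
    intro k i i' h h'
    fin_cases i <;> fin_cases i' <;> simp at h h' ⊢ <;> linarith [h.1, h.2, h'.1, h'.2]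
  cases c <;> cases d <;> simp only [part, Part.core.injEq, reduceCtorEq, Core.D.injEq] at hcd <;>
    simp only [Holds] at hc hd
  case C.C k j k' j' =>
    obtain rfl := hc.2.symm.trans hd.2
    have := hc.1.symm.trans hd.1
    congr 1
    exact Fin.ext (by exact_mod_cast this)
  case E₁.E₁ k i k' i' =>
    obtain rfl := hc.1.2.symm.trans hd.1.2
    rw [h4 k i i' hc.2 hd.2]
  case E₂.E₂ k i k' i' =>
    obtain rfl := hc.1.2.symm.trans hd.1.2
    rw [h2 k i i' hc.2 hd.2]
  case E₃.E₃ k k' =>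
    obtain rfl := hc.2.symm.trans hd.2
    rfl
  case D.D => rw [hcd]
  all_goals first | rfl | omega

theorem disjoint_carrier (hz : P.Feasible z) {c d : Cell} (hcd : c ≠ d) :
    Disjoint (c.carrier P z) (d.carrier P z) := by
  rw [Set.disjoint_left]
  intro s hc hd
  obtain ⟨x, hx, rfl⟩ := mem_carrier_iff.mp hc
  obtain ⟨y, hy, hxy⟩ := mem_carrier_iff.mp hd
  have hpart : c.part = d.part := by
    rw [← partOf_embed c.part (mem_unit hx), ← partOf_embed d.part (mem_unit hy), hxy]
  have hyx : y = x := by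
    rw [← hpart, Part.embed, Part.embed] at hxy
    exact mul_left_cancel₀ c.part.size_pos.ne' (add_left_cancel hxy)
  subst hyx
  exact hcd (eq_of_holds hz hpart ((mem_Ico_iff hz c y).mp hx) ((mem_Ico_iff hz d y).mp hy))

/-- Comparing the position with `l`, `p` and `u` in turn finds a piece, whatever the order of these
numbers. -/
theorem exists_holds (X : Part) {x : ℝ} (hx : x ∈ Ico (0 : ℝ) 1) :
    ∃ c : Cell, c.part = X ∧ c.Holds P z x := by
  obtain ⟨j, hj⟩ := floor_cases hx
  rcases X with (_ | _ | _ | k | _ | _) | _ | _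
  · exact ⟨.A, rfl, hx⟩
  · exact ⟨.B, rfl, hx⟩
  · exact ⟨.C (coord (3 * x)) j, rfl, hj, rfl⟩
  · exact ⟨.D k, rfl, hx⟩
  · set k := coord (3 * x) with hk
    fin_cases j
    · have hj : ⌊3 * x⌋ = 0 := by exact_mod_cast hj
      obtain ⟨h0, h1⟩ := (block_iff k 0 x).mp ⟨hj, hk.symm⟩
      by_cases hl : relPos k 0 x < P.l k
      · exact ⟨.E₁ k 0, rfl, ⟨hj, hk.symm⟩, h0, hl⟩
      by_cases hp : relPos k 0 x < P.pval k z
      · exact ⟨.E₁ k 1, rfl, ⟨hj, hk.symm⟩, not_lt.mp hl, hp⟩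
      by_cases hu : relPos k 0 x < P.u k
      · exact ⟨.E₁ k 2, rfl, ⟨hj, hk.symm⟩, not_lt.mp hp, hu⟩
      · exact ⟨.E₁ k 3, rfl, ⟨hj, hk.symm⟩, not_lt.mp hu, h1⟩
    · have hj : ⌊3 * x⌋ = 1 := by exact_mod_cast hj
      obtain ⟨h0, h1⟩ := (block_iff k 1 x).mp ⟨hj, hk.symm⟩
      by_cases hp : relPos k 1 x < 1 - P.pval k z
      · exact ⟨.E₂ k 0, rfl, ⟨hj, hk.symm⟩, h0, hp⟩
      · exact ⟨.E₂ k 1, rfl, ⟨hj, hk.symm⟩, not_lt.mp hp, h1⟩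
    · exact ⟨.E₃ k, rfl, by exact_mod_cast hj, hk.symm⟩
  · exact ⟨.F, rfl, hx⟩
  · exact ⟨.Q, rfl, hx⟩
  · exact ⟨.R, rfl, hx⟩

theorem iUnion_carrier (hz : P.Feasible z) : ⋃ c : Cell, c.carrier P z = Ico (0 : ℝ) 1 := by
  ext s
  rw [mem_iUnion]
  constructor
  · rintro ⟨c, hc⟩
    obtain ⟨x, hx, rfl⟩ := mem_carrier_iff.mp hc
    exact c.part.embed_mem (mem_unit hx)
  · intro hs
    obtain ⟨hx, hxs⟩ := embed_partOf hs
    obtain ⟨c, hcp, hc⟩ := exists_holds (P := P) (z := z) (partOf s) hx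
    exact ⟨c, mem_carrier_iff.mpr ⟨_, (mem_Ico_iff hz c _).mpr hc, by rw [hcp, hxs]⟩⟩

end Cell

/-! ### The contribution of one labeling -/

section Labeling

variable {P : BoundingSequence} {W₀ : ℝ → ℝ → ℝ} {z : Cube}

theorem Cell.outer_of_not_inCE {c : Cell} (h : ¬ c.InCE) : c.part.Outer := by
  cases c <;> simp [Cell.InCE] at h <;> constructor <;> simp [Cell.part]

theorem Cell.part_of_inCE {c : Cell} (h : c.InCE) : c.part = .core .C ∨ c.part = .core .E := by
  cases c <;> simp [Cell.InCE] at h <;> simp [Cell.part]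

theorem Cell.left_eq_lo {c : Cell} (h : c.part ≠ .core .E) :
    c.left P z = c.lo P ∧ c.right P z = c.hi P := by
  cases c <;> first | exact ⟨rfl, rfl⟩ | exact absurd rfl h

/-- A nonempty piece sits in a nondegenerate fixed interval, so rescaling one to the other is
bijective. -/
theorem Cell.lo_lt_hi (hz : P.Feasible z) {c : Cell} (h : c.left P z < c.right P z) :
    c.lo P < c.hi P := by
  cases c with
  | E₁ k i =>
    have hp : (0 : ℝ) < (1 / 2) ^ (k : ℕ) / 3 := by positivity
    obtain ⟨h1, h2⟩ := hz k
    simp only [Cell.left, Cell.right, Cell.lo, Cell.hi, add_lt_add_iff_left,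
      mul_lt_mul_iff_right₀ hp] at h ⊢
    fin_cases i <;> simp at h ⊢
    exacts [h, h.trans_le h2, h1.trans_lt h, h]
  | E₂ k i => exact lt_add_of_pos_right _ (by positivity)
  | E₃ k => exact h
  | C k j => exact h
  | _ => exact h

theorem affine_mem_Ico {a b t : ℝ} (hab : a < b) (ht : t ∈ Ico (0 : ℝ) 1) :
    a + (b - a) * t ∈ Ico a b := by
  have : 0 < b - a := sub_pos.mpr hab
  constructor <;> nlinarith [ht.1, ht.2]

theorem Cell.lo_mem_unit (c : Cell) {t : ℝ} (ht : t ∈ Ico (0 : ℝ) 1) :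
    c.lo P + (c.hi P - c.lo P) * t ∈ Ico (0 : ℝ) 1 := by
  have hblock : ∀ (k : ℕ+) (j : Fin 3) (a b : ℝ), a ∈ Icc (0 : ℝ) 1 → b ∈ Icc (0 : ℝ) 1 →
      blockStart k j + (1 / 2) ^ (k : ℕ) / 3 * a + (blockStart k j + (1 / 2) ^ (k : ℕ) / 3 * b -
        (blockStart k j + (1 / 2) ^ (k : ℕ) / 3 * a)) * t ∈ Ico (0 : ℝ) 1 := by
    intro k j a b ha hb
    have := blockStart_mem k j (t := a + (b - a) * t)
      ⟨by nlinarith [ht.1, ht.2, ha.1, hb.1], by nlinarith [ht.1, ht.2, ha.2, hb.2]⟩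
    convert this using 1
    ring
  have h0 : (0 : ℝ) ∈ Icc (0 : ℝ) 1 := ⟨le_rfl, zero_le_one⟩
  have h1 : (1 : ℝ) ∈ Icc (0 : ℝ) 1 := ⟨zero_le_one, le_rfl⟩
  have hl := P.l_mem
  have hu := P.u_mem
  cases c with
  | E₁ k i =>
    refine hblock k 0 _ _ ?_ ?_ <;> fin_cases i
    exacts [h0, hl k, hl k, hu k, hl k, hu k, hu k, h1]
  | E₂ k i => simpa [Cell.lo, Cell.hi] using hblock k 1 0 1 h0 h1
  | E₃ k => simpa [Cell.lo, Cell.hi] using hblock k 2 0 1 h0 h1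
  | C k j => simpa [Cell.lo, Cell.hi] using hblock k j 0 1 h0 h1
  | _ => simpa [Cell.lo, Cell.hi] using ht

theorem Cell.point_mem (c : Cell) {t : ℝ} (ht : t ∈ Ico (0 : ℝ) 1) :
    c.point P t ∈ Ico (0 : ℝ) 1 :=
  c.part.embed_mem (c.lo_mem_unit ht)

/-- The fixed interval arises from the piece by moving only endpoints at `p` or `1 - p`, which zones
ignore, and feasibility keeps `p` between `l` and `u`. -/
theorem Cell.sameZone (hz : P.Feasible z) {c : Cell} (hc : c.part = .core .E) {x y : ℝ}
    (hx : x ∈ Ico (c.left P z) (c.right P z)) (hy : y ∈ Ico (c.lo P) (c.hi P)) :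
    SameZone P x y := by
  rw [Cell.mem_Ico_iff hz] at hx
  cases c with
  | E₁ k i =>
    obtain ⟨⟨hf, hk⟩, hx⟩ := hx
    rw [Cell.lo, Cell.hi, Cell.mem_Ico_iff_relPos] at hy
    have h1 := hz k
    have h2 := P.l_mem k
    have h3 := P.u_mem k
    have hb := block_iff k 0 y
    rw [Nat.cast_zero] at hb
    obtain ⟨hf', hk'⟩ := hb.mpr ⟨le_trans (by fin_cases i <;> simp [h2.1, h3.1]) hy.1,
      hy.2.trans_le (by fin_cases i <;> simp [h2.2, h3.2])⟩
    obtain ⟨h4, h5⟩ := h1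
    refine ⟨hf.trans hf'.symm, hk.trans hk'.symm, fun _ m hm => ?_, fun _ m hm => ?_⟩
    · obtain rfl := hk.symm.trans hm
      fin_cases i <;> simp at hx hy
      · exact iff_of_true hx.2 hy.2
      · exact iff_of_false hx.1.not_gt hy.1.not_gt
      · exact iff_of_false (h4.trans hx.1).not_gt hy.1.not_gt
      · exact iff_of_false ((h4.trans h5).trans hx.1).not_gt ((h4.trans h5).trans hy.1).not_gt
    · obtain rfl := hk.symm.trans hm
      fin_cases i <;> simp at hx hy
      · exact iff_of_true (hx.2.trans_le (h4.trans h5)) (hy.2.trans_le (h4.trans h5))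
      · exact iff_of_true (hx.2.trans_le h5) hy.2
      · exact iff_of_true hx.2 hy.2
      · exact iff_of_false hx.1.not_gt hy.1.not_gt
  | E₂ k i =>
    obtain ⟨⟨hf, hk⟩, hx⟩ := hx
    obtain ⟨hf', hk'⟩ := (Cell.mem_Ico_block_iff k 1 y).mp hy
    rw [Nat.cast_one] at hf'
    refine ⟨hf.trans hf'.symm, hk.trans hk'.symm, fun h => ?_, fun h => ?_⟩ <;> omega
  | E₃ k =>
    obtain ⟨hf, hk⟩ := hx
    obtain ⟨hf', hk'⟩ := (Cell.mem_Ico_block_iff k 2 y).mp hy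
    rw [Nat.cast_ofNat] at hf'
    refine ⟨hf.trans hf'.symm, hk.trans hk'.symm, fun h => ?_, fun h => ?_⟩ <;> omega
  | _ => simp [Cell.part] at hc

/-- The point at relative position `t` of a piece avoids the jumps of the tiles, and so does the
point at relative position `t` of the interval containing it. -/
def Cell.Regular (P : BoundingSequence) (z : Cube) (c : Cell) (t : ℝ) : Prop :=
  c.left P z + (c.right P z - c.left P z) * t ∉ jumpSet P z ∧
    c.lo P + (c.hi P - c.lo P) * t ∉ jumpSet P fun _ => 0

theorem Cell.countable_not_regular (hz : P.Feasible z) {c : Cell}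
    (h : c.left P z < c.right P z) : {t | ¬ c.Regular P z t}.Countable := by
  have haff : ∀ a b : ℝ, a < b → Function.Injective fun t : ℝ => a + (b - a) * t :=
    fun a b hab s t hst =>
      mul_left_cancel₀ (sub_pos.mpr hab).ne' (add_left_cancel hst)
  refine (((countable_jumpSet P z).preimage (haff _ _ h)).union
    ((countable_jumpSet P fun _ => 0).preimage (haff _ _ (c.lo_lt_hi hz h)))).mono fun t ht => ?_
  by_contra hc
  exact ht ⟨fun h1 => hc (Or.inl h1), fun h1 => hc (Or.inr h1)⟩

/-- In `E` the two points share a zone. In `C` they coincide, and the only danger is the degree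
tile, settled by `coreDegree_C_indep`. The remaining parts never see `z`. -/
theorem tile_outer_right (hz : P.Feasible z) {c : Cell} (hc : c.left P z < c.right P z)
    {Y : Part} (hY : Y.Outer) {t : ℝ} (ht : t ∈ Ico (0 : ℝ) 1) (hr : c.Regular P z t) (s : ℝ) :
    tile P W₀ z c.part Y (c.left P z + (c.right P z - c.left P z) * t) s =
      tile P W₀ (fun _ => 0) c.part Y (c.lo P + (c.hi P - c.lo P) * t) s := by
  have hx := affine_mem_Ico hc ht
  have hx' := affine_mem_Ico (c.lo_lt_hi hz hc) ht
  by_cases hE : c.part = .core .E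
  · have hzone := Cell.sameZone hz hE hx hx'
    rw [hE]
    exact hzone.tile_eq (Cell.mem_unit hx) (c.lo_mem_unit ht) hr.1 hr.2 hY s
  · obtain ⟨h1, h2⟩ := Cell.left_eq_lo (P := P) (z := z) hE
    rw [← h1, ← h2]
    by_cases hC : c.part = .core .C
    · rw [hC]
      exact tile_C_indep hY (Cell.mem_unit hx) s
    · exact tile_indep ⟨hC, hE⟩ hY _ _

/-- Off the jumps, the tiles outside `(C ∪ E)²` take at the points of the pieces the same values as
at `z = 0`. -/
theorem WP_eq_of_not_inCE (hW : ∀ x ∈ Ico (0 : ℝ) 1, ∀ y ∈ Ico (0 : ℝ) 1, W₀ x y = W₀ y x)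
    (hz : P.Feasible z) {c d : Cell} (hcd : ¬ (c.InCE ∧ d.InCE))
    (hc : c.left P z < c.right P z) (hd : d.left P z < d.right P z) {t s : ℝ}
    (ht : t ∈ Ico (0 : ℝ) 1) (hs : s ∈ Ico (0 : ℝ) 1) (hrc : c.Regular P z t)
    (hrd : d.Regular P z s) :
    WP P W₀ z (c.part.embed (c.left P z + (c.right P z - c.left P z) * t))
      (d.part.embed (d.left P z + (d.right P z - d.left P z) * s)) =
      WP P W₀ (fun _ => 0) (c.point P t) (d.point P s) := by
  have hx := Cell.mem_unit (affine_mem_Ico hc ht)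
  have hy := Cell.mem_unit (affine_mem_Ico hd hs)
  have hx' := c.lo_mem_unit (P := P) ht
  have hy' := d.lo_mem_unit (P := P) hs
  rw [Cell.point, Cell.point, WP_embed _ _ _ _ _ hx hy, WP_embed _ _ _ _ _ hx' hy']
  by_cases h : d.InCE
  · have hco := Cell.outer_of_not_inCE fun h' => hcd ⟨h', h⟩
    obtain ⟨h1, h2⟩ := Cell.left_eq_lo (P := P) (z := z) hco.2
    rw [tile_comm hW z _ _ hx hy, tile_comm hW _ _ _ hx' hy', ← h1, ← h2]
    exact tile_outer_right hz hd hco hs hrd _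
  · have hdo := Cell.outer_of_not_inCE h
    obtain ⟨h1, h2⟩ := Cell.left_eq_lo (P := P) (z := z) hdo.2
    rw [← h1, ← h2]
    exact tile_outer_right hz hc hdo ht hrc _

theorem eval_ite_one (p : Prop) [Decidable p] (f : ℕ+ → ℝ) :
    MvPolynomial.eval f (if p then 1 else 0) = if p then 1 else 0 := by
  split_ifs <;> simp

theorem edgePoly_comm_E {c d : Cell} (hc : c.part = .core .E) (hd : d.part = .core .C) :
    edgePoly c d = edgePoly d c := by
  cases c <;> simp [Cell.part] at hc <;> cases d <;> simp [Cell.part] at hd <;> rfl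

theorem tileCC_eq_eval {k k' : ℕ+} {j j' : Fin 3} {x y : ℝ} (hx : x ∈ Ico (0 : ℝ) 1)
    (hy : y ∈ Ico (0 : ℝ) 1) (hc : (Cell.C k j).Holds P z x) (hd : (Cell.C k' j').Holds P z y) :
    tileCC z x y = MvPolynomial.eval z.val (edgePoly (.C k j) (.C k' j')) := by
  obtain ⟨hj, rfl⟩ := hc
  obtain ⟨hj', rfl⟩ := hd
  have h2 : ∀ (i : Fin 3) (x : ℝ), x ∈ Ico (0 : ℝ) 1 → ⌊3 * x⌋ = ((i : ℕ) : ℤ) →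
      (x < 2 / 3 ↔ i ≠ 2) := by
    intro i x hx hi
    have h3 : x < 2 / 3 ↔ ⌊3 * x⌋ < 2 := by
      rw [Int.floor_lt]; push_cast; constructor <;> intro h <;> linarith
    rw [h3, hi]
    fin_cases i <;> simp
  have hjj : ⌊3 * x⌋ = ⌊3 * y⌋ ↔ j = j' := by
    rw [hj, hj', Fin.ext_iff, Nat.cast_inj]
  have hm : ∀ A, MvPolynomial.eval z.val (MvPolynomial.monomial A 1) = monomialValue A z := by
    intro A
    rw [MvPolynomial.eval_monomial, one_mul]; rfl
  simp only [tileCC, edgePoly, h2 j x hx hj, h2 j' y hy hj', hjj]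
  by_cases h : coord (3 * x) = coord (3 * y) ∧ j ≠ 2 ∧ j' ≠ 2
  · rw [if_pos ⟨h.2.1, h.2.2, h.1⟩, if_pos h]
    split_ifs
    · rw [hm]
    · rw [map_sub, map_one, hm]
  · rw [if_neg fun h' => h ⟨h'.2.2, h'.1, h'.2.1⟩, if_neg h, map_zero]

/-- The pieces with `i < 2` are those below `p`, since `l ≤ p`, and those with `2 ≤ i` are above it,
since `p ≤ u`. So each piece lies on one side. -/
theorem tileCE_eq_eval (hz : P.Feasible z) {k : ℕ+} {j : Fin 3} {d : Cell}
    (hdE : d.part = .core .E) {x y : ℝ} (hx : x ∈ Ico (0 : ℝ) 1)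
    (hy : y ∈ Ico (0 : ℝ) 1) (hyz : y ∉ jumpSet P z)
    (hc : (Cell.C k j).Holds P z x) (hd : d.Holds P z y) :
    tileCE P z x y = MvPolynomial.eval z.val (edgePoly (.C k j) d) := by
  obtain ⟨hj, rfl⟩ := hc
  rw [tileCE_eq hx hy hyz]
  have hj0 : ⌊3 * x⌋ = 0 ↔ j = 0 := by
    rw [hj, Fin.ext_iff]; simp
  have hj1 : ⌊3 * x⌋ = 1 ↔ j = 1 := by
    rw [hj, Fin.ext_iff]; simp
  cases d with
  | E₁ k' i =>
    obtain ⟨⟨hf, rfl⟩, hi⟩ := hd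
    obtain ⟨h1, h2⟩ := hz (coord (3 * y))
    have hs : OnFirstSide P z y ↔ i < 2 := by
      unfold OnFirstSide
      simp only [hf, true_and, zero_ne_one, false_and, or_false]
      fin_cases i <;> simp at hi ⊢
      · exact hi.2.trans_le h1
      · exact hi.2
      · exact hi.1
      · exact h2.trans hi.1
    simp only [edgePoly, eval_ite_one, hj0, hj1, hs, hf, true_or, true_and, not_lt]
  | E₂ k' i =>
    obtain ⟨⟨hf, rfl⟩, hi⟩ := hd
    have hs : OnFirstSide P z y ↔ i = 0 := by
      unfold OnFirstSide
      simp only [hf, one_ne_zero, true_and, false_and, false_or]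
      fin_cases i <;> simp at hi ⊢
      · exact hi.2
      · linarith [hi.1]
    have hs' : i = 1 ↔ ¬ i = 0 := by omega
    simp only [edgePoly, eval_ite_one, hj0, hj1, hs, hs', hf, or_true, true_and]
  | E₃ k' =>
    obtain ⟨hf, hk⟩ := hd
    simp [edgePoly, hf]
  | _ => simp [Cell.part] at hdE

/-- Off the jumps, the tiles of `(C ∪ E)²` are constant on the products of pieces. -/
theorem WP_eq_of_inCE (hW : ∀ x ∈ Ico (0 : ℝ) 1, ∀ y ∈ Ico (0 : ℝ) 1, W₀ x y = W₀ y x)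
    (hz : P.Feasible z) {c d : Cell} (hc : c.InCE) (hd : d.InCE) {x y : ℝ}
    (hx : x ∈ Ico (c.left P z) (c.right P z)) (hy : y ∈ Ico (d.left P z) (d.right P z))
    (hxz : x ∉ jumpSet P z) (hyz : y ∉ jumpSet P z) :
    WP P W₀ z (c.part.embed x) (d.part.embed y) = MvPolynomial.eval z.val (edgePoly c d) := by
  have hxu := Cell.mem_unit hx
  have hyu := Cell.mem_unit hy
  rw [Cell.mem_Ico_iff hz] at hx hy
  have hCE : ∀ {c d : Cell} {x y : ℝ}, c.part = .core .C → d.part = .core .E →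
      x ∈ Ico (0 : ℝ) 1 → y ∈ Ico (0 : ℝ) 1 → y ∉ jumpSet P z → c.Holds P z x → d.Holds P z y →
      tile P W₀ z (.core .C) (.core .E) x y = MvPolynomial.eval z.val (edgePoly c d) := by
    intro c d x y hc hd hxu hyu hyz hx hy
    cases c <;> simp [Cell.part] at hc
    exact tileCE_eq_eval hz hd hxu hyu hyz hx hy
  rw [WP_embed _ _ _ _ _ hxu hyu]
  rcases Cell.part_of_inCE hc with hc' | hc' <;> rcases Cell.part_of_inCE hd with hd' | hd' <;>
    rw [hc', hd']
  · cases c <;> simp [Cell.part] at hc'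
    cases d <;> simp [Cell.part] at hd'
    exact tileCC_eq_eval hxu hyu hx hy
  · exact hCE hc' hd' hxu hyu hyz hx hy
  · rw [tile_comm hW z _ _ hxu hyu, edgePoly_comm_E hc' hd']
    exact hCE hd' hc' hyu hxu hxz hy hx
  · have h0 : edgePoly c d = 0 := by
      cases c <;> simp [Cell.part] at hc' <;> cases d <;> simp [Cell.part] at hd' <;> rfl
    rw [h0, map_zero]
    rfl

variable {n : ℕ} (H : SimpleGraph (Fin n))

/-- The integrand of the labeled density. -/
def densityIntegrand (W : ℝ → ℝ → ℝ) (x : Fin n → ℝ) : ℝ :=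
  ∏ q ∈ vertexPairs n, if H.Adj q.1 q.2 then W (x q.1) (x q.2) else 1 - W (x q.1) (x q.2)

/-- Rescaling the box to the unit box produces the product of the measures. The pairs inside `C ∪ E`
then contribute constants, and the others give the integrand of `outerProb`. -/
theorem integral_carrier (hW : ∀ x ∈ Ico (0 : ℝ) 1, ∀ y ∈ Ico (0 : ℝ) 1, W₀ x y = W₀ y x)
    (hz : P.Feasible z) (L : Fin n → Cell) :
    ∫ x in univ.pi fun v => (L v).carrier P z, densityIntegrand H (WP P W₀ z) x =
      MvPolynomial.eval z.val (labeledPoly P W₀ H L) := by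
  have hle : ∀ v, (L v).part.embed ((L v).left P z) ≤ (L v).part.embed ((L v).right P z) := by
    intro v
    have := (L v).part.size_pos
    have := (L v).left_le_right hz
    unfold Part.embed
    gcongr
  have hlen : ∀ v, (L v).part.embed ((L v).right P z) - (L v).part.embed ((L v).left P z) =
      MvPolynomial.eval z.val ((L v).measurePoly P) := by
    intro v
    rw [← Cell.size_mul_right_sub_left]
    unfold Part.embed
    ring
  unfold Cell.carrier
  rw [integral_pi_Ico hle, labeledPoly, map_mul, map_mul, MvPolynomial.eval_C, map_prod, map_prod]
  simp only [hlen]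
  -- An empty piece has measure polynomial vanishing at `z`, so both sides are zero and no rescaling
  -- is needed.
  by_cases hdeg : ∃ v, ¬ (L v).left P z < (L v).right P z
  · obtain ⟨v, hv⟩ := hdeg
    have h0 : MvPolynomial.eval z.val ((L v).measurePoly P) = 0 := by
      rw [← Cell.size_mul_right_sub_left, le_antisymm ((L v).left_le_right hz) (not_lt.mp hv),
        sub_self, mul_zero]
    rw [Finset.prod_eq_zero (Finset.mem_univ v) h0]
    ring
  push Not at hdeg
  have hpt : ∀ (v : Fin n) (t : ℝ), (L v).part.embed ((L v).left P z) +
      MvPolynomial.eval z.val ((L v).measurePoly P) * t =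
      (L v).part.embed ((L v).left P z + ((L v).right P z - (L v).left P z) * t) := by
    intro v t
    rw [← Cell.size_mul_right_sub_left]
    unfold Part.embed
    ring
  simp only [hpt]
  -- Each coordinate has countably many bad values, and coordinate projections pull null sets back
  -- to null sets.
  have hreg : ∀ᵐ t : Fin n → ℝ, ∀ v, (L v).Regular P z (t v) := by
    rw [ae_all_iff]
    intro v
    have h := ((L v).countable_not_regular hz (hdeg v)).ae_notMem volume
    have h' := (Measure.quasiMeasurePreserving_eval (fun _ : Fin n => (volume : Measure ℝ)) v).ae h
    filter_upwards [h'] with t ht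
    exact not_not.mp ht
  have hmeas : MeasurableSet (unitBox n) := MeasurableSet.univ_pi fun _ => measurableSet_Ico
  have hint : ∫ t in unitBox n, densityIntegrand H (WP P W₀ z) (fun v =>
        (L v).part.embed ((L v).left P z + ((L v).right P z - (L v).left P z) * t v)) =
      ∫ t in unitBox n, (∏ q ∈ (vertexPairs n).filter fun q => (L q.1).InCE ∧ (L q.2).InCE,
        MvPolynomial.eval z.val (if H.Adj q.1 q.2 then edgePoly (L q.1) (L q.2)
          else 1 - edgePoly (L q.1) (L q.2))) *
        ∏ q ∈ (vertexPairs n).filter fun q => ¬ ((L q.1).InCE ∧ (L q.2).InCE),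
          if H.Adj q.1 q.2 then
            WP P W₀ (fun _ => 0) ((L q.1).point P (t q.1)) ((L q.2).point P (t q.2))
          else 1 - WP P W₀ (fun _ => 0) ((L q.1).point P (t q.1)) ((L q.2).point P (t q.2)) := by
    refine setIntegral_congr_ae hmeas ?_
    filter_upwards [hreg] with t ht htu
    rw [densityIntegrand, ← Finset.prod_filter_mul_prod_filter_not (vertexPairs n)
      fun q => (L q.1).InCE ∧ (L q.2).InCE]
    have hu : ∀ v, t v ∈ Ico (0 : ℝ) 1 := fun v => htu v (mem_univ v)
    congr 1
    · refine Finset.prod_congr rfl fun q hq => ?_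
      obtain ⟨-, h1, h2⟩ := Finset.mem_filter.mp hq
      rw [WP_eq_of_inCE hW hz h1 h2 (affine_mem_Ico (hdeg q.1) (hu q.1))
        (affine_mem_Ico (hdeg q.2) (hu q.2)) (ht q.1).1 (ht q.2).1]
      split_ifs
      · rfl
      · rw [map_sub, map_one]
    · refine Finset.prod_congr rfl fun q hq => ?_
      rw [WP_eq_of_not_inCE hW hz (Finset.mem_filter.mp hq).2 (hdeg q.1) (hdeg q.2) (hu q.1)
        (hu q.2) (ht q.1) (ht q.2)]
  rw [hint, integral_const_mul, outerProb]
  ring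

/-! ### Summation over the labelings -/

theorem measurable_densityIntegrand {W : ℝ → ℝ → ℝ}
    (hW : Measurable fun q : ℝ × ℝ => W q.1 q.2) : Measurable (densityIntegrand H W) := by
  refine Finset.measurable_fun_prod _ fun q _ => ?_
  have h : Measurable fun x : Fin n → ℝ => W (x q.1) (x q.2) :=
    hW.comp (show Measurable fun x : Fin n → ℝ => (x q.1, x q.2) by fun_prop)
  split_ifs
  · exact h
  · exact measurable_const.sub h

theorem integrableOn_densityIntegrand {W : ℝ → ℝ → ℝ} (hW : IsGraphon W) :
    IntegrableOn (densityIntegrand H W) (unitBox n) := by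
  obtain ⟨W₁, hm, hW₁⟩ := hW.exists_measurable
  have hmeas : MeasurableSet (unitBox n) := MeasurableSet.univ_pi fun _ => measurableSet_Ico
  have hvol : volume (unitBox n) ≠ ⊤ := by simp [unitBox, volume_pi_pi]
  have heq : EqOn (densityIntegrand H W₁) (densityIntegrand H W) (unitBox n) := fun x hx => by
    unfold densityIntegrand
    refine Finset.prod_congr rfl fun q _ => ?_
    rw [hW₁ _ (hx q.1 (mem_univ _)) _ (hx q.2 (mem_univ _))]
  refine IntegrableOn.congr_fun ?_ heq hmeas
  refine Measure.integrableOn_of_bounded (M := 1) hvol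
    (measurable_densityIntegrand H hm).aestronglyMeasurable ?_
  refine (ae_restrict_iff' hmeas).mpr (Filter.Eventually.of_forall fun x hx => ?_)
  rw [heq hx, Real.norm_eq_abs, densityIntegrand, Finset.abs_prod]
  refine Finset.prod_le_one (fun _ _ => abs_nonneg _) fun q _ => ?_
  have h1 := hW.mem _ (hx q.1 (mem_univ _)) _ (hx q.2 (mem_univ _))
  split_ifs <;> rw [abs_le] <;> constructor <;> linarith [h1.1, h1.2]

/-- The boxes of the countably many labelings partition the unit box, so countable additivity of the
integral applies. -/
theorem hasSum_labeledDensity (hW₀ : ∀ x ∈ Ico (0 : ℝ) 1, ∀ y ∈ Ico (0 : ℝ) 1, W₀ x y = W₀ y x)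
    (hz : P.Feasible z) (hWP : IsGraphon (WP P W₀ z)) :
    HasSum (fun L : Fin n → Cell => MvPolynomial.eval z.val (labeledPoly P W₀ H L))
      (labeledDensity H (WP P W₀ z)) := by
  have hbox : unitBox n = ⋃ L : Fin n → Cell, univ.pi fun v => (L v).carrier P z := by
    ext x
    simp only [unitBox, ← Cell.iUnion_carrier hz, mem_iUnion, mem_univ_pi]
    exact Classical.skolem
  have hmeas : ∀ L : Fin n → Cell, MeasurableSet (univ.pi fun v => (L v).carrier P z) := fun L =>
    MeasurableSet.univ_pi fun v => measurableSet_Ico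
  have hdisj : Pairwise (Function.onFun Disjoint fun L : Fin n → Cell =>
      univ.pi fun v => (L v).carrier P z) := by
    intro L L' hL
    obtain ⟨v, hv⟩ := Function.ne_iff.mp hL
    rw [Function.onFun, Set.disjoint_left]
    intro x hx hx'
    exact Set.disjoint_left.mp (Cell.disjoint_carrier hz hv) (hx v (mem_univ v))
      (hx' v (mem_univ v))
  have hint := integrableOn_densityIntegrand H hWP
  have h := hasSum_integral_iUnion hmeas hdisj (hbox ▸ hint)
  rw [← hbox] at h
  simp only [integral_carrier H hW₀ hz] at h
  exact h

end Labeling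

/-! ### The functions `t_{P,H}` -/

section Series

variable {P : BoundingSequence} {W₀ : ℝ → ℝ → ℝ} {n : ℕ} {H : SimpleGraph (Fin n)} {r : ℝ}

theorem summable_coeff_labeledPoly (hr : 1 ≤ r)
    (hs : Summable fun L : Fin n → Cell => wnorm r (labeledPoly P W₀ H L)) (A : ℕ+ →₀ ℕ) :
    Summable fun L : Fin n → Cell => (labeledPoly P W₀ H L).coeff A :=
  Summable.of_norm_bounded hs fun _ => abs_coeff_le_wnorm hr _ A

theorem summable_wnorm_sigma (hr : 1 ≤ r)
    (hs : Summable fun L : Fin n → Cell => wnorm r (labeledPoly P W₀ H L)) :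
    Summable fun q : (Fin n → Cell) × (ℕ+ →₀ ℕ) =>
      |(labeledPoly P W₀ H q.1).coeff q.2| * r ^ msum q.2 := by
  have hr0 : 0 ≤ r := zero_le_one.trans hr
  have h0 : ∀ q : (Fin n → Cell) × (ℕ+ →₀ ℕ),
      0 ≤ |(labeledPoly P W₀ H q.1).coeff q.2| * r ^ msum q.2 := fun q =>
    mul_nonneg (abs_nonneg _) (pow_nonneg hr0 _)
  refine (summable_prod_of_nonneg h0).mpr ⟨fun L => ?_, ?_⟩
  · exact (hasSum_wnorm (labeledPoly P W₀ H L)).summable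
  · have h1 : ∀ L, ∑' A, |(labeledPoly P W₀ H L).coeff A| * r ^ msum A =
        wnorm r (labeledPoly P W₀ H L) := fun L => (hasSum_wnorm (labeledPoly P W₀ H L)).tsum_eq
    simpa only [h1] using hs

/-- Exchanging the sums over labelings and monomials turns summability of the norms into a weighted
bound on the summed coefficients. -/
theorem overConvergent_tsum_coeff (hr : 1 < r)
    (hs : Summable fun L : Fin n → Cell => wnorm r (labeledPoly P W₀ H L)) :
    OverConvergent fun A => ∑' L : Fin n → Cell, (labeledPoly P W₀ H L).coeff A := by
  have hr0 : 0 ≤ r := by linarith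
  have h := (summable_wnorm_sigma hr.le hs).prod_symm.prod
  refine ⟨r, hr, Summable.of_nonneg_of_le (fun A => by positivity) (fun A => ?_) h⟩
  have h1 := (summable_coeff_labeledPoly hr.le hs A).norm
  simp only [Prod.swap, tsum_mul_right]
  exact mul_le_mul_of_nonneg_right (norm_tsum_le_tsum_norm h1) (by positivity)

theorem tFun_eq_seriesSum : tFun P W₀ H =
    seriesSum fun A => ∑' L : Fin n → Cell, (labeledPoly P W₀ H L).coeff A := by
  funext z
  exact multisetEquiv.tsum_eq fun A =>
    (∑' L : Fin n → Cell, (labeledPoly P W₀ H L).coeff A) * monomialValue A z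

/-- Fubini for the absolutely summable double family of coefficients; feasibility plays no role. -/
theorem tFun_eq_tsum_eval (hr : 1 < r)
    (hs : Summable fun L : Fin n → Cell => wnorm r (labeledPoly P W₀ H L)) (z : Cube) :
    tFun P W₀ H z =
      ∑' L : Fin n → Cell, MvPolynomial.eval z.val (labeledPoly P W₀ H L) := by
  have hbound : ∀ q : (Fin n → Cell) × (ℕ+ →₀ ℕ),
      ‖(labeledPoly P W₀ H q.1).coeff q.2 * monomialValue q.2 z‖ ≤
        |(labeledPoly P W₀ H q.1).coeff q.2| * r ^ msum q.2 := fun q =>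
    (abs_mul_monomialValue_le _ q.2 z).trans
      (le_mul_of_one_le_right (abs_nonneg _) (one_le_pow₀ hr.le))
  have h := Summable.of_norm_bounded (summable_wnorm_sigma hr.le hs) hbound
  have hcomm : ∑' A, ∑' L : Fin n → Cell, (labeledPoly P W₀ H L).coeff A * monomialValue A z =
      ∑' L : Fin n → Cell, ∑' A, (labeledPoly P W₀ H L).coeff A * monomialValue A z :=
    Summable.tsum_comm h
  rw [tFun_eq_seriesSum, seriesSum]
  simp only [← tsum_mul_right]
  rw [hcomm]
  exact tsum_congr fun L => (hasSum_eval (labeledPoly P W₀ H L) z).tsum_eq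

theorem summable_alpha (h : OverConvergent fun A =>
    ∑' L : Fin n → Cell, (labeledPoly P W₀ H L).coeff A) (z : Cube) :
    Summable fun i : ℕ+ => alpha P W₀ H i * monomialValue (multiset i) z :=
  (multisetEquiv.summable_iff (f := fun A =>
    (∑' L : Fin n → Cell, (labeledPoly P W₀ H L).coeff A) * monomialValue A z)).mpr (h.summable z)

end Series

end

end GraphonFamily

open GraphonFamily
theorem mainTheorem4 (n : ℕ) (H : SimpleGraph (Fin n)) (P : BoundingSequence)
    (W₀ : ℝ → ℝ → ℝ) (hW₀ : IsGraphon W₀)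
    (hG : ∀ x ∈ Ico (0 : ℝ) 1, ∀ y ∈ Ico (0 : ℝ) 1,
      W₀ (hostEmbed 6 x) (hostEmbed 6 y) = WF P x y) :
    (∀ i : ℕ+, Summable fun L : Fin n → Cell =>
      (labeledPoly P W₀ H L).coeff (multiset i)) ∧
    (∀ z : Cube, Summable fun i : ℕ+ => alpha P W₀ H i * monomialValue (multiset i) z) ∧
    TotallyAnalytic (tFun P W₀ H) ∧
    (∀ z : Cube, IsGraphon (WP P W₀ z)) ∧
    ∀ z : Cube, P.Feasible z → tFun P W₀ H z = labeledDensity H (WP P W₀ z) := by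
  have hgraphon := isGraphon_WP hW₀ hG
  obtain ⟨r, hr, hs⟩ := exists_summable_wnorm_labeledPoly P W₀ H fun L =>
    abs_outerProb_le P W₀ H (hgraphon _).mem (fun c t ht => c.point_mem ht) L
  have hconv := overConvergent_tsum_coeff hr hs
  refine ⟨fun i => summable_coeff_labeledPoly hr.le hs _, fun z => ?_, ?_, hgraphon,
    fun z hz => ?_⟩
  · exact summable_alpha hconv z
  · rw [tFun_eq_seriesSum]
    exact hconv.totallyAnalytic
  · rw [tFun_eq_tsum_eval hr hs]
    exact (hasSum_labeledDensity H hW₀.symm hz (hgraphon z)).tsum_eq
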